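/- Throughout, $d,k\in\mathbb N$, $T>0$, $p\in(2,3)$, and $\Delta_T=\{(s,t):0\le s\le t\le T\}$. For a path $X$ write $X_{s,t}=X_t-X_s$, and for $q\ge1$ and a path or a two-parameter function $\Xi$ on $\Delta_T$ let $\|\Xi\|_q=\big(\sup_{\mathcal P}\sum_{[u,v]\in\mathcal P}|\Xi_{u,v}|^q\big)^{1/q}$, the supremum being over all partitions $\mathcal P$ of $[0,T]$. A càdlàg $p$-rough path over $\mathbb R^d$ is a pair $\mathbf X=(X,\mathbb X)$, where $X\colon[0,T]\to\mathbb R^d$ is càdlàg with $\|X\|_p<\infty$, and $\mathbb X\colon\Delta_T\to\mathbb R^{d\times d}$ is càdlàg in each variable with $\|\mathbb X\|_{p/2}<\infty$, and $\mathbb X_{s,t}=\mathbb X_{s,u}+\mathbb X_{u,t}+X_{s,u}\otimes X_{u,t}$ for all $0\le s\le u\le t\le T$. Put $\|\mathbf X\|_p=\|X\|_p+\|\mathbb X\|_{p/2}$ and $\|\mathbf X;\tilde{\mathbf X}\|_p=\|X-\tilde X\|_p+\|\mathbb X-\tilde{\mathbb X}\|_{p/2}$. A pair $(Y,Y')$ of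 càdlàg paths of finite $p$-variation with values in $\mathbb R^k$ and $\mathcal L(\mathbb R^d;\mathbb R^k)$, respectively, is a controlled path with respect to $X$, written $(Y,Y')\in\mathcal V^p_X$, if $R^Y_{s,t}:=Y_{s,t}-Y'_sX_{s,t}$ is càdlàg in each variable with $\|R^Y\|_{p/2}<\infty$. Put $\|Y,Y'\|_{X,p}=|Y'_0|+\|Y'\|_p+\|R^Y\|_{p/2}$ and $\|Y,Y';\tilde Y,\tilde Y'\|_{X,\tilde X,p}=|Y'_0-\tilde Y'_0|+\|Y'-\tilde Y'\|_p+\|R^Y-R^{\tilde Y}\|_{p/2}$ for $(Y,Y')\in\mathcal V^p_X$ and $(\tilde Y,\tilde Y')\in\mathcal V^p_{\tilde X}$. $C^n_b=C^n_b(\mathbb R^k;\mathcal L(\mathbb R^d;\mathbb R^k))$ is the space of functions that are continuous and bounded together with all their Fréchet derivatives up to order $n$, with the norm $\|f\|_{C^n_b}=\sum_{r=0}^n\|\mathrm D^rf\|_\infty$. For $f\in C^3_b$ and $y_0\in\mathbb R^k$, a solution of the RDE $$Y_t=y_0+\int_0^tf(Y_s)\,\mathrm d\mathbf X_s,\qquad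 t\in[0,T],\tag{1}$$ is a controlled path $(Y,Y')\in\mathcal V^p_X$ with $Y'=f(Y)$ that satisfies (1) for every $t\in[0,T]$, where the forward rough integral is $$\int_0^tf(Y_s)\,\mathrm d\mathbf X_s=\lim_{|\mathcal P|\to0}\sum_{[u,v]\in\mathcal P}\big(f(Y_u)X_{u,v}+\mathrm Df(Y_u)Y'_u\,\mathbb X_{u,v}\big),$$ the limit being over partitions $\mathcal P$ of $[0,t]$ with mesh tending to zero, and $\mathcal L(\mathbb R^d;\mathcal L(\mathbb R^d;\mathbb R^k))$ being identified with $\mathcal L(\mathbb R^d\otimes\mathbb R^d;\mathbb R^k)$. **Corollary 3.1.** (i) For every $f\in C^3_b$, $y_0\in\mathbb R^k$ and every càdlàg $p$-rough path $\mathbf X$ over $\mathbb R^d$, there exists a unique solution $(Y,Y')$ of (1). Moreover, there is a componentwise non-decreasing function $K_p\colon[0,\infty)^2\to[0,\infty)$, depending only on $p$, $d$ and $k$, such that $$\|Y,Y'\|_{X,p}\le K_p\big(\|f\|_{C^2_b},\|\mathbf X\|_p\big).$$ (ii) Let $(Y,Y')$ be the solution of (1) with data $(y_0,f,\mathbf X)$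 and let $(\tilde Y,\tilde Y')$ be the solution with data $(\tilde y_0,\tilde f,\tilde{\mathbf X})$, where $\tilde y_0\in\mathbb R^k$, $\tilde f\in C^3_b$ and $\tilde{\mathbf X}$ is a càdlàg $p$-rough path over $\mathbb R^d$. If $\|Y,Y'\|_{X,p}\le K$ and $\|\tilde Y,\tilde Y'\|_{\tilde X,p}\le K$ for some $K>0$, then $$|Y_0-\tilde Y_0|+\|Y,Y';\tilde Y,\tilde Y'\|_{X,\tilde X,p}\le C\,\big(|y_0-\tilde y_0|+\|f-\tilde f\|_{C^2_b}+\|\mathbf X;\tilde{\mathbf X}\|_p\big),$$ where $C>0$ depends only on $d$, $k$, $p$, $\|f\|_{C^3_b}\vee\|\tilde f\|_{C^3_b}$, $K$, $\|\mathbf X\|_p$ and $\|\tilde{\mathbf X}\|_p$, and is bounded when, for fixed $d,k$, the remaining five quantities range over compact subsets of $(2,3)$, $[0,\infty)$, $(0,\infty)$, $[0,\infty)$ and $[0,\infty)$, respectively. -/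

import Mathlib

open Set Filter Topology
open scoped NNReal ENNReal

noncomputable section

namespace CadlagRDE

/-- The Euclidean space `ℝ^n`. -/
abbrev Vec (n : ℕ) : Type := EuclideanSpace ℝ (Fin n)

/-- The space `ℝ^{d×d}` with its Euclidean (Frobenius) norm. -/
abbrev Tens (d : ℕ) : Type := EuclideanSpace ℝ (Fin d × Fin d)

/-- A finite partition `a = π₀ < π₁ < ⋯ < πₙ = b` of the interval `[a, b]`
(the values of `pts` after the index `n` play no role). -/
structure Partition (a b : ℝ) where
  n : ℕ
  pts : ℕ → ℝ
  first : pts 0 = a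
  last : pts n = b
  lt_succ : ∀ i < n, pts i < pts (i + 1)

section Paths

variable {E : Type*} [NormedAddCommGroup E]

/-- `f` is càdlàg on `[a, b]`: right-continuous, with left limits. -/
def IsCadlagOn (f : ℝ → E) (a b : ℝ) : Prop :=
  (∀ t ∈ Ico a b, ContinuousWithinAt f (Ici t) t) ∧
    ∀ t ∈ Ioc a b, ∃ l : E, Tendsto f (𝓝[<] t) (𝓝 l)

/-- The increments `X_{s,t} = X_t - X_s` of a path. -/
def incr (X : ℝ → E) (s t : ℝ) : E := X t - X s

/-- The `p`-variation over `[a, b]` of a two-parameter function, with values in `[0, ∞]`. -/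
def eVar (p : ℝ) (Ξ : ℝ → ℝ → E) (a b : ℝ) : ℝ≥0∞ :=
  (⨆ π : Partition a b, ∑ i ∈ Finset.range π.n, ‖Ξ (π.pts i) (π.pts (i + 1))‖ₑ ^ p) ^ (1 / p)

/-- The `p`-variation as a real number; it is used for functions of finite `p`-variation. -/
def pVar (p : ℝ) (Ξ : ℝ → ℝ → E) (a b : ℝ) : ℝ := (eVar p Ξ a b).toReal

/-- The space `D^p([0,T]; E)` of càdlàg paths of finite `p`-variation. -/
def MemD (p T : ℝ) (X : ℝ → E) : Prop :=
  IsCadlagOn X 0 T ∧ eVar p (incr X) 0 T < ∞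

/-- The space `D_2^q(Δ_T; E)` of two-parameter functions of finite `q`-variation
that are càdlàg in each of the two variables on the simplex `0 ≤ s ≤ t ≤ T`. -/
def MemD2 (q T : ℝ) (Ξ : ℝ → ℝ → E) : Prop :=
  (∀ t ∈ Icc 0 T, IsCadlagOn (fun s => Ξ s t) 0 t) ∧
  (∀ s ∈ Icc 0 T, IsCadlagOn (fun t => Ξ s t) s T) ∧
  eVar q Ξ 0 T < ∞

end Paths

/-- A càdlàg `p`-rough path `(X, 𝕏)` over `ℝ^d` on `[0, T]`. -/
structure RoughPath (d : ℕ) (p T : ℝ) where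
  path : ℝ → Vec d
  area : ℝ → ℝ → Tens d
  path_mem : MemD p T path
  area_mem : MemD2 (p / 2) T area
  chen : ∀ s u t : ℝ, 0 ≤ s → s ≤ u → u ≤ t → t ≤ T → ∀ i j : Fin d,
    area s t (i, j) = area s u (i, j) + area u t (i, j) + incr path s u i * incr path u t j

/-- The seminorm `‖X‖_p + ‖𝕏‖_{p/2}` of a rough path. -/
def RoughPath.norm {d : ℕ} {p T : ℝ} (X : RoughPath d p T) : ℝ :=
  pVar p (incr X.path) 0 T + pVar (p / 2) X.area 0 T

/-- The distance `‖X - X̃‖_p + ‖𝕏 - 𝕏̃‖_{p/2}` of two rough paths. -/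
def RoughPath.dist {d : ℕ} {p T : ℝ} (X Z : RoughPath d p T) : ℝ :=
  pVar p (incr (fun t => X.path t - Z.path t)) 0 T +
    pVar (p / 2) (fun s t => X.area s t - Z.area s t) 0 T

section Controlled

variable {d : ℕ} {E : Type*} [NormedAddCommGroup E] [NormedSpace ℝ E]

/-- The remainder `R^Y_{s,t} = Y_{s,t} - Y'_s X_{s,t}`. -/
def remainder (X : ℝ → Vec d) (Y : ℝ → E) (Y' : ℝ → Vec d →L[ℝ] E) (s t : ℝ) : E :=
  incr Y s t - Y' s (incr X s t)

/-- `(Y, Y')` is an `E`-valued controlled path with respect to `X` on `[0, T]`. -/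
structure IsControlled (p T : ℝ) (X : ℝ → Vec d) (Y : ℝ → E) (Y' : ℝ → Vec d →L[ℝ] E) :
    Prop where
  path : MemD p T Y
  deriv : MemD p T Y'
  rem : MemD2 (p / 2) T (remainder X Y Y')

/-- `‖Y, Y'‖_{X,p} = |Y'_0| + ‖Y'‖_p + ‖R^Y‖_{p/2}`. -/
def controlledNorm (p T : ℝ) (X : ℝ → Vec d) (Y : ℝ → E) (Y' : ℝ → Vec d →L[ℝ] E) : ℝ :=
  ‖Y' 0‖ + pVar p (incr Y') 0 T + pVar (p / 2) (remainder X Y Y') 0 T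

/-- `‖Y, Y'; Z, Z'‖_{X,W,p} = |Y'_0 - Z'_0| + ‖Y' - Z'‖_p + ‖R^Y - R^Z‖_{p/2}`, where `(Y, Y')` is
controlled by `X` and `(Z, Z')` is controlled by `W`. -/
def controlledDist (p T : ℝ) (X W : ℝ → Vec d) (Y : ℝ → E) (Y' : ℝ → Vec d →L[ℝ] E)
    (Z : ℝ → E) (Z' : ℝ → Vec d →L[ℝ] E) : ℝ :=
  ‖Y' 0 - Z' 0‖ + pVar p (incr (fun t => Y' t - Z' t)) 0 T +
    pVar (p / 2) (fun s t => remainder X Y Y' s t - remainder W Z Z' s t) 0 T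

end Controlled

/-- The identification of `L(ℝ^d; L(ℝ^d; F))` with `L(ℝ^d ⊗ ℝ^d; F)`, under which
`A (x ⊗ y) = (A x) y`. -/
def tensApply {d : ℕ} {F : Type*} [NormedAddCommGroup F] [NormedSpace ℝ F]
    (A : Vec d →L[ℝ] Vec d →L[ℝ] F) (M : Tens d) : F :=
  ∑ i, ∑ j, M (i, j) • A (EuclideanSpace.single i 1) (EuclideanSpace.single j 1)

/-- `I` is the forward rough integral `∫_a^b V_r d𝐗_r`, that is, the limit of the compensated
left-point Riemann sums as the mesh of the partition of `[a, b]` tends to zero. -/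
def HasRoughIntegral {d : ℕ} {p T : ℝ} {F : Type*} [NormedAddCommGroup F] [NormedSpace ℝ F]
    (X : RoughPath d p T) (V : ℝ → Vec d →L[ℝ] F) (V' : ℝ → Vec d →L[ℝ] Vec d →L[ℝ] F)
    (a b : ℝ) (I : F) : Prop :=
  ∀ ε > 0, ∃ δ > 0, ∀ π : Partition a b, (∀ i < π.n, π.pts (i + 1) - π.pts i < δ) →
    ‖∑ i ∈ Finset.range π.n,
        (V (π.pts i) (incr X.path (π.pts i) (π.pts (i + 1))) +
          tensApply (V' (π.pts i)) (X.area (π.pts i) (π.pts (i + 1)))) - I‖ < ε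

section Coefficients

variable {E F : Type*} [NormedAddCommGroup E] [NormedSpace ℝ E]
  [NormedAddCommGroup F] [NormedSpace ℝ F]

/-- `f ∈ C^n_b`: all derivatives of `f` up to order `n` exist, are continuous and bounded. -/
def MemCb (n : ℕ) (f : E → F) : Prop :=
  ContDiff ℝ n f ∧ ∀ r ≤ n, ∃ M : ℝ, ∀ x, ‖iteratedFDeriv ℝ r f x‖ ≤ M

/-- `‖f‖_{C^n_b} = ‖f‖_∞ + ‖Df‖_∞ + ⋯ + ‖D^n f‖_∞`; it is used for `f ∈ C^n_b`. -/
def cbNorm (n : ℕ) (f : E → F) : ℝ :=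
  ∑ r ∈ Finset.range (n + 1), ⨆ x, ‖iteratedFDeriv ℝ r f x‖

end Coefficients

/-- `(Y, Y')` solves `Y_t = y₀ + ∫_0^t f(Y_s) d𝐗_s` on `[0, T]`: it is a path controlled by `X` with
`Y' = f(Y)`, and the integral is the rough integral of the controlled path `(f(Y), Df(Y) Y')`. -/
structure IsSolution {d k : ℕ} {p T : ℝ} (X : RoughPath d p T)
    (f : Vec k → Vec d →L[ℝ] Vec k) (y₀ : Vec k)
    (Y : ℝ → Vec k) (Y' : ℝ → Vec d →L[ℝ] Vec k) : Prop where
  controlled : IsControlled p T X.path Y Y'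
  deriv_eq : ∀ t ∈ Icc 0 T, Y' t = f (Y t)
  integral_eq : ∀ t ∈ Icc 0 T,
    HasRoughIntegral X (fun s => f (Y s)) (fun s => (fderiv ℝ f (Y s)).comp (Y' s)) 0 t (Y t - y₀)

/-- The range of the variables `(p, ‖f‖_{C³_b} ∨ ‖f̃‖_{C³_b}, K, ‖𝐗‖_p, ‖𝐗̃‖_p)`. -/
def paramRange : Set (ℝ × ℝ × ℝ × ℝ × ℝ) :=
  Ioo 2 3 ×ˢ Ici 0 ×ˢ Ioi 0 ×ˢ Ici 0 ×ˢ Ici 0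

end CadlagRDE

end

/-! Solutions are constructed by Davie's method, as limits of discrete schemes, and not by a fixed
point. The core estimates concern sequences indexed by ℕ; paths enter only by sampling along
partitions. Over [s,t] a solution started at y should move by the germ f(y)X_{s,t} +
Df(y)f(y)𝕏_{s,t}. Let J_{s,t} be the error of this approximation, and let ω be a superadditive
control built from the variations of X and 𝕏. By Chen's relation the defect J_{s,t} - J_{s,u} -
J_{u,t} is of order ω^{3/p}, up to a small multiple of J_{s,u}. Since 3/p > 1, such defects can be
summed over successive bisections (`IsControl.sewing_le`).

Jumps make ω discontinuous, so an interval cannot be cut exactly in half. It is cut instead into two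
pieces carrying at most half of ω each, and one single partition step between them, on which the
error is known. In the same way a long interval is cut into boundedly many blocks of small control,
joined by single steps that may be large (`IsControl.block_induction`).

Existence: the second order Euler scheme satisfies bounds that do not depend on the partition
(`exists_apriori`), and compactness gives a path with the same bounds (`exists_davie_path`). Its
Riemann sums converge as the mesh tends to zero. Cells of small control contribute B ω^{3/p}, which
has a small sum. The remaining cells straddle one of finitely many times, and the germ error over
such a cell is small because it is governed by the control before the jump and the control from the
jump onwards, not by the jump itself (`exists_norm_germ_error_le`, `sum_norm_le_of_locallySmall`).
Only f, Df and the Lipschitz constant of Df are used, hence a bound in terms of the C²_b norm.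

Stability: two arbitrary solutions are known only through convergence of Riemann sums. The
Saks–Henstock lemma (`IsMeshIntegral.exists_sum_norm_le`) shows that along fine partitions the germ
errors have arbitrarily small total norm, so both solutions solve the discrete equation up to a
negligible error. Sewing the difference of the two errors and a discrete Gronwall argument over
blocks (`exists_stability`) then compare them (`exists_pathwise_stability`); here D²f must be
Lipschitz. Uniqueness is the case of equal data. The constants see the paths only through a bound
for ω(0,T), and are uniform in p away from 3. -/

namespace CadlagRDE

/-! ### Taylor estimates and second differences of bounded smooth maps -/

section Calculus

variable {E F : Type*} [NormedAddCommGroup E] [NormedSpace ℝ E]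
  [NormedAddCommGroup F] [NormedSpace ℝ F]

/-- `f` and its derivative are bounded by `M`, and the derivative is `M`-Lipschitz. -/
structure BoundC2 (f : E → F) (M : ℝ) : Prop where
  diff : Differentiable ℝ f
  bound : ∀ x, ‖f x‖ ≤ M
  fderiv_bound : ∀ x, ‖fderiv ℝ f x‖ ≤ M
  fderiv_lip : ∀ x y, ‖fderiv ℝ f x - fderiv ℝ f y‖ ≤ M * ‖x - y‖

theorem norm_sub_le_of_fderiv_le {f : E → F} {M : ℝ} (hf : Differentiable ℝ f)
    (h : ∀ x, ‖fderiv ℝ f x‖ ≤ M) (x y : E) : ‖f x - f y‖ ≤ M * ‖x - y‖ :=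
  convex_univ.norm_image_sub_le_of_norm_fderiv_le (𝕜 := ℝ) (fun x _ => hf x) (fun x _ => h x)
    (mem_univ y) (mem_univ x)

namespace BoundC2

variable {f g : E → F} {M θ : ℝ}

theorem nonneg (hf : BoundC2 f M) : 0 ≤ M := (norm_nonneg _).trans (hf.bound 0)

theorem mono {M' : ℝ} (hf : BoundC2 f M) (h : M ≤ M') : BoundC2 f M' where
  diff := hf.diff
  bound x := (hf.bound x).trans h
  fderiv_bound x := (hf.fderiv_bound x).trans h
  fderiv_lip x y := (hf.fderiv_lip x y).trans (by gcongr)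

theorem lip (hf : BoundC2 f M) (x y : E) : ‖f x - f y‖ ≤ M * ‖x - y‖ :=
  norm_sub_le_of_fderiv_le hf.diff hf.fderiv_bound x y

/-- This is the mean value inequality for `f - fderiv ℝ f x` on the ball of radius `r` around `x`,
where the derivative of that map is at most `M * r`. -/
theorem taylor_segment (hf : BoundC2 f M) (x y z : E) {r : ℝ} (hy : ‖y - x‖ ≤ r)
    (hz : ‖z - x‖ ≤ r) : ‖f z - f y - fderiv ℝ f x (z - y)‖ ≤ M * r * ‖z - y‖ := by
  refine (convex_closedBall x r).norm_image_sub_le_of_norm_fderiv_le' (𝕜 := ℝ)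
    (fun u _ => hf.diff u) (fun u hu => ?_) (by simpa [dist_eq_norm] using hy)
    (by simpa [dist_eq_norm] using hz)
  refine (hf.fderiv_lip u x).trans ?_
  have := hf.nonneg
  gcongr
  simpa [dist_eq_norm] using hu

theorem taylor (hf : BoundC2 f M) (x z : E) :
    ‖f z - f x - fderiv ℝ f x (z - x)‖ ≤ M * ‖z - x‖ ^ 2 := by
  refine (hf.taylor_segment x x z (by simp) le_rfl).trans_eq (by ring)

/-- Compare `z'` with the translate `y' + (z - y)`. Exchanging one for the other costs the Lipschitz
constant times the second difference of the points; what remains is an increment of `u ↦ f (y + u) -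
f (y' + u)`, whose derivative is at most `M * ‖y - y'‖`. -/
theorem four_point (hf : BoundC2 f M) (y z y' z' : E) :
    ‖(f z - f y) - (f z' - f y')‖ ≤
      M * ‖(z - y) - (z' - y')‖ + M * ‖y - y'‖ * ‖z - y‖ := by
  have h1 : ‖f (y' + (z - y)) - f z'‖ ≤ M * ‖(z - y) - (z' - y')‖ := by
    refine (hf.lip _ _).trans_eq ?_
    congr 2; abel
  have hd : ∀ w : E, HasFDerivAt (fun u => f (y + u) - f (y' + u))
      (fderiv ℝ f (y + w) - fderiv ℝ f (y' + w)) w := fun w =>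
    ((hasFDerivAt_comp_add_left y).2 (hf.diff (y + w)).hasFDerivAt).sub
      ((hasFDerivAt_comp_add_left y').2 (hf.diff (y' + w)).hasFDerivAt)
  have h2 : ‖(f (y + (z - y)) - f (y' + (z - y))) - (f (y + 0) - f (y' + 0))‖ ≤
      M * ‖y - y'‖ * ‖z - y - 0‖ := by
    refine norm_sub_le_of_fderiv_le (fun w => (hd w).differentiableAt) (fun w => ?_) (z - y) 0
    rw [(hd w).fderiv]
    refine (hf.fderiv_lip _ _).trans_eq ?_
    congr 2; abel
  simp only [sub_zero, add_zero, add_sub_cancel] at h2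
  have : (f z - f y) - (f z' - f y') =
      (f (y' + (z - y)) - f z') + ((f z - f (y' + (z - y))) - (f y - f y')) := by abel
  rw [this]
  exact (norm_add_le _ _).trans (add_le_add h1 h2)

theorem fderiv_sub_bound (hf : BoundC2 f M) (hg : Differentiable ℝ g)
    (hd : BoundC2 (fun x => f x - g x) θ) (x : E) : ‖fderiv ℝ f x - fderiv ℝ g x‖ ≤ θ := by
  have := hd.fderiv_bound x
  rwa [fderiv_fun_sub (hf.diff x) (hg x)] at this

theorem fderiv_sub_lip (hf : BoundC2 f M) (hg : Differentiable ℝ g)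
    (hd : BoundC2 (fun x => f x - g x) θ) (x y : E) :
    ‖(fderiv ℝ f x - fderiv ℝ g x) - (fderiv ℝ f y - fderiv ℝ g y)‖ ≤ θ * ‖x - y‖ := by
  have := hd.fderiv_lip x y
  rwa [fderiv_fun_sub (hf.diff x) (hg x), fderiv_fun_sub (hf.diff y) (hg y)] at this

/-- Base point, increment and function are changed one at a time, which gives the three terms. For
the base point, the map `u ↦ f (y + u) - f (y' + u) - (fderiv ℝ f y - fderiv ℝ f y') u` has a second
difference of `fderiv ℝ f` as its derivative. This is the only use of the regularity of the second
derivative, so it is required of `f` and not of `g`. -/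
theorem taylor_sub (hf : BoundC2 f M) (hf' : BoundC2 (fderiv ℝ f) M) (hg : Differentiable ℝ g)
    (hd : BoundC2 (fun x => f x - g x) θ) (y z y' z' : E) :
    ‖(f z - f y - fderiv ℝ f y (z - y)) - (g z' - g y' - fderiv ℝ g y' (z' - y'))‖ ≤
      M * ‖y - y'‖ * ‖z - y‖ ^ 2 + M * (‖z - y‖ + ‖z' - y'‖) * ‖(z - y) - (z' - y')‖ +
        θ * ‖z' - y'‖ ^ 2 := by
  set h := z - y with hh
  set h' := z' - y' with hh'
  have hz : z = y + h := by simp [hh]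
  have hz' : z' = y' + h' := by simp [hh']
  have hM := hf.nonneg
  have h3 := hd.taylor y' z'
  rw [fderiv_fun_sub (hf.diff y') (hg y'), ← hh', hz'] at h3
  have h2 : ‖f (y' + h) - f (y' + h') - fderiv ℝ f y' (h - h')‖ ≤
      M * (‖h‖ + ‖h'‖) * ‖h - h'‖ := by
    have := hf.taylor_segment y' (y' + h') (y' + h) (r := ‖h‖ + ‖h'‖) (by simp) (by simp)
    simpa using this
  have h1 : ‖(f (y + h) - f (y' + h) - (fderiv ℝ f y - fderiv ℝ f y') h) - (f y - f y')‖ ≤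
      M * ‖y - y'‖ * ‖h‖ ^ 2 := by
    have hd : ∀ w : E, HasFDerivAt
        (fun u => f (y + u) - f (y' + u) - (fderiv ℝ f y - fderiv ℝ f y') u)
        (fderiv ℝ f (y + w) - fderiv ℝ f (y' + w) - (fderiv ℝ f y - fderiv ℝ f y')) w := fun w =>
      (((hasFDerivAt_comp_add_left y).2 (hf.diff (y + w)).hasFDerivAt).sub
        ((hasFDerivAt_comp_add_left y').2 (hf.diff (y' + w)).hasFDerivAt)).sub
          (ContinuousLinearMap.hasFDerivAt _)
    have := (convex_closedBall (0 : E) ‖h‖).norm_image_sub_le_of_norm_hasFDerivWithin_le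
      (𝕜 := ℝ) (C := M * ‖y - y'‖ * ‖h‖) (x := 0) (y := h)
      (fun u _ => (hd u).hasFDerivWithinAt) (fun u hu => ?_) (by simp) (by simp)
    · simp only [add_zero, map_zero, sub_zero] at this
      refine this.trans_eq (by ring)
    · have h4 := hf'.four_point y (y + u) y' (y' + u)
      simp only [add_sub_cancel_left, sub_self, norm_zero, mul_zero, zero_add] at h4
      calc _ = ‖(fderiv ℝ f (y + u) - fderiv ℝ f y) - (fderiv ℝ f (y' + u) - fderiv ℝ f y')‖ := by
            congr 1; abel
        _ ≤ _ := h4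
        _ ≤ _ := by
          gcongr
          simpa using hu
  have e : (f z - f y - fderiv ℝ f y h) - (g z' - g y' - fderiv ℝ g y' h') =
      ((f (y + h) - f (y' + h) - (fderiv ℝ f y - fderiv ℝ f y') h) - (f y - f y')) +
      (f (y' + h) - f (y' + h') - fderiv ℝ f y' (h - h')) +
      ((f (y' + h') - g (y' + h')) - (f y' - g y') - (fderiv ℝ f y' - fderiv ℝ g y') h') := by
    rw [hz, hz']
    simp only [_root_.sub_apply, map_sub]
    abel
  rw [e]
  exact (norm_add_le _ _).trans (add_le_add ((norm_add_le _ _).trans (add_le_add h1 h2)) h3)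

end BoundC2

theorem MemCb.le_cbNorm {n : ℕ} {f : E → F} (hf : MemCb n f) {r : ℕ} (hr : r ≤ n) (x : E) :
    ‖iteratedFDeriv ℝ r f x‖ ≤ cbNorm n f := by
  obtain ⟨M, hM⟩ := hf.2 r hr
  have h1 : ‖iteratedFDeriv ℝ r f x‖ ≤ ⨆ x, ‖iteratedFDeriv ℝ r f x‖ :=
    le_ciSup (f := fun x => ‖iteratedFDeriv ℝ r f x‖) ⟨M, by rintro _ ⟨y, rfl⟩; exact hM y⟩ x
  refine h1.trans (Finset.single_le_sum (f := fun r => ⨆ x, ‖iteratedFDeriv ℝ r f x‖)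
    (fun i _ => ?_) (by simpa using Nat.lt_succ_of_le hr))
  exact Real.iSup_nonneg fun x => norm_nonneg _

theorem cbNorm_nonneg (n : ℕ) (f : E → F) : 0 ≤ cbNorm n f :=
  Finset.sum_nonneg fun _ _ => Real.iSup_nonneg fun _ => norm_nonneg _

theorem MemCb.mono {n m : ℕ} {f : E → F} (hf : MemCb n f) (h : m ≤ n) : MemCb m f :=
  ⟨hf.1.of_le (by exact_mod_cast h), fun r hr => hf.2 r (hr.trans h)⟩

theorem MemCb.sub {n : ℕ} {f g : E → F} (hf : MemCb n f) (hg : MemCb n g) :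
    MemCb n (fun x => f x - g x) := by
  refine ⟨hf.1.sub hg.1, fun r hr => ?_⟩
  obtain ⟨M, hM⟩ := hf.2 r hr
  obtain ⟨M', hM'⟩ := hg.2 r hr
  refine ⟨M + M', fun x => ?_⟩
  have : iteratedFDeriv ℝ r (fun x => f x - g x) x =
      iteratedFDeriv ℝ r f x - iteratedFDeriv ℝ r g x :=
    iteratedFDeriv_sub_apply (hf.1.of_le (by exact_mod_cast hr)).contDiffAt
      (hg.1.of_le (by exact_mod_cast hr)).contDiffAt
  rw [this]
  exact (norm_sub_le _ _).trans (add_le_add (hM x) (hM' x))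

theorem MemCb.boundC2 {f : E → F} (hf : MemCb 2 f) : BoundC2 f (cbNorm 2 f) where
  diff := hf.1.differentiable (by norm_num)
  bound x := by simpa [norm_iteratedFDeriv_zero] using hf.le_cbNorm (r := 0) (by norm_num) x
  fderiv_bound x := by
    simpa [norm_iteratedFDeriv_one] using hf.le_cbNorm (r := 1) (by norm_num) x
  fderiv_lip := by
    refine norm_sub_le_of_fderiv_le ?_ fun x => ?_
    · exact (hf.1.fderiv_right (m := 1) (by norm_num)).differentiable (by norm_num)
    · have := hf.le_cbNorm (r := 2) (by norm_num) x
      rwa [← norm_iteratedFDeriv_fderiv, norm_iteratedFDeriv_one] at this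

theorem MemCb.boundC2_of_three {f : E → F} (hf : MemCb 3 f) : BoundC2 f (cbNorm 3 f) where
  diff := hf.1.differentiable (by norm_num)
  bound x := by simpa [norm_iteratedFDeriv_zero] using hf.le_cbNorm (r := 0) (by norm_num) x
  fderiv_bound x := by
    simpa [norm_iteratedFDeriv_one] using hf.le_cbNorm (r := 1) (by norm_num) x
  fderiv_lip := by
    refine norm_sub_le_of_fderiv_le ?_ fun x => ?_
    · exact (hf.1.fderiv_right (m := 2) (by norm_num)).differentiable (by norm_num)
    · have := hf.le_cbNorm (r := 2) (by norm_num) x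
      rwa [← norm_iteratedFDeriv_fderiv, norm_iteratedFDeriv_one] at this

theorem MemCb.boundC2_fderiv {f : E → F} (hf : MemCb 3 f) :
    BoundC2 (fderiv ℝ f) (cbNorm 3 f) where
  diff := (hf.1.fderiv_right (m := 2) (by norm_num)).differentiable (by norm_num)
  bound x := hf.boundC2_of_three.fderiv_bound x
  fderiv_bound x := by
    have := hf.le_cbNorm (r := 2) (by norm_num) x
    rwa [← norm_iteratedFDeriv_fderiv, norm_iteratedFDeriv_one] at this
  fderiv_lip := by
    have h : ContDiff ℝ 2 (fderiv ℝ f) := hf.1.fderiv_right (m := 2) (by norm_num)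
    refine norm_sub_le_of_fderiv_le ?_ fun x => ?_
    · exact (h.fderiv_right (m := 1) (by norm_num)).differentiable (by norm_num)
    · have := hf.le_cbNorm (r := 3) (by norm_num) x
      rwa [← norm_iteratedFDeriv_fderiv, ← norm_iteratedFDeriv_fderiv,
        norm_iteratedFDeriv_one] at this

end Calculus

/-! ### Pairing bilinear maps with second order tensors -/

section Tensor

variable {d : ℕ} {F : Type*} [NormedAddCommGroup F] [NormedSpace ℝ F]

/-- The tensor product `x ⊗ y`. -/
noncomputable def tens (x y : Vec d) : Tens d := WithLp.toLp 2 fun ij => x ij.1 * y ij.2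

theorem tensApply_add_right (A : Vec d →L[ℝ] Vec d →L[ℝ] F) (m m' : Tens d) :
    tensApply A (m + m') = tensApply A m + tensApply A m' := by
  simp [tensApply, add_smul, Finset.sum_add_distrib]

theorem tensApply_sub_right (A : Vec d →L[ℝ] Vec d →L[ℝ] F) (m m' : Tens d) :
    tensApply A (m - m') = tensApply A m - tensApply A m' := by
  simp [tensApply, sub_smul, Finset.sum_sub_distrib]

theorem tensApply_sub_left (A A' : Vec d →L[ℝ] Vec d →L[ℝ] F) (m : Tens d) :
    tensApply (A - A') m = tensApply A m - tensApply A' m := by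
  simp [tensApply, smul_sub, Finset.sum_sub_distrib]

theorem tensApply_tens (A : Vec d →L[ℝ] Vec d →L[ℝ] F) (x y : Vec d) :
    tensApply A (tens x y) = A x y := by
  have hx : ∀ v : Vec d, v = ∑ i, v i • EuclideanSpace.single i (1 : ℝ) := fun v => by
    ext j
    simp [Pi.single_apply]
  conv_rhs => rw [hx x, hx y]
  simp only [tensApply, tens, map_sum, map_smul, _root_.sum_apply,
    _root_.smul_apply, Finset.smul_sum, smul_smul]
  rw [Finset.sum_comm]
  refine Finset.sum_congr rfl fun i _ => Finset.sum_congr rfl fun j _ => ?_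
  rw [mul_comm]

/-- A bound for the operator norm of `tensApply`. -/
noncomputable def tensConst (d : ℕ) : ℝ := 1 + (d : ℝ) ^ 2

theorem one_le_tensConst (d : ℕ) : 1 ≤ tensConst d := by
  have : (0 : ℝ) ≤ (d : ℝ) ^ 2 := by positivity
  unfold tensConst; linarith

theorem norm_tensApply_le (A : Vec d →L[ℝ] Vec d →L[ℝ] F) (m : Tens d) :
    ‖tensApply A m‖ ≤ tensConst d * ‖A‖ * ‖m‖ := by
  have h : ∀ i j : Fin d, ‖m (i, j) • A (EuclideanSpace.single i 1) (EuclideanSpace.single j 1)‖ ≤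
      ‖m‖ * ‖A‖ := fun i j => by
    rw [norm_smul]
    gcongr
    · exact PiLp.norm_apply_le m (i, j)
    · refine (A.le_opNorm₂ _ _).trans ?_
      simp
  calc ‖tensApply A m‖ ≤ ∑ i : Fin d, ∑ j : Fin d, ‖m‖ * ‖A‖ :=
        (norm_sum_le _ _).trans (Finset.sum_le_sum fun i _ =>
          (norm_sum_le _ _).trans (Finset.sum_le_sum fun j _ => h i j))
    _ = (d : ℝ) ^ 2 * (‖A‖ * ‖m‖) := by simp; ring
    _ ≤ tensConst d * ‖A‖ * ‖m‖ := by
      unfold tensConst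
      nlinarith [mul_nonneg (norm_nonneg A) (norm_nonneg m)]

end Tensor

end CadlagRDE

/-! ### Controls, discrete sewing and block decomposition -/

namespace CadlagRDE

/-- `ω` is a (superadditive) control function for intervals with endpoints in `s`. -/
structure IsControl {ι : Type*} [LinearOrder ι] (s : Set ι) (ω : ι → ι → ℝ) : Prop where
  nonneg : ∀ a ∈ s, ∀ b ∈ s, a ≤ b → 0 ≤ ω a b
  superadd : ∀ a ∈ s, ∀ b ∈ s, ∀ c ∈ s, a ≤ b → b ≤ c → ω a b + ω b c ≤ ω a c

namespace IsControl

section General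

variable {ι κ : Type*} [LinearOrder ι] [LinearOrder κ] {s : Set ι} {ω ω' : ι → ι → ℝ}

theorem self_eq_zero (h : IsControl s ω) {a : ι} (ha : a ∈ s) : ω a a = 0 := by
  have h1 := h.nonneg a ha a ha le_rfl
  have h2 := h.superadd a ha a ha a ha le_rfl le_rfl
  linarith

theorem mono (h : IsControl s ω) {a b c e : ι} (ha : a ∈ s) (hb : b ∈ s) (hc : c ∈ s)
    (he : e ∈ s) (hab : a ≤ b) (hbc : b ≤ c) (hce : c ≤ e) : ω b c ≤ ω a e := by
  have h1 := h.superadd a ha b hb c hc hab hbc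
  have h2 := h.superadd a ha c hc e he (hab.trans hbc) hce
  have h3 := h.nonneg a ha b hb hab
  have h4 := h.nonneg c hc e he hce
  linarith

theorem add (h : IsControl s ω) (h' : IsControl s ω') :
    IsControl s (fun a b => ω a b + ω' a b) where
  nonneg a ha b hb hab := add_nonneg (h.nonneg a ha b hb hab) (h'.nonneg a ha b hb hab)
  superadd a ha b hb c hc hab hbc := by
    have h1 := h.superadd a ha b hb c hc hab hbc
    have h2 := h'.superadd a ha b hb c hc hab hbc
    linarith

theorem const_mul (h : IsControl s ω) {r : ℝ} (hr : 0 ≤ r) :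
    IsControl s (fun a b => r * ω a b) where
  nonneg a ha b hb hab := mul_nonneg hr (h.nonneg a ha b hb hab)
  superadd a ha b hb c hc hab hbc := by
    have h1 := h.superadd a ha b hb c hc hab hbc
    nlinarith

theorem rpow (h : IsControl s ω) {q : ℝ} (hq : 1 ≤ q) :
    IsControl s (fun a b => ω a b ^ q) where
  nonneg a ha b hb hab := Real.rpow_nonneg (h.nonneg a ha b hb hab) q
  superadd a ha b hb c hc hab hbc := by
    have h1 := h.superadd a ha b hb c hc hab hbc
    have h2 := h.nonneg a ha b hb hab
    have h3 := h.nonneg b hb c hc hbc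
    exact (Real.add_rpow_le_rpow_add h2 h3 hq).trans
      (Real.rpow_le_rpow (by positivity) h1 (by linarith))

theorem comp (h : IsControl s ω) {t : κ → ι} (ht : Monotone t) (hs : ∀ i, t i ∈ s) :
    IsControl univ (fun i j => ω (t i) (t j)) where
  nonneg a _ b _ hab := h.nonneg _ (hs a) _ (hs b) (ht hab)
  superadd a _ b _ c _ hab hbc := h.superadd _ (hs a) _ (hs b) _ (hs c) (ht hab) (ht hbc)

theorem mono_pow (h : IsControl s ω) {α : ℝ} (hα : 0 ≤ α) {a b c e : ι} (ha : a ∈ s) (hb : b ∈ s)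
    (hc : c ∈ s) (he : e ∈ s) (hab : a ≤ b) (hbc : b ≤ c) (hce : c ≤ e) :
    ω b c ^ α ≤ ω a e ^ α :=
  Real.rpow_le_rpow (h.nonneg b hb c hc hbc) (h.mono ha hb hc he hab hbc hce) hα

end General

variable {ω ε : ℕ → ℕ → ℝ}

/-- The increments of a nondecreasing function form a control. -/
theorem of_monotone {ι : Type*} [LinearOrder ι] (s : Set ι) {F : ι → ℝ} (hF : Monotone F) :
    IsControl s (fun a b => F b - F a) where
  nonneg a _ b _ hab := sub_nonneg.2 (hF hab)
  superadd a _ b _ c _ _ _ := by linarith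

/-- Induction on `j - i`. Cut `[i, j]` into `[i, m]`, the single step `[m, m + 1]` and `[m + 1, j]`,
with at most half of `ω i j` on each outer piece. The cubic terms of the outer pieces add up to at
most `κ` times the claimed one, the values of `ε` add up by superadditivity, and the two defects are
paid for by the margin `1 - κ`. No bound on `ω m (m + 1)` beyond monotonicity is needed, so `ω` may
jump. The control `ε` allows nonzero errors on single steps. -/
theorem sewing_le {E : Type*} [NormedAddCommGroup E] {J : ℕ → ℕ → E} {α C S ρ κ : ℝ} {a b : ℕ}
    (hω : IsControl univ ω) (hε : IsControl univ ε) (hα : 0 < α) (hC : 0 ≤ C) (hS : 0 ≤ S)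
    (hκ : 2 * ((1 / 2 : ℝ) ^ α) ^ 3 ≤ κ) (hκ1 : κ < 1) (hρ : C * ρ ≤ (1 - κ) / 2)
    (h0 : ∀ i, J i i = 0)
    (h1 : ∀ i, a ≤ i → i + 1 ≤ b → ‖J i (i + 1)‖ ≤ ε i (i + 1))
    (hδ : ∀ i m j, a ≤ i → i ≤ m → m ≤ j → j ≤ b →
      ‖J i j - J i m - J m j‖ ≤ C * S * (ω i j ^ α) ^ 3 + C * (ω i j ^ α) * ‖J i m‖)
    (hεω : ∀ i j, a ≤ i → i ≤ j → j ≤ b → ε i j ≤ S * (ω i j ^ α) ^ 2)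
    (hab : ω a b ^ α ≤ ρ) (i j : ℕ) (hai : a ≤ i) (hij : i ≤ j) (hjb : j ≤ b) :
    ‖J i j‖ ≤ 8 * C / (1 - κ) * S * (ω i j ^ α) ^ 3 + ε i j := by
  set L := 8 * C / (1 - κ) with hL
  have hκ' : 0 < 1 - κ := by linarith
  have hL0 : 0 ≤ L := by positivity
  -- The inequality that closes the induction. It is an equality, and this determines the constant
  -- `8 * C / (1 - κ)`. The summand `4 * C` collects the four terms of the two defects that do not
  -- contain `L`.
  have hLC : κ * L + 4 * C + (1 - κ) / 2 * L ≤ L := by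
    have : (1 - κ) * L = 8 * C := by rw [hL]; field_simp
    linarith
  have hφ0 : ∀ i j, i ≤ j → 0 ≤ ω i j ^ α := fun i j h =>
    Real.rpow_nonneg (hω.nonneg i trivial j trivial h) α
  have hφm : ∀ i j k l, i ≤ j → j ≤ k → k ≤ l → ω j k ^ α ≤ ω i l ^ α := fun i j k l h1 h2 h3 =>
    hω.mono_pow hα.le trivial trivial trivial trivial h1 h2 h3
  induction hn : j - i using Nat.strong_induction_on generalizing i j with
  | _ n ih =>
  rcases hij.eq_or_lt with rfl | hlt
  · rw [h0, norm_zero]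
    have := hε.nonneg i trivial i trivial le_rfl
    have := hφ0 i i le_rfl
    positivity
  set c : ℝ := (1 / 2 : ℝ) ^ α with hc
  have hc0 : 0 ≤ c := by positivity
  have hhalf : ∀ u v, u ≤ v → ω u v ≤ ω i j / 2 → ω u v ^ α ≤ c * ω i j ^ α := fun u v huv h => by
    rw [hc, ← Real.mul_rpow (by norm_num) (hω.nonneg i trivial j trivial hij)]
    exact Real.rpow_le_rpow (hω.nonneg u trivial v trivial huv) (by linarith) hα.le
  set P : ℕ → Prop := fun m => i ≤ m ∧ ω i m ≤ ω i j / 2 with hP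
  have hPi : P i := by
    refine ⟨le_rfl, ?_⟩
    rw [hω.self_eq_zero trivial]
    have := hω.nonneg i trivial j trivial hij
    linarith
  classical
  -- The last index up to which at most half of the control is used. Then more than half is used up
  -- to `m + 1`, so superadditivity leaves less than half on `[m + 1, j]`. The search stops at `j -
  -- 1` to ensure `m + 1 ≤ j`.
  set m := Nat.findGreatest P (j - 1) with hm
  have hPm : P m := Nat.findGreatest_spec (P := P) (show i ≤ j - 1 by omega) hPi
  have hmj : m ≤ j - 1 := Nat.findGreatest_le _
  obtain ⟨him, hm2⟩ := hPm
  have hm3 : ω (m + 1) j ≤ ω i j / 2 := by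
    rcases eq_or_lt_of_le (show m + 1 ≤ j by omega) with h | h
    · rw [h, hω.self_eq_zero trivial]
      have := hω.nonneg i trivial j trivial hij
      linarith
    · have hn : ¬ P (m + 1) := Nat.findGreatest_is_greatest (Nat.lt_succ_self m) (by omega)
      have h2 : ω i j / 2 < ω i (m + 1) := by
        by_contra h3
        exact hn ⟨by omega, not_lt.1 h3⟩
      have := hω.superadd i trivial (m + 1) trivial j trivial (by omega) h.le
      linarith
  set φ := ω i j ^ α with hφ
  have hφ00 : 0 ≤ φ := hφ0 i j hij
  have hφρ : φ ≤ ρ := (hφm a i j b hai hij hjb).trans hab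
  have e1 := ih (m - i) (by omega) i m hai him (by omega) rfl
  have e2 := ih (j - (m + 1)) (by omega) (m + 1) j (by omega) (by omega) hjb rfl
  have p1 : (ω i m ^ α) ^ 3 ≤ c ^ 3 * φ ^ 3 := by
    rw [← mul_pow]; exact pow_le_pow_left₀ (hφ0 _ _ him) (hhalf i m him hm2) 3
  have p2 : (ω (m + 1) j ^ α) ^ 3 ≤ c ^ 3 * φ ^ 3 := by
    rw [← mul_pow]
    exact pow_le_pow_left₀ (hφ0 _ _ (by omega)) (hhalf _ _ (by omega) hm3) 3
  have d1 := hδ i m j hai him (by omega) hjb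
  have d2 := hδ m (m + 1) j (by omega) (by omega) (by omega) hjb
  have s1 := h1 m (by omega) (by omega)
  have q1 := hεω i m hai him (by omega)
  have q2 := hεω m (m + 1) (by omega) (by omega) (by omega)
  have r1 : ω i m ^ α ≤ φ := hφm i i m j le_rfl him (by omega)
  have r2 : ω m (m + 1) ^ α ≤ φ := hφm i m (m + 1) j him (by omega) (by omega)
  have r3 : ω m j ^ α ≤ φ := hφm i m j j him (by omega) le_rfl
  have z1 := hφ0 i m him
  have z2 := hφ0 m (m + 1) (by omega)
  have z3 := hφ0 m j (by omega)
  have t1 : ‖J i m‖ ≤ L * S * φ ^ 3 + S * φ ^ 2 := by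
    refine e1.trans (add_le_add ?_ (q1.trans ?_)) <;> gcongr
  have t2 : ‖J m (m + 1)‖ ≤ S * φ ^ 2 := by
    refine s1.trans (q2.trans ?_); gcongr
  have u1 : ‖J i j - J i m - J m j‖ ≤ C * S * φ ^ 3 + C * φ * (L * S * φ ^ 3 + S * φ ^ 2) := by
    refine d1.trans ?_; gcongr
  have u2 : ‖J m j - J m (m + 1) - J (m + 1) j‖ ≤ C * S * φ ^ 3 + C * φ * (S * φ ^ 2) := by
    refine d2.trans ?_; gcongr
  have hεs : ε i m + ε m (m + 1) + ε (m + 1) j ≤ ε i j := by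
    have h1 := hε.superadd i trivial m trivial (m + 1) trivial him (by omega)
    have h2 := hε.superadd i trivial (m + 1) trivial j trivial (by omega) (by omega)
    linarith
  have e : J i j = J i m + J m (m + 1) + J (m + 1) j + (J i j - J i m - J m j) +
      (J m j - J m (m + 1) - J (m + 1) j) := by abel
  have key : ‖J i j‖ ≤ ‖J i m‖ + ‖J m (m + 1)‖ + ‖J (m + 1) j‖ + ‖J i j - J i m - J m j‖ +
      ‖J m j - J m (m + 1) - J (m + 1) j‖ := by
    conv_lhs => rw [e]
    exact (norm_add_le _ _).trans (add_le_add ((norm_add_le _ _).trans (add_le_add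
      ((norm_add_le _ _).trans (add_le_add (norm_add_le _ _) le_rfl)) le_rfl)) le_rfl)
  have f1 : L * S * (ω i m ^ α) ^ 3 ≤ L * S * (c ^ 3 * φ ^ 3) := by gcongr
  have f2 : L * S * (ω (m + 1) j ^ α) ^ 3 ≤ L * S * (c ^ 3 * φ ^ 3) := by gcongr
  have f3 : C * φ * (L * S * φ ^ 3) ≤ (1 - κ) / 2 * (L * S * φ ^ 3) := by
    gcongr
    exact (mul_le_mul_of_nonneg_left hφρ hC).trans hρ
  have f4 : 2 * c ^ 3 * (L * S * φ ^ 3) ≤ κ * (L * S * φ ^ 3) := by gcongr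
  have f5 : (κ * L + 4 * C + (1 - κ) / 2 * L) * (S * φ ^ 3) ≤ L * (S * φ ^ 3) := by gcongr
  nlinarith

/-- Greedy cutting: take the longest block from `i` with control at most `r` and then one single
step, of whatever size. Together they use up more than `r`, so after at most `N` repetitions a
single block remains. Thus `N + 1` blocks and `N` steps suffice. -/
theorem block_induction (hω : IsControl univ ω) {r : ℝ} (hr : 0 ≤ r) {Q : ℕ → ℕ → ℕ → Prop}
    (hblock : ∀ N i j, i ≤ j → ω i j ≤ r → Q N i j)
    (hstep : ∀ N i b j, i ≤ b → b < j → ω i b ≤ r → Q N (b + 1) j → Q (N + 1) i j) (N i j : ℕ)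
    (hij : i ≤ j) (h : ω i j ≤ N * r) : Q N i j := by
  induction N generalizing i with
  | zero => exact hblock 0 i j hij (h.trans (by simpa using hr))
  | succ N ih =>
    by_cases hr' : ω i j ≤ r
    · exact hblock _ i j hij hr'
    classical
    set P : ℕ → Prop := fun m => i ≤ m ∧ ω i m ≤ r with hP
    have hPi : P i := ⟨le_rfl, by rwa [hω.self_eq_zero trivial]⟩
    set b := Nat.findGreatest P j with hb
    have hPb : P b := Nat.findGreatest_spec (P := P) hij hPi
    have hbj : b < j := lt_of_le_of_ne (Nat.findGreatest_le _) fun h' => hr' (h' ▸ hPb.2)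
    have h2 : r < ω i (b + 1) := by
      by_contra h3
      exact Nat.findGreatest_is_greatest (P := P) (Nat.lt_succ_self b) (by omega)
        ⟨by have := hPb.1; omega, not_lt.1 h3⟩
    have h3 := hω.superadd i trivial (b + 1) trivial j trivial (by have := hPb.1; omega) (by omega)
    refine hstep N i b j hPb.1 hbj hPb.2 (ih (b + 1) (by omega) ?_)
    push_cast at h
    linarith

end IsControl

end CadlagRDE

/-! ### The germ of the equation and its defect -/

namespace CadlagRDE

section Germ

variable {d k : ℕ}

/-- The second order coefficient `Df · f`. -/
noncomputable def coefD (f : Vec k → Vec d →L[ℝ] Vec k) (y : Vec k) :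
    Vec d →L[ℝ] Vec d →L[ℝ] Vec k := (fderiv ℝ f y).comp (f y)

/-- The local approximation `f(y) x + Df(y) f(y) a` of the increment of a solution. -/
noncomputable def germ (f : Vec k → Vec d →L[ℝ] Vec k) (y : Vec k) (x : Vec d) (a : Tens d) :
    Vec k := f y x + tensApply (coefD f y) a

variable {f : Vec k → Vec d →L[ℝ] Vec k} {M : ℝ}

/-- The tensor `tens x₁ x₂` from Chen's relation contributes `fderiv ℝ f y (f y x₁) x₂`. This
cancels the first order part of `(f z - f y) x₂`, so the defect gains one order. -/
theorem germ_defect (f : Vec k → Vec d →L[ℝ] Vec k) (y z : Vec k) (x₁ x₂ : Vec d)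
    (a₁ a₂ : Tens d) :
    germ f y (x₁ + x₂) (a₁ + a₂ + tens x₁ x₂) - germ f y x₁ a₁ - germ f z x₂ a₂ =
      -((f z - f y - fderiv ℝ f y (f y x₁)) x₂) - tensApply (coefD f z - coefD f y) a₂ := by
  simp only [germ, tensApply_add_right, tensApply_sub_left, tensApply_tens, map_add,
    _root_.sub_apply, coefD, ContinuousLinearMap.comp_apply]
  abel

theorem norm_coefD_le (hf : BoundC2 f M) (y : Vec k) : ‖coefD f y‖ ≤ M ^ 2 := by
  refine (ContinuousLinearMap.opNorm_comp_le _ _).trans ?_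
  rw [pow_two]
  have := hf.nonneg
  gcongr
  exacts [hf.fderiv_bound y, hf.bound y]

theorem norm_coefD_sub_le (hf : BoundC2 f M) (y z : Vec k) :
    ‖coefD f z - coefD f y‖ ≤ 2 * M ^ 2 * ‖z - y‖ := by
  have e : coefD f z - coefD f y =
      (fderiv ℝ f z - fderiv ℝ f y).comp (f z) + (fderiv ℝ f y).comp (f z - f y) := by
    ext v w
    simp [coefD]
  have hM := hf.nonneg
  rw [e]
  have h1 : ‖(fderiv ℝ f z - fderiv ℝ f y).comp (f z)‖ ≤
      ‖fderiv ℝ f z - fderiv ℝ f y‖ * ‖f z‖ := ContinuousLinearMap.opNorm_comp_le _ _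
  have h2 : ‖(fderiv ℝ f y).comp (f z - f y)‖ ≤ ‖fderiv ℝ f y‖ * ‖f z - f y‖ :=
    ContinuousLinearMap.opNorm_comp_le _ _
  have h3 := norm_add_le ((fderiv ℝ f z - fderiv ℝ f y).comp (f z))
    ((fderiv ℝ f y).comp (f z - f y))
  refine h3.trans ((add_le_add h1 h2).trans ?_)
  calc ‖fderiv ℝ f z - fderiv ℝ f y‖ * ‖f z‖ + ‖fderiv ℝ f y‖ * ‖f z - f y‖
      ≤ (M * ‖z - y‖) * M + M * (M * ‖z - y‖) := by
        gcongr
        exacts [hf.fderiv_lip _ _, hf.bound _, hf.fderiv_bound _, hf.lip _ _]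
    _ = _ := by ring

theorem norm_apply_le_of_le (hf : BoundC2 f M) (y : Vec k) {x : Vec d} {r : ℝ} (hx : ‖x‖ ≤ r) :
    ‖f y x‖ ≤ M * r := by
  have := hf.nonneg
  exact ((f y).le_opNorm x).trans (mul_le_mul (hf.bound y) hx (norm_nonneg _) this)

theorem norm_tensApply_coefD_le (hf : BoundC2 f M) (y : Vec k) {a : Tens d} {r : ℝ}
    (ha : ‖a‖ ≤ r) : ‖tensApply (coefD f y) a‖ ≤ tensConst d * M ^ 2 * r := by
  have := one_le_tensConst d
  refine (norm_tensApply_le _ _).trans ?_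
  gcongr
  exact norm_coefD_le hf y

theorem norm_germ_le (hf : BoundC2 f M) (y : Vec k) {x : Vec d} {a : Tens d} {r s : ℝ}
    (hx : ‖x‖ ≤ r) (ha : ‖a‖ ≤ s) : ‖germ f y x a‖ ≤ M * r + tensConst d * M ^ 2 * s :=
  (norm_add_le _ _).trans (add_le_add (norm_apply_le_of_le hf y hx)
    (norm_tensApply_coefD_le hf y ha))

theorem norm_germ_le_mul (hf : BoundC2 f M) (hM : 1 ≤ M) (y : Vec k) {x : Vec d} {a : Tens d}
    {φ : ℝ} (hφ : φ ≤ 1) (hx : ‖x‖ ≤ φ) (ha : ‖a‖ ≤ φ ^ 2) :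
    ‖germ f y x a‖ ≤ 2 * tensConst d * M ^ 2 * φ := by
  have hφ0 : 0 ≤ φ := (norm_nonneg _).trans hx
  have hD := one_le_tensConst d
  have h1 : M * φ ≤ tensConst d * M ^ 2 * φ := by
    gcongr
    calc M ≤ 1 * M ^ 2 := by nlinarith
      _ ≤ tensConst d * M ^ 2 := by gcongr
  have h2 : tensConst d * M ^ 2 * φ ^ 2 ≤ tensConst d * M ^ 2 * φ := by
    gcongr; nlinarith
  have := norm_germ_le hf y hx ha
  linarith

/-- Pass from `z` to `y + germ f y x a` at Lipschitz cost, then apply Taylor's formula at `y`. The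
linear part of the germ cancels against `f y x`, and the area part that is left is already quadratic
in `φ`. -/
theorem norm_defect_le (hf : BoundC2 f M) (hM : 1 ≤ M) {y z : Vec k} {x : Vec d} {a : Tens d}
    {φ : ℝ} (hφ : φ ≤ 1) (hx : ‖x‖ ≤ φ) (ha : ‖a‖ ≤ φ ^ 2) :
    ‖f z - f y - fderiv ℝ f y (f y x)‖ ≤
      M * ‖z - y - germ f y x a‖ + 5 * tensConst d ^ 2 * M ^ 5 * φ ^ 2 := by
  have hφ0 : 0 ≤ φ := (norm_nonneg _).trans hx
  have hD := one_le_tensConst d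
  set h := germ f y x a with hh
  have e : f z - f y - fderiv ℝ f y (f y x) = (f z - f (y + h)) +
      (f (y + h) - f y - fderiv ℝ f y ((y + h) - y)) +
        fderiv ℝ f y (tensApply (coefD f y) a) := by
    have : (y + h) - y = f y x + tensApply (coefD f y) a := by rw [hh, germ]; abel
    rw [this, map_add]; abel
  rw [e]
  have h1 : ‖f z - f (y + h)‖ ≤ M * ‖z - y - h‖ := by
    refine (hf.lip _ _).trans_eq ?_
    rw [sub_add_eq_sub_sub]
  have h2 : ‖f (y + h) - f y - fderiv ℝ f y ((y + h) - y)‖ ≤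
      M * (2 * tensConst d * M ^ 2 * φ) ^ 2 := by
    refine (hf.taylor _ _).trans ?_
    gcongr
    rw [add_sub_cancel_left]
    exact norm_germ_le_mul hf hM y hφ hx ha
  have h3 : ‖fderiv ℝ f y (tensApply (coefD f y) a)‖ ≤ M * (tensConst d * M ^ 2 * φ ^ 2) := by
    refine (ContinuousLinearMap.le_opNorm _ _).trans ?_
    gcongr
    exacts [hf.fderiv_bound y, norm_tensApply_coefD_le hf y ha]
  have h4 : M * (tensConst d * M ^ 2 * φ ^ 2) ≤ tensConst d ^ 2 * M ^ 5 * φ ^ 2 := by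
    have : tensConst d * M ^ 3 ≤ tensConst d ^ 2 * M ^ 5 := by
      gcongr
      · nlinarith
      · norm_num
    calc _ = (tensConst d * M ^ 3) * φ ^ 2 := by ring
      _ ≤ _ := by gcongr
  refine (norm_add₃_le).trans ?_
  nlinarith

theorem norm_sub_le_add_germ (hf : BoundC2 f M) (hM : 1 ≤ M) {y z : Vec k} {x : Vec d}
    {a : Tens d} {φ : ℝ} (hφ : φ ≤ 1) (hx : ‖x‖ ≤ φ) (ha : ‖a‖ ≤ φ ^ 2) :
    ‖z - y‖ ≤ ‖z - y - germ f y x a‖ + 2 * tensConst d * M ^ 2 * φ := by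
  have := norm_germ_le_mul hf hM y hφ hx ha
  have h2 := norm_add_le (z - y - germ f y x a) (germ f y x a)
  rw [sub_add_cancel] at h2
  linarith

end Germ

/-! ### A priori estimates for the discrete equation -/

section Discrete

variable {d k : ℕ}

/-- A rough path in discrete time, controlled by `ω`. -/
structure DiscreteRough (x : ℕ → Vec d) (a : ℕ → ℕ → Tens d) (ω : ℕ → ℕ → ℝ) (α : ℝ) : Prop where
  chen : ∀ i m j, i ≤ m → m ≤ j → a i j = a i m + a m j + tens (x m - x i) (x j - x m)
  path_le : ∀ i j, i ≤ j → ‖x j - x i‖ ≤ ω i j ^ α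
  area_le : ∀ i j, i ≤ j → ‖a i j‖ ≤ (ω i j ^ α) ^ 2

/-- The error of the local approximation of a sequence `y`. -/
noncomputable def err (f : Vec k → Vec d →L[ℝ] Vec k) (x : ℕ → Vec d) (a : ℕ → ℕ → Tens d)
    (y : ℕ → Vec k) (i j : ℕ) : Vec k := y j - y i - germ f (y i) (x j - x i) (a i j)

variable {f : Vec k → Vec d →L[ℝ] Vec k} {x : ℕ → Vec d} {a : ℕ → ℕ → Tens d} {ω : ℕ → ℕ → ℝ}
  {α M : ℝ} {y : ℕ → Vec k}

theorem DiscreteRough.area_self (h : DiscreteRough x a ω α) (i : ℕ) : a i i = 0 := by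
  have := h.chen i i i le_rfl le_rfl
  have h0 : tens (x i - x i) (x i - x i) = 0 := by ext; simp [tens]
  rw [h0, add_zero] at this
  exact left_eq_add.1 this

theorem DiscreteRough.err_self (h : DiscreteRough x a ω α) (f : Vec k → Vec d →L[ℝ] Vec k)
    (y : ℕ → Vec k) (i : ℕ) : err f x a y i i = 0 := by
  simp [err, germ, h.area_self, tensApply]

theorem DiscreteRough.err_defect (h : DiscreteRough x a ω α) (f : Vec k → Vec d →L[ℝ] Vec k)
    (y : ℕ → Vec k) {i m j : ℕ} (him : i ≤ m) (hmj : m ≤ j) :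
    err f x a y i j - err f x a y i m - err f x a y m j =
      (f (y m) - f (y i) - fderiv ℝ f (y i) (f (y i) (x m - x i))) (x j - x m) +
        tensApply (coefD f (y m) - coefD f (y i)) (a m j) := by
  have hd := germ_defect f (y i) (y m) (x m - x i) (x j - x m) (a i m) (a m j)
  rw [sub_add_sub_cancel' (x m) (x i) (x j), ← h.chen i m j him hmj] at hd
  have e : err f x a y i j - err f x a y i m - err f x a y m j =
      -(germ f (y i) (x j - x i) (a i j) - germ f (y i) (x m - x i) (a i m) -
        germ f (y m) (x j - x m) (a m j)) := by
    simp only [err]; abel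
  rw [e, hd]; abel

/-- The interval `[i, m]` enters through `ω i m` and the error there, and the interval `[m, j]` only
through `‖x j - x m‖` and `‖a m j‖`. Since the two are kept apart, the bound remains useful when
`[m, j]` is a single step with a large jump. -/
theorem DiscreteRough.norm_err_defect_le (h : DiscreteRough x a ω α) (hf : BoundC2 f M)
    (hM : 1 ≤ M) (y : ℕ → Vec k) {i m j : ℕ} (him : i ≤ m) (hmj : m ≤ j) (hφ : ω i m ^ α ≤ 1) :
    ‖err f x a y i j - err f x a y i m - err f x a y m j‖ ≤
      (M * ‖err f x a y i m‖ + 5 * tensConst d ^ 2 * M ^ 5 * (ω i m ^ α) ^ 2) * ‖x j - x m‖ +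
        tensConst d * (2 * M ^ 2 * ‖err f x a y i m‖ +
          4 * tensConst d * M ^ 4 * ω i m ^ α) * ‖a m j‖ := by
  have hD := one_le_tensConst d
  rw [h.err_defect f y him hmj]
  refine (norm_add_le _ _).trans (add_le_add ?_ ?_)
  · refine (ContinuousLinearMap.le_opNorm _ _).trans ?_
    gcongr
    exact norm_defect_le hf hM hφ (h.path_le i m him) (h.area_le i m him)
  · refine (norm_tensApply_le _ _).trans ?_
    gcongr
    refine (norm_coefD_sub_le hf _ _).trans ?_
    have := norm_sub_le_add_germ hf hM (y := y i) (z := y m) hφ (h.path_le i m him)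
      (h.area_le i m him)
    calc _ ≤ 2 * M ^ 2 * (‖err f x a y i m‖ + 2 * tensConst d * M ^ 2 * ω i m ^ α) := by
          gcongr; exact this
      _ = _ := by ring

/-- A threshold on `ω` itself that serves for every exponent `α ≥ 1 / 3`, so that the number of
blocks does not depend on `α`. -/
theorem rpow_le_of_le_cube {w ρ α : ℝ} (hw : 0 ≤ w) (hρ : 0 < ρ) (hρ1 : ρ ≤ 1) (hα : 1 / 3 ≤ α)
    (h : w ≤ ρ ^ 3) : w ^ α ≤ ρ := by
  calc w ^ α ≤ (ρ ^ 3) ^ α := Real.rpow_le_rpow hw h (by linarith)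
    _ = ρ ^ (3 * α) := by rw [← Real.rpow_natCast, ← Real.rpow_mul hρ.le]; norm_num
    _ ≤ ρ ^ (1 : ℝ) := Real.rpow_le_rpow_of_exponent_ge hρ hρ1 (by linarith)
    _ = ρ := Real.rpow_one ρ

theorem rpow_le_of_le {w Ω α : ℝ} (hw : 0 ≤ w) (hΩ : 1 ≤ Ω) (hα : 0 ≤ α) (hα1 : α ≤ 1)
    (h : w ≤ Ω) : w ^ α ≤ Ω := by
  calc w ^ α ≤ Ω ^ α := Real.rpow_le_rpow hw h hα
    _ ≤ Ω ^ (1 : ℝ) := Real.rpow_le_rpow_of_exponent_le hΩ hα1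
    _ = Ω := Real.rpow_one Ω

/-- The contraction factor `2 · 2^{-3α} < 1` of the dyadic sewing argument. -/
theorem exists_sewing_factor {α₀ : ℝ} (hα₀ : 1 / 3 < α₀) :
    ∃ κ : ℝ, κ < 1 ∧ ∀ α, α₀ ≤ α → 2 * ((1 / 2 : ℝ) ^ α) ^ 3 ≤ κ := by
  refine ⟨2 * ((1 / 2 : ℝ) ^ α₀) ^ 3, ?_, fun α hα => ?_⟩
  · rw [← Real.rpow_natCast, ← Real.rpow_mul (by norm_num)]
    have : (1 / 2 : ℝ) ^ (α₀ * (3 : ℕ)) < (1 / 2 : ℝ) ^ (1 : ℝ) :=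
      Real.rpow_lt_rpow_of_exponent_gt (by norm_num) (by norm_num) (by push_cast; linarith)
    rw [Real.rpow_one] at this
    linarith
  · have : (1 / 2 : ℝ) ^ α ≤ (1 / 2 : ℝ) ^ α₀ :=
      Real.rpow_le_rpow_of_exponent_ge (by norm_num) (by norm_num) hα
    gcongr

/-- Sewing with `ε = 0`, because an exact discrete solution has no error on single steps. In the
constant `C`, the factor 9 is 5 from the path term of the defect plus 4 from the area term. -/
theorem exists_apriori_local (d k : ℕ) {α₀ M : ℝ} (hα₀ : 1 / 3 < α₀) (hM : 1 ≤ M) :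
    ∃ ρ L : ℝ, 0 < ρ ∧ ρ ≤ 1 ∧ 0 ≤ L ∧ ∀ α, α₀ ≤ α → ∀ f : Vec k → Vec d →L[ℝ] Vec k,
      BoundC2 f M → ∀ (x : ℕ → Vec d) (a : ℕ → ℕ → Tens d) (ω : ℕ → ℕ → ℝ) (y : ℕ → Vec k),
      IsControl univ ω → DiscreteRough x a ω α → (∀ i, err f x a y i (i + 1) = 0) →
      ∀ i j, i ≤ j → ω i j ^ α ≤ ρ → ‖err f x a y i j‖ ≤ L * (ω i j ^ α) ^ 3 := by
  obtain ⟨κ, hκ1, hκ⟩ := exists_sewing_factor hα₀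
  have hD := one_le_tensConst d
  set C : ℝ := 9 * tensConst d ^ 2 * M ^ 5 with hC
  have hC0 : 0 < C := by positivity
  have hκ0 : 0 < 1 - κ := by linarith
  refine ⟨min 1 ((1 - κ) / 2 / C), 8 * C / (1 - κ), by positivity, min_le_left _ _,
    by positivity, ?_⟩
  intro α hα f hf x a ω y hω h hy i j hij hρ
  have hφ0 : ∀ i j, i ≤ j → 0 ≤ ω i j ^ α := fun i j h =>
    Real.rpow_nonneg (hω.nonneg i trivial j trivial h) α
  have hε : IsControl (univ : Set ℕ) (fun _ _ => (0 : ℝ)) := ⟨by simp, by simp⟩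
  have main := IsControl.sewing_le (J := err f x a y) (C := C) (S := 1) (a := i) (b := j) hω hε
    (by linarith : 0 < α) hC0.le zero_le_one (hκ α hα) hκ1 (ρ := min 1 ((1 - κ) / 2 / C))
    ?_ (h.err_self f y) (fun i _ _ => by simp [hy]) ?_ ?_ hρ i j le_rfl hij le_rfl
  · simpa using main
  · calc C * min 1 ((1 - κ) / 2 / C) ≤ C * ((1 - κ) / 2 / C) := by
          gcongr; exact min_le_right _ _
      _ = (1 - κ) / 2 := by field_simp
  · intro u m v hu hum hmv hv
    set φ := ω u v ^ α with hφ
    have hφ1 : φ ≤ 1 := (hω.mono_pow (by linarith) trivial trivial trivial trivial hu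
      (hum.trans hmv) hv).trans (hρ.trans (min_le_left _ _))
    have e1 : ω u m ^ α ≤ φ := hω.mono_pow (by linarith) trivial trivial trivial trivial le_rfl
      hum hmv
    have e2 : ω m v ^ α ≤ φ := hω.mono_pow (by linarith) trivial trivial trivial trivial hum
      hmv le_rfl
    have n1 := hφ0 u m hum
    have n2 := hφ0 m v hmv
    have n3 : 0 ≤ φ := hφ0 u v (hum.trans hmv)
    have b1 : ‖x v - x m‖ ≤ φ := (h.path_le m v hmv).trans e2
    have b2 : ‖a m v‖ ≤ φ ^ 2 := (h.area_le m v hmv).trans (by gcongr)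
    set r := ‖err f x a y u m‖ with hr
    have hr0 : 0 ≤ r := norm_nonneg _
    have hbd := h.norm_err_defect_le hf hM y hum hmv (e1.trans hφ1)
    have hM5 : M ^ 2 ≤ M ^ 5 := pow_le_pow_right₀ hM (by norm_num)
    have hM4 : M ^ 4 ≤ M ^ 5 := pow_le_pow_right₀ hM (by norm_num)
    have hM1 : M ≤ M ^ 5 := le_self_pow₀ hM (by norm_num)
    have hD2 : tensConst d ≤ tensConst d ^ 2 := le_self_pow₀ hD (by norm_num)
    calc _ ≤ (M * r + 5 * tensConst d ^ 2 * M ^ 5 * (ω u m ^ α) ^ 2) * ‖x v - x m‖ +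
          tensConst d * (2 * M ^ 2 * r + 4 * tensConst d * M ^ 4 * ω u m ^ α) * ‖a m v‖ := hbd
      _ ≤ (M ^ 5 * r + 5 * tensConst d ^ 2 * M ^ 5 * φ ^ 2) * φ +
          tensConst d * (2 * M ^ 5 * r + 4 * tensConst d * M ^ 5 * φ) * φ ^ 2 := by gcongr
      _ = (1 * (M ^ 5 * r * φ) + 2 * tensConst d * (M ^ 5 * r * φ) * φ) +
            9 * tensConst d ^ 2 * M ^ 5 * φ ^ 3 := by ring
      _ ≤ (tensConst d ^ 2 * (M ^ 5 * r * φ) + 2 * tensConst d ^ 2 * (M ^ 5 * r * φ) * 1) +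
            9 * tensConst d ^ 2 * M ^ 5 * φ ^ 3 := by
          gcongr
          exact hD.trans hD2
      _ ≤ C * 1 * φ ^ 3 + C * φ * r := by
          have : 0 ≤ tensConst d ^ 2 * (M ^ 5 * r * φ) := by positivity
          rw [hC]; nlinarith
  · intro u v hu huv hv
    have := hφ0 u v huv
    positivity

/-- The local bound spreads to all intervals through at most `⌈Ω / ρ ^ 3⌉₊ + 1` blocks joined by
single steps. Where `ω i j ^ α ≥ ρ`, a uniform bound suffices after division by a power of `ρ`. The
last clause bounds the error up to `j + 1` by the control up to `j`: the final step, however large,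
has no error of its own, and the defect at `j` carries a factor that is small with `ω i j`. -/
theorem exists_apriori (d k : ℕ) {α₀ M Ω : ℝ} (hα₀ : 1 / 3 < α₀) (hM : 1 ≤ M) (hΩ : 1 ≤ Ω) :
    ∃ ρ B : ℝ, 0 < ρ ∧ ρ ≤ 1 ∧ 0 ≤ B ∧ ∀ α, α₀ ≤ α → α ≤ 1 →
      ∀ f : Vec k → Vec d →L[ℝ] Vec k, BoundC2 f M →
      ∀ (x : ℕ → Vec d) (a : ℕ → ℕ → Tens d) (ω : ℕ → ℕ → ℝ) (y : ℕ → Vec k),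
      IsControl univ ω → DiscreteRough x a ω α → (∀ i j, i ≤ j → ω i j ≤ Ω) →
      (∀ i, err f x a y i (i + 1) = 0) → ∀ i j, i ≤ j →
        (ω i j ^ α ≤ ρ → ‖err f x a y i j‖ ≤ B * (ω i j ^ α) ^ 3) ∧
        ‖y j - y i‖ ≤ B * ω i j ^ α ∧
        ‖y j - y i - f (y i) (x j - x i)‖ ≤ B * (ω i j ^ α) ^ 2 ∧
        (ω i j ^ α ≤ ρ → ‖err f x a y i (j + 1)‖ ≤ B * ω i j ^ α) := by
  obtain ⟨ρ, L, hρ, hρ1, hL, hloc⟩ := exists_apriori_local d k hα₀ hM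
  have hD := one_le_tensConst d
  set D := tensConst d with hDdef
  set B₀ := L + 2 * D * M ^ 2 with hB₀
  -- The cost of one block plus the cost of one single step.
  set A := B₀ + (M * Ω + D * M ^ 2 * Ω ^ 2) with hA
  set N := ⌈Ω / ρ ^ 3⌉₊ with hN
  set A' := (N + 1 : ℝ) * A with hA'
  set B₂ := B₀ + A' / ρ with hB₂
  set B₃ := L + D * M ^ 2 + (A' + M * Ω) / ρ ^ 2 with hB₃
  set B₄ := L + (M * L + 5 * D ^ 2 * M ^ 5) * Ω + D * (2 * M ^ 2 * L + 4 * D * M ^ 4) * Ω ^ 2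
    with hB₄
  have hB₀0 : 0 ≤ B₀ := by positivity
  have hA0 : 0 ≤ A := by positivity
  have hA'0 : 0 ≤ A' := by positivity
  have hB₂0 : 0 ≤ B₂ := by positivity
  have hB₃0 : 0 ≤ B₃ := by positivity
  have hB₄0 : 0 ≤ B₄ := by positivity
  refine ⟨ρ, L + B₂ + B₃ + B₄, hρ, hρ1, by positivity, ?_⟩
  intro α hα hα1 f hf x a ω y hω h hΩω hy i j hij
  have hφ0 : ∀ i j, i ≤ j → 0 ≤ ω i j ^ α := fun i j h =>
    Real.rpow_nonneg (hω.nonneg i trivial j trivial h) α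
  have hφΩ : ∀ i j, i ≤ j → ω i j ^ α ≤ Ω := fun i j h =>
    rpow_le_of_le (hω.nonneg i trivial j trivial h) hΩ (by linarith) hα1 (hΩω i j h)
  have hJ := hloc α hα f hf x a ω y hω h hy
  have hYloc : ∀ i j, i ≤ j → ω i j ^ α ≤ ρ → ‖y j - y i‖ ≤ B₀ * ω i j ^ α := by
    intro i j hij hr
    have h1 := norm_sub_le_add_germ hf hM (y := y i) (z := y j) (hr.trans hρ1)
      (h.path_le i j hij) (h.area_le i j hij)
    have h2 := hJ i j hij hr
    have h0 := hφ0 i j hij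
    have h3 : L * (ω i j ^ α) ^ 3 ≤ L * ω i j ^ α := by
      gcongr
      exact pow_le_of_le_one h0 (hr.trans hρ1) (by norm_num)
    simp only [err] at h2
    rw [hB₀]; linarith
  have hstep : ∀ i, ‖y (i + 1) - y i‖ ≤ M * Ω + D * M ^ 2 * Ω ^ 2 := by
    intro i
    have h1 := hy i
    rw [err, sub_eq_zero] at h1
    rw [h1]
    have h0 := hφ0 i (i + 1) (by omega)
    refine norm_germ_le hf _ ((h.path_le i (i + 1) (by omega)).trans (hφΩ _ _ (by omega)))
      ((h.area_le i (i + 1) (by omega)).trans ?_)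
    gcongr
    exact hφΩ _ _ (by omega)
  have hglob : ∀ i j, i ≤ j → ‖y j - y i‖ ≤ A' := by
    intro i j hij
    refine IsControl.block_induction hω (r := ρ ^ 3) (by positivity)
      (Q := fun N i j => ‖y j - y i‖ ≤ (N + 1 : ℝ) * A) ?_ ?_ N i j hij ?_
    · intro N i j hij hr
      have hr' := rpow_le_of_le_cube (hω.nonneg i trivial j trivial hij) hρ hρ1
        (by linarith : 1 / 3 ≤ α) hr
      have h1 : B₀ * ω i j ^ α ≤ B₀ * 1 := by gcongr; exact hr'.trans hρ1
      have h2 : (0 : ℝ) ≤ N * A := by positivity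
      have h3 : 0 ≤ M * Ω + D * M ^ 2 * Ω ^ 2 := by positivity
      have := hYloc i j hij hr'
      rw [hA] at h2 ⊢
      linarith
    · intro N i b j hib hbj hr hQ
      have hr' := rpow_le_of_le_cube (hω.nonneg i trivial b trivial hib) hρ hρ1
        (by linarith : 1 / 3 ≤ α) hr
      have h1 : B₀ * ω i b ^ α ≤ B₀ * 1 := by gcongr; exact hr'.trans hρ1
      have h2 := hYloc i b hib hr'
      have h3 := hstep b
      have e : y j - y i = (y j - y (b + 1)) + (y (b + 1) - y b) + (y b - y i) := by abel
      rw [e]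
      refine norm_add₃_le.trans ?_
      push_cast
      have : ((N : ℝ) + 1 + 1) * A = (N + 1 : ℝ) * A + B₀ + (M * Ω + D * M ^ 2 * Ω ^ 2) := by
        rw [hA]; ring
      linarith
    · calc ω i j ≤ Ω := hΩω i j hij
        _ = Ω / ρ ^ 3 * ρ ^ 3 := by field_simp
        _ ≤ N * ρ ^ 3 := by gcongr; exact Nat.le_ceil _
  have h0 := hφ0 i j hij
  have hle : ∀ {u v : ℝ}, 0 ≤ v → ∀ {c : ℝ}, c ≤ u → c * v ≤ u * v := fun hv _ hc =>
    mul_le_mul_of_nonneg_right hc hv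
  refine ⟨fun hr => ?_, ?_, ?_, fun hr => ?_⟩
  · exact (hJ i j hij hr).trans (hle (by positivity) (by linarith))
  · refine le_trans ?_ (hle (c := B₂) h0 (by linarith))
    rcases le_total (ω i j ^ α) ρ with hr | hr
    · refine (hYloc i j hij hr).trans (hle h0 ?_)
      have : 0 ≤ A' / ρ := by positivity
      linarith
    · refine (hglob i j hij).trans ?_
      calc A' = A' / ρ * ρ := by field_simp
        _ ≤ A' / ρ * ω i j ^ α := by gcongr
        _ ≤ B₂ * ω i j ^ α := hle h0 (by linarith)
  · refine le_trans ?_ (hle (c := B₃) (by positivity) (by linarith))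
    rcases le_total (ω i j ^ α) ρ with hr | hr
    · have e : y j - y i - f (y i) (x j - x i) =
          err f x a y i j + tensApply (coefD f (y i)) (a i j) := by
        simp only [err, germ]; abel
      rw [e]
      have h1 := hJ i j hij hr
      have h2 := norm_tensApply_coefD_le hf (y i) (h.area_le i j hij)
      have h3 : L * (ω i j ^ α) ^ 3 ≤ L * (ω i j ^ α) ^ 2 := by
        gcongr L * ?_
        exact pow_le_pow_of_le_one h0 (hr.trans hρ1) (by norm_num)
      refine (norm_add_le _ _).trans (le_trans (b := (L + D * M ^ 2) * (ω i j ^ α) ^ 2) ?_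
        (hle (by positivity) ?_))
      · linarith
      · have : 0 ≤ (A' + M * Ω) / ρ ^ 2 := by positivity
        linarith
    · have h1 := hglob i j hij
      have h2 := norm_apply_le_of_le hf (y i) ((h.path_le i j hij).trans (hφΩ i j hij))
      calc _ ≤ A' + M * Ω := (norm_sub_le _ _).trans (add_le_add h1 h2)
        _ = (A' + M * Ω) / ρ ^ 2 * ρ ^ 2 := by field_simp
        _ ≤ (A' + M * Ω) / ρ ^ 2 * (ω i j ^ α) ^ 2 := by gcongr
        _ ≤ B₃ * (ω i j ^ α) ^ 2 := hle (by positivity) (by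
          have : 0 ≤ L + D * M ^ 2 := by positivity
          linarith)
  · refine le_trans ?_ (hle (c := B₄) h0 (by linarith))
    set φ := ω i j ^ α with hφ
    have hφ1 : φ ≤ 1 := hr.trans hρ1
    have h1 := h.norm_err_defect_le hf hM y hij (Nat.le_succ j) (hr.trans hρ1)
    have h2 : ‖err f x a y i j‖ ≤ L * φ := (hJ i j hij hr).trans (by
      gcongr
      exact pow_le_of_le_one h0 hφ1 (by norm_num))
    have h3 : ‖x (j + 1) - x j‖ ≤ Ω :=
      (h.path_le j (j + 1) (by omega)).trans (hφΩ _ _ (by omega))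
    have h4 : ‖a j (j + 1)‖ ≤ Ω ^ 2 :=
      (h.area_le j (j + 1) (by omega)).trans
        (pow_le_pow_left₀ (hφ0 _ _ (by omega)) (hφΩ _ _ (by omega)) 2)
    -- The summand `err f x a y j (j + 1)` vanishes, so only the defect at `j` is added.
    have e : err f x a y i (j + 1) = err f x a y i j + (err f x a y i (j + 1) -
        err f x a y i j - err f x a y j (j + 1)) := by rw [hy j]; abel
    rw [e]
    refine (norm_add_le _ _).trans ?_
    have h5 : φ ^ 2 ≤ φ := pow_le_of_le_one h0 hφ1 (by norm_num)
    calc _ ≤ L * φ + ((M * (L * φ) + 5 * D ^ 2 * M ^ 5 * φ) * Ω +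
          D * (2 * M ^ 2 * (L * φ) + 4 * D * M ^ 4 * φ) * Ω ^ 2) := by
          refine add_le_add h2 (h1.trans ?_)
          gcongr
      _ = B₄ * φ := by rw [hB₄]; ring

end Discrete

end CadlagRDE

/-! ### Comparison of two coefficients: germs and defects -/

namespace CadlagRDE

variable {d k : ℕ}

/-- Two coefficients in `C³_b` with constant `M` that are `θ`-close in `C²_b`. -/
structure CoefPair (f g : Vec k → Vec d →L[ℝ] Vec k) (M θ : ℝ) : Prop where
  one_le : 1 ≤ M
  left : BoundC2 f M
  left_fderiv : BoundC2 (fderiv ℝ f) M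
  right : BoundC2 g M
  sub : BoundC2 (fun x => f x - g x) θ

namespace CoefPair

variable {f g : Vec k → Vec d →L[ℝ] Vec k} {M θ S : ℝ}

/-- In this and the following estimates `S` dominates both `θ` and the distance of the base points,
so that differences of the data and of the solutions are measured by a single number. -/
theorem norm_sub_le (h : CoefPair f g M θ) (hS : θ ≤ S) {y y' : Vec k} (hy : ‖y - y'‖ ≤ S) :
    ‖f y - g y'‖ ≤ 2 * M * S := by
  have h1 := h.left.lip y y'
  have h2 := h.sub.bound y'
  have hM := h.one_le
  have hS0 : 0 ≤ S := (norm_nonneg _).trans hy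
  have e : f y - g y' = (f y - f y') + (f y' - g y') := by abel
  rw [e]
  refine (norm_add_le _ _).trans ((add_le_add h1 h2).trans ?_)
  have : M * ‖y - y'‖ ≤ M * S := by gcongr
  nlinarith

theorem norm_fderiv_sub_le (h : CoefPair f g M θ) (hS : θ ≤ S) {y y' : Vec k}
    (hy : ‖y - y'‖ ≤ S) : ‖fderiv ℝ f y - fderiv ℝ g y'‖ ≤ 2 * M * S := by
  have h1 := h.left.fderiv_lip y y'
  have h2 := h.left.fderiv_sub_bound h.right.diff h.sub y'
  have hM := h.one_le
  have hS0 : 0 ≤ S := (norm_nonneg _).trans hy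
  have e : fderiv ℝ f y - fderiv ℝ g y' =
    (fderiv ℝ f y - fderiv ℝ f y') + (fderiv ℝ f y' - fderiv ℝ g y') := by abel
  rw [e]
  refine (norm_add_le _ _).trans ((add_le_add h1 h2).trans ?_)
  have : M * ‖y - y'‖ ≤ M * S := by gcongr
  nlinarith

theorem norm_coefD_sub_le (h : CoefPair f g M θ) (hS : θ ≤ S) {y y' : Vec k}
    (hy : ‖y - y'‖ ≤ S) : ‖coefD f y - coefD g y'‖ ≤ 4 * M ^ 2 * S := by
  have hM := h.one_le
  have hS0 : 0 ≤ S := (norm_nonneg _).trans hy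
  have e : coefD f y - coefD g y' =
      (fderiv ℝ f y - fderiv ℝ g y').comp (f y) + (fderiv ℝ g y').comp (f y - g y') := by
    ext v w
    simp [coefD]
  have h1 : ‖(fderiv ℝ f y - fderiv ℝ g y').comp (f y)‖ ≤
      ‖fderiv ℝ f y - fderiv ℝ g y'‖ * ‖f y‖ := ContinuousLinearMap.opNorm_comp_le _ _
  have h2 : ‖(fderiv ℝ g y').comp (f y - g y')‖ ≤ ‖fderiv ℝ g y'‖ * ‖f y - g y'‖ :=
    ContinuousLinearMap.opNorm_comp_le _ _
  have h3 := norm_add_le ((fderiv ℝ f y - fderiv ℝ g y').comp (f y))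
    ((fderiv ℝ g y').comp (f y - g y'))
  rw [e]
  refine h3.trans ((add_le_add h1 h2).trans ?_)
  calc ‖fderiv ℝ f y - fderiv ℝ g y'‖ * ‖f y‖ + ‖fderiv ℝ g y'‖ * ‖f y - g y'‖
      ≤ (2 * M * S) * M + M * (2 * M * S) := by
        gcongr
        exacts [h.norm_fderiv_sub_le hS hy, h.left.bound _, h.right.fderiv_bound _,
          h.norm_sub_le hS hy]
    _ = _ := by ring

theorem norm_apply_sub_le (h : CoefPair f g M θ) (hS : θ ≤ S) {y y' : Vec k}
    (hy : ‖y - y'‖ ≤ S) {x x' : Vec d} {r : ℝ} (hx : ‖x‖ ≤ r) (hxx : ‖x - x'‖ ≤ S * r) :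
    ‖f y x - g y' x'‖ ≤ 3 * M * S * r := by
  have hM := h.one_le
  have hS0 : 0 ≤ S := (norm_nonneg _).trans hy
  have e : f y x - g y' x' = (f y - g y') x + g y' (x - x') := by
    simp only [_root_.sub_apply, map_sub]; abel
  rw [e]
  have h1 : ‖(f y - g y') x‖ ≤ 2 * M * S * r :=
    ((f y - g y').le_opNorm x).trans
      (mul_le_mul (h.norm_sub_le hS hy) hx (norm_nonneg _) (by positivity))
  have h2 := norm_apply_le_of_le h.right y' hxx
  refine (norm_add_le _ _).trans ((add_le_add h1 h2).trans_eq (by ring))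

theorem norm_tensApply_sub_le (h : CoefPair f g M θ) (hS : θ ≤ S) {y y' : Vec k}
    (hy : ‖y - y'‖ ≤ S) {a a' : Tens d} {r : ℝ} (ha : ‖a‖ ≤ r) (haa : ‖a - a'‖ ≤ S * r) :
    ‖tensApply (coefD f y) a - tensApply (coefD g y') a'‖ ≤ 5 * tensConst d * M ^ 2 * S * r := by
  have hM := h.one_le
  have hD := one_le_tensConst d
  have hS0 : 0 ≤ S := (norm_nonneg _).trans hy
  have e : tensApply (coefD f y) a - tensApply (coefD g y') a' =
      tensApply (coefD f y - coefD g y') a + tensApply (coefD g y') (a - a') := by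
    rw [tensApply_sub_left, tensApply_sub_right]; abel
  rw [e]
  have h1 : ‖tensApply (coefD f y - coefD g y') a‖ ≤ tensConst d * (4 * M ^ 2 * S) * r := by
    refine (norm_tensApply_le _ _).trans ?_
    gcongr
    exact h.norm_coefD_sub_le hS hy
  have h2 := norm_tensApply_coefD_le h.right y' haa
  refine (norm_add_le _ _).trans ((add_le_add h1 h2).trans_eq (by ring))

theorem norm_germ_sub_le (h : CoefPair f g M θ) (hS : θ ≤ S) {y y' : Vec k}
    (hy : ‖y - y'‖ ≤ S) {x x' : Vec d} {a a' : Tens d} {r : ℝ} (hx : ‖x‖ ≤ r)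
    (hxx : ‖x - x'‖ ≤ S * r) (ha : ‖a‖ ≤ r ^ 2) (haa : ‖a - a'‖ ≤ S * r ^ 2) :
    ‖germ f y x a - germ g y' x' a'‖ ≤
      3 * M * S * r + 5 * tensConst d * M ^ 2 * S * r ^ 2 := by
  have e : germ f y x a - germ g y' x' a' = (f y x - g y' x') +
      (tensApply (coefD f y) a - tensApply (coefD g y') a') := by
    simp only [germ]; abel
  rw [e]
  exact (norm_add_le _ _).trans (add_le_add (h.norm_apply_sub_le hS hy hx hxx)
    (h.norm_tensApply_sub_le hS hy ha haa))

theorem four_point (h : CoefPair f g M θ) (hS : θ ≤ S) {y z y' z' : Vec k}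
    (hy : ‖y - y'‖ ≤ S) :
    ‖(f z - f y) - (g z' - g y')‖ ≤
      M * ‖(z - y) - (z' - y')‖ + M * S * (‖z - y‖ + ‖z' - y'‖) := by
  have hM := h.one_le
  have hS0 : 0 ≤ S := (norm_nonneg _).trans hy
  have h1 := h.left.four_point y z y' z'
  have h2 := h.sub.lip z' y'
  have e : (f z - f y) - (g z' - g y') =
      ((f z - f y) - (f z' - f y')) + ((f z' - g z') - (f y' - g y')) := by abel
  rw [e]
  refine (norm_add_le _ _).trans ((add_le_add h1 h2).trans ?_)
  have h3 : M * ‖y - y'‖ * ‖z - y‖ ≤ M * S * ‖z - y‖ := by gcongr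
  have h4 : θ * ‖z' - y'‖ ≤ M * S * ‖z' - y'‖ := by
    gcongr
    nlinarith
  linarith

theorem four_point_fderiv (h : CoefPair f g M θ) (hS : θ ≤ S) {y z y' z' : Vec k}
    (hy : ‖y - y'‖ ≤ S) :
    ‖(fderiv ℝ f z - fderiv ℝ f y) - (fderiv ℝ g z' - fderiv ℝ g y')‖ ≤
      M * ‖(z - y) - (z' - y')‖ + M * S * (‖z - y‖ + ‖z' - y'‖) := by
  have hM := h.one_le
  have hS0 : 0 ≤ S := (norm_nonneg _).trans hy
  have h1 := h.left_fderiv.four_point y z y' z'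
  have h2 := h.left.fderiv_sub_lip h.right.diff h.sub z' y'
  have e : (fderiv ℝ f z - fderiv ℝ f y) - (fderiv ℝ g z' - fderiv ℝ g y') =
      ((fderiv ℝ f z - fderiv ℝ f y) - (fderiv ℝ f z' - fderiv ℝ f y')) +
        ((fderiv ℝ f z' - fderiv ℝ g z') - (fderiv ℝ f y' - fderiv ℝ g y')) := by abel
  have h0 := norm_add_le ((fderiv ℝ f z - fderiv ℝ f y) - (fderiv ℝ f z' - fderiv ℝ f y'))
    ((fderiv ℝ f z' - fderiv ℝ g z') - (fderiv ℝ f y' - fderiv ℝ g y'))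
  rw [e]
  refine h0.trans ((add_le_add h1 h2).trans ?_)
  have h3 : M * ‖y - y'‖ * ‖z - y‖ ≤ M * S * ‖z - y‖ := by gcongr
  have h4 : θ * ‖z' - y'‖ ≤ M * S * ‖z' - y'‖ := by
    gcongr
    nlinarith
  linarith

/-- Product rule for second differences: second differences of `fderiv` and of the coefficient, each
times a bounded factor, and two products of first differences. -/
theorem four_point_coefD (h : CoefPair f g M θ) (hS : θ ≤ S) {y z y' z' : Vec k}
    (hy : ‖y - y'‖ ≤ S) (hz : ‖z - z'‖ ≤ S) :
    ‖(coefD f z - coefD f y) - (coefD g z' - coefD g y')‖ ≤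
      2 * M ^ 2 * ‖(z - y) - (z' - y')‖ + 4 * M ^ 2 * S * (‖z - y‖ + ‖z' - y'‖) := by
  have hM := h.one_le
  have hS0 : 0 ≤ S := (norm_nonneg _).trans hy
  have e : (coefD f z - coefD f y) - (coefD g z' - coefD g y') =
      ((fderiv ℝ f z - fderiv ℝ f y) - (fderiv ℝ g z' - fderiv ℝ g y')).comp (f z) +
      (fderiv ℝ g z' - fderiv ℝ g y').comp (f z - g z') +
      ((fderiv ℝ f y - fderiv ℝ g y').comp (f z - f y) +
      (fderiv ℝ g y').comp ((f z - f y) - (g z' - g y'))) := by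
    ext v w
    simp only [coefD, ContinuousLinearMap.comp_apply, _root_.sub_apply, _root_.add_apply,
      map_sub, PiLp.sub_apply, PiLp.add_apply]
    ring
  set Δ := ‖(z - y) - (z' - y')‖
  have b1 : ‖((fderiv ℝ f z - fderiv ℝ f y) - (fderiv ℝ g z' - fderiv ℝ g y')).comp (f z)‖ ≤
      (M * Δ + M * S * (‖z - y‖ + ‖z' - y'‖)) * M :=
    (ContinuousLinearMap.opNorm_comp_le _ _).trans (mul_le_mul (h.four_point_fderiv hS hy)
      (h.left.bound _) (norm_nonneg _) (by positivity))
  have b2 : ‖(fderiv ℝ g z' - fderiv ℝ g y').comp (f z - g z')‖ ≤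
      (M * ‖z' - y'‖) * (2 * M * S) :=
    (ContinuousLinearMap.opNorm_comp_le _ _).trans (mul_le_mul (h.right.fderiv_lip _ _)
      (h.norm_sub_le hS hz) (norm_nonneg _) (by positivity))
  have b3 : ‖(fderiv ℝ f y - fderiv ℝ g y').comp (f z - f y)‖ ≤ (2 * M * S) * (M * ‖z - y‖) :=
    (ContinuousLinearMap.opNorm_comp_le _ _).trans (mul_le_mul (h.norm_fderiv_sub_le hS hy)
      (h.left.lip _ _) (norm_nonneg _) (by positivity))
  have b4 : ‖(fderiv ℝ g y').comp ((f z - f y) - (g z' - g y'))‖ ≤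
      M * (M * Δ + M * S * (‖z - y‖ + ‖z' - y'‖)) :=
    (ContinuousLinearMap.opNorm_comp_le _ _).trans (mul_le_mul (h.right.fderiv_bound _)
      (h.four_point hS hy) (norm_nonneg _) (by positivity))
  rw [e]
  have key : ∀ p q r s : Vec d →L[ℝ] Vec d →L[ℝ] Vec k,
      ‖p + q + (r + s)‖ ≤ ‖p‖ + ‖q‖ + (‖r‖ + ‖s‖) := fun p q r s =>
    (norm_add_le (p + q) (r + s)).trans (add_le_add (norm_add_le p q) (norm_add_le r s))
  refine (key _ _ _ _).trans ((add_le_add (add_le_add b1 b2) (add_le_add b3 b4)).trans_eq ?_)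
  ring

/-- The first order remainder `f(z) - f(y) - Df(y) f(y) x`, compared for two solutions. -/
theorem norm_first_order_sub_le (h : CoefPair f g M θ) (hS : θ ≤ S) {y z y' z' : Vec k}
    (hy : ‖y - y'‖ ≤ S) (x x' : Vec d) :
    ‖(f z - f y - fderiv ℝ f y (f y x)) - (g z' - g y' - fderiv ℝ g y' (g y' x'))‖ ≤
      M * S * ‖z - y‖ ^ 2 + M * (‖z - y‖ + ‖z' - y'‖) * ‖(z - y) - (z' - y')‖ +
        S * ‖z' - y'‖ ^ 2 + (2 * M * S * ‖z - y - f y x‖ +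
          M * ‖(z - y - f y x) - (z' - y' - g y' x')‖) := by
  have hM := h.one_le
  have hS0 : 0 ≤ S := (norm_nonneg _).trans hy
  have e : (f z - f y - fderiv ℝ f y (f y x)) - (g z' - g y' - fderiv ℝ g y' (g y' x')) =
      ((f z - f y - fderiv ℝ f y (z - y)) - (g z' - g y' - fderiv ℝ g y' (z' - y'))) +
      ((fderiv ℝ f y - fderiv ℝ g y') (z - y - f y x) +
        fderiv ℝ g y' ((z - y - f y x) - (z' - y' - g y' x'))) := by
    simp only [_root_.sub_apply, map_sub]; abel
  rw [e]
  refine (norm_add_le _ _).trans (add_le_add ?_ ((norm_add_le _ _).trans (add_le_add ?_ ?_)))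
  · refine (h.left.taylor_sub h.left_fderiv h.right.diff h.sub y z y' z').trans ?_
    gcongr
  · exact (ContinuousLinearMap.le_opNorm _ _).trans
      (mul_le_mul_of_nonneg_right (h.norm_fderiv_sub_le hS hy) (norm_nonneg _))
  · exact (ContinuousLinearMap.le_opNorm _ _).trans
      (mul_le_mul_of_nonneg_right (h.right.fderiv_bound _) (norm_nonneg _))

set_option maxHeartbeats 1000000 in
/-- The defect of the germ, compared for two solutions. -/
theorem norm_defect_sub_le (h : CoefPair f g M θ) (hS : θ ≤ S) {y z y' z' : Vec k}
    (hy : ‖y - y'‖ ≤ S) (hz : ‖z - z'‖ ≤ S) {x₁ x₁' x₂ x₂' : Vec d} {a₁ a₁' a₂ a₂' : Tens d}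
    {φ : ℝ} (hφ : φ ≤ 1) (hx₁ : ‖x₁‖ ≤ φ) (hx₁' : ‖x₁'‖ ≤ φ) (hx₂ : ‖x₂‖ ≤ φ)
    (ha₁ : ‖a₁‖ ≤ φ ^ 2) (ha₂ : ‖a₂‖ ≤ φ ^ 2) (hdx₁ : ‖x₁ - x₁'‖ ≤ S * φ)
    (hdx₂ : ‖x₂ - x₂'‖ ≤ S * φ) (hda₁ : ‖a₁ - a₁'‖ ≤ S * φ ^ 2) (hda₂ : ‖a₂ - a₂'‖ ≤ S * φ ^ 2)
    (hR : ‖z - y - f y x₁‖ ≤ φ ^ 2) (hR' : ‖z' - y' - g y' x₁'‖ ≤ φ ^ 2) :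
    ‖((f z - f y - fderiv ℝ f y (f y x₁)) x₂ + tensApply (coefD f z - coefD f y) a₂) -
      ((g z' - g y' - fderiv ℝ g y' (g y' x₁')) x₂' + tensApply (coefD g z' - coefD g y') a₂')‖ ≤
      88 * tensConst d ^ 2 * M ^ 4 * S * φ ^ 3 + 88 * tensConst d ^ 2 * M ^ 4 * φ *
        ‖(z - y - germ f y x₁ a₁) - (z' - y' - germ g y' x₁' a₁')‖ := by
  have hM := h.one_le
  have hD := one_le_tensConst d
  have hS0 : 0 ≤ S := (norm_nonneg _).trans hy
  have hφ0 : 0 ≤ φ := (norm_nonneg _).trans hx₁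
  set D := tensConst d with hDdef
  set e := ‖(z - y - germ f y x₁ a₁) - (z' - y' - germ g y' x₁' a₁')‖ with he
  have he0 : 0 ≤ e := norm_nonneg _
  have hφ2 : φ ^ 2 ≤ φ := pow_le_of_le_one hφ0 hφ (by norm_num)
  have hMM : M ≤ M ^ 2 := le_self_pow₀ hM (by norm_num)
  have hM23 : M ^ 2 ≤ M ^ 3 := pow_le_pow_right₀ hM (by norm_num)
  have hM34 : M ^ 3 ≤ M ^ 4 := pow_le_pow_right₀ hM (by norm_num)
  have hM24 : M ^ 2 ≤ M ^ 4 := hM23.trans hM34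
  have hDD : D ≤ D ^ 2 := le_self_pow₀ hD (by norm_num)
  have hD21 : 1 ≤ D ^ 2 := hD.trans hDD
  have hh : ‖z - y‖ ≤ 2 * M * φ := by
    have h1 := norm_add_le (z - y - f y x₁) (f y x₁)
    rw [sub_add_cancel] at h1
    have h2 := norm_apply_le_of_le h.left y hx₁
    nlinarith
  have hh' : ‖z' - y'‖ ≤ 2 * M * φ := by
    have h1 := norm_add_le (z' - y' - g y' x₁') (g y' x₁')
    rw [sub_add_cancel] at h1
    have h2 := norm_apply_le_of_le h.right y' hx₁'
    nlinarith
  -- The difference of increments equals the difference of errors plus the difference of germs, and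
  -- the latter is Lipschitz in the data. In this way the estimate is expressed through `e` instead
  -- of unknown increments.
  have hΔ : ‖(z - y) - (z' - y')‖ ≤ e + 8 * D * M ^ 2 * S * φ := by
    have h1 := norm_add_le ((z - y - germ f y x₁ a₁) - (z' - y' - germ g y' x₁' a₁'))
      (germ f y x₁ a₁ - germ g y' x₁' a₁')
    have e1 : ((z - y - germ f y x₁ a₁) - (z' - y' - germ g y' x₁' a₁')) +
      (germ f y x₁ a₁ - germ g y' x₁' a₁') = (z - y) - (z' - y') := by abel
    rw [e1] at h1
    have h2 := h.norm_germ_sub_le hS hy hx₁ hdx₁ ha₁ hda₁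
    have h3 : 5 * D * M ^ 2 * S * φ ^ 2 ≤ 5 * D * M ^ 2 * S * φ := by gcongr
    have h4 : 3 * M * S * φ ≤ 3 * (D * M ^ 2) * S * φ := by
      gcongr
      nlinarith
    linarith
  have hΔR : ‖(z - y - f y x₁) - (z' - y' - g y' x₁')‖ ≤ e + 5 * D * M ^ 2 * S * φ ^ 2 := by
    have h1 := norm_add_le ((z - y - germ f y x₁ a₁) - (z' - y' - germ g y' x₁' a₁'))
      (tensApply (coefD f y) a₁ - tensApply (coefD g y') a₁')
    have e1 : ((z - y - germ f y x₁ a₁) - (z' - y' - germ g y' x₁' a₁')) +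
      (tensApply (coefD f y) a₁ - tensApply (coefD g y') a₁') =
        (z - y - f y x₁) - (z' - y' - g y' x₁') := by simp only [germ]; abel
    rw [e1] at h1
    have h2 := h.norm_tensApply_sub_le hS hy ha₁ hda₁
    linarith
  have hA : ‖(f z - f y - fderiv ℝ f y (f y x₁)) - (g z' - g y' - fderiv ℝ g y' (g y' x₁'))‖ ≤
      5 * M ^ 2 * e + 47 * D * M ^ 4 * S * φ ^ 2 := by
    refine (h.norm_first_order_sub_le hS hy x₁ x₁').trans ?_
    calc _ ≤ M * S * (2 * M * φ) ^ 2 + M * (2 * M * φ + 2 * M * φ) *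
          (e + 8 * D * M ^ 2 * S * φ) + S * (2 * M * φ) ^ 2 + (2 * M * S * φ ^ 2 +
          M * (e + 5 * D * M ^ 2 * S * φ ^ 2)) := by gcongr
      _ = 4 * M ^ 2 * e * φ + M * e + (4 * (1 * M ^ 3) + 32 * (D * M ^ 4) + 4 * (1 * M ^ 2) +
          2 * (1 * M) + 5 * (D * M ^ 3)) * (S * φ ^ 2) := by ring
      _ ≤ 4 * M ^ 2 * e * 1 + M ^ 2 * e + (4 * (D * M ^ 4) + 32 * (D * M ^ 4) + 4 * (D * M ^ 4) +
          2 * (D * M ^ 4) + 5 * (D * M ^ 4)) * (S * φ ^ 2) := by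
        gcongr
        exact hMM.trans hM24
      _ = _ := by ring
  have hA' : ‖g z' - g y' - fderiv ℝ g y' (g y' x₁')‖ ≤ 5 * M ^ 3 * φ ^ 2 := by
    have h1 := h.right.taylor y' z'
    have e1 : g z' - g y' - fderiv ℝ g y' (g y' x₁') =
        (g z' - g y' - fderiv ℝ g y' (z' - y')) + fderiv ℝ g y' (z' - y' - g y' x₁') := by
      simp only [map_sub]; abel
    have h2 : ‖fderiv ℝ g y' (z' - y' - g y' x₁')‖ ≤ M * φ ^ 2 :=
      (ContinuousLinearMap.le_opNorm _ _).trans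
        (mul_le_mul (h.right.fderiv_bound _) hR' (norm_nonneg _) (by linarith))
    rw [e1]
    refine (norm_add_le _ _).trans ((add_le_add h1 h2).trans ?_)
    calc _ ≤ M * (2 * M * φ) ^ 2 + M * φ ^ 2 := by gcongr
      _ = 4 * M ^ 3 * φ ^ 2 + M * φ ^ 2 := by ring
      _ ≤ 4 * M ^ 3 * φ ^ 2 + M ^ 3 * φ ^ 2 := by gcongr; exact hMM.trans hM23
      _ = _ := by ring
  have hc : ‖(coefD f z - coefD f y) - (coefD g z' - coefD g y')‖ ≤
      2 * M ^ 2 * e + 32 * D * M ^ 4 * S * φ := by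
    refine (h.four_point_coefD hS hy hz).trans ?_
    calc _ ≤ 2 * M ^ 2 * (e + 8 * D * M ^ 2 * S * φ) +
          4 * M ^ 2 * S * (2 * M * φ + 2 * M * φ) := by gcongr
      _ = 2 * M ^ 2 * e + 16 * D * M ^ 4 * S * φ + 16 * (1 * M ^ 3) * (S * φ) := by ring
      _ ≤ 2 * M ^ 2 * e + 16 * D * M ^ 4 * S * φ + 16 * (D * M ^ 4) * (S * φ) := by gcongr
      _ = _ := by ring
  have hc' : ‖coefD g z' - coefD g y'‖ ≤ 4 * M ^ 3 * φ := by
    refine (CadlagRDE.norm_coefD_sub_le h.right _ _).trans ?_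
    calc _ ≤ 2 * M ^ 2 * (2 * M * φ) := by gcongr
      _ = _ := by ring
  set A := f z - f y - fderiv ℝ f y (f y x₁)
  set A' := g z' - g y' - fderiv ℝ g y' (g y' x₁')
  set c := coefD f z - coefD f y
  set c' := coefD g z' - coefD g y'
  have e1 : (A x₂ + tensApply c a₂) - (A' x₂' + tensApply c' a₂') =
      ((A - A') x₂ + A' (x₂ - x₂')) +
        (tensApply (c - c') a₂ + tensApply c' (a₂ - a₂')) := by
    simp only [_root_.sub_apply, map_sub, tensApply_sub_left, tensApply_sub_right]; abel
  have e2 := (norm_add_le ((A - A') x₂ + A' (x₂ - x₂'))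
    (tensApply (c - c') a₂ + tensApply c' (a₂ - a₂'))).trans
      (add_le_add (norm_add_le ((A - A') x₂) (A' (x₂ - x₂')))
        (norm_add_le (tensApply (c - c') a₂) (tensApply c' (a₂ - a₂'))))
  rw [e1]
  have t1 : ‖(A - A') x₂‖ ≤ (5 * M ^ 2 * e + 47 * D * M ^ 4 * S * φ ^ 2) * φ :=
    (ContinuousLinearMap.le_opNorm _ _).trans
      (mul_le_mul hA hx₂ (norm_nonneg _) (by positivity))
  have t2 : ‖A' (x₂ - x₂')‖ ≤ (5 * M ^ 3 * φ ^ 2) * (S * φ) :=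
    (ContinuousLinearMap.le_opNorm _ _).trans
      (mul_le_mul hA' hdx₂ (norm_nonneg _) (by positivity))
  have t3 : ‖tensApply (c - c') a₂‖ ≤
      D * (2 * M ^ 2 * e + 32 * D * M ^ 4 * S * φ) * φ ^ 2 := by
    refine (norm_tensApply_le _ _).trans ?_
    gcongr
  have t4 : ‖tensApply c' (a₂ - a₂')‖ ≤ D * (4 * M ^ 3 * φ) * (S * φ ^ 2) := by
    refine (norm_tensApply_le _ _).trans ?_
    gcongr
  refine e2.trans ((add_le_add (add_le_add t1 t2) (add_le_add t3 t4)).trans ?_)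
  -- The factor 88 is the sum 47 + 5 + 32 + 4 of the coefficients of `S * φ ^ 3`; the terms with `e`
  -- would need only 5 + 2.
  clear_value A A' c c'
  calc _ = (5 * (1 * M ^ 2) * (e * φ) + 2 * (D * M ^ 2) * (e * φ) * φ) +
        (47 * (D * M ^ 4) + 5 * (1 * M ^ 3) + 32 * (D ^ 2 * M ^ 4) + 4 * (D * M ^ 3)) *
          (S * φ ^ 3) := by ring
    _ ≤ (5 * (D ^ 2 * M ^ 4) * (e * φ) + 2 * (D ^ 2 * M ^ 4) * (e * φ) * 1) +
        (47 * (D ^ 2 * M ^ 4) + 5 * (D ^ 2 * M ^ 4) + 32 * (D ^ 2 * M ^ 4) +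
          4 * (D ^ 2 * M ^ 4)) * (S * φ ^ 3) := by gcongr
    _ ≤ _ := by
      have : 0 ≤ D ^ 2 * M ^ 4 * (e * φ) := by positivity
      nlinarith

end CoefPair

end CadlagRDE

/-! ### Stability of the discrete equation -/

namespace CadlagRDE

variable {d k : ℕ}

/-- Two discrete rough differential equations with close data, solved up to errors. -/
structure DiscretePair (f g : Vec k → Vec d →L[ℝ] Vec k) (M θ α : ℝ) (x x' : ℕ → Vec d)
    (a a' : ℕ → ℕ → Tens d) (y y' : ℕ → Vec k) (ω ε : ℕ → ℕ → ℝ) : Prop where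
  coef : CoefPair f g M θ
  ctrl : IsControl univ ω
  ctrl_err : IsControl univ ε
  left : DiscreteRough x a ω α
  right : DiscreteRough x' a' ω α
  path_sub : ∀ i j, i ≤ j → ‖(x j - x i) - (x' j - x' i)‖ ≤ θ * ω i j ^ α
  area_sub : ∀ i j, i ≤ j → ‖a i j - a' i j‖ ≤ θ * (ω i j ^ α) ^ 2
  rem_left : ∀ i j, i ≤ j → ‖y j - y i - f (y i) (x j - x i)‖ ≤ (ω i j ^ α) ^ 2
  rem_right : ∀ i j, i ≤ j → ‖y' j - y' i - g (y' i) (x' j - x' i)‖ ≤ (ω i j ^ α) ^ 2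
  err_le : ∀ i, ‖err f x a y i (i + 1) - err g x' a' y' i (i + 1)‖ ≤ ε i (i + 1)
  ctrl_err_le : ∀ i j, i ≤ j → ε i j ≤ θ * (ω i j ^ α) ^ 2

namespace DiscretePair

variable {f g : Vec k → Vec d →L[ℝ] Vec k} {M θ α : ℝ} {x x' : ℕ → Vec d}
    {a a' : ℕ → ℕ → Tens d} {y y' : ℕ → Vec k} {ω ε : ℕ → ℕ → ℝ}

theorem rpow_nonneg (h : DiscretePair f g M θ α x x' a a' y y' ω ε) {i j : ℕ} (hij : i ≤ j) :
    0 ≤ ω i j ^ α := Real.rpow_nonneg (h.ctrl.nonneg i trivial j trivial hij) α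

theorem theta_nonneg (h : DiscretePair f g M θ α x x' a a' y y' ω ε) : 0 ≤ θ :=
  h.coef.sub.nonneg

theorem defect_le (h : DiscretePair f g M θ α x x' a a' y y' ω ε) (hα : 0 ≤ α) {S : ℝ}
    (hS : θ ≤ S) {u m v : ℕ} (hum : u ≤ m) (hmv : m ≤ v) (hu : ‖y u - y' u‖ ≤ S)
    (hm : ‖y m - y' m‖ ≤ S) (hφ : ω u v ^ α ≤ 1) :
    ‖(err f x a y u v - err g x' a' y' u v) - (err f x a y u m - err g x' a' y' u m) -
      (err f x a y m v - err g x' a' y' m v)‖ ≤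
      88 * tensConst d ^ 2 * M ^ 4 * S * (ω u v ^ α) ^ 3 +
        88 * tensConst d ^ 2 * M ^ 4 * ω u v ^ α * ‖err f x a y u m - err g x' a' y' u m‖ := by
  have e : (err f x a y u v - err g x' a' y' u v) - (err f x a y u m - err g x' a' y' u m) -
      (err f x a y m v - err g x' a' y' m v) =
      (err f x a y u v - err f x a y u m - err f x a y m v) -
        (err g x' a' y' u v - err g x' a' y' u m - err g x' a' y' m v) := by abel
  rw [e, h.left.err_defect f y hum hmv, h.right.err_defect g y' hum hmv]
  have h1 : ω u m ^ α ≤ ω u v ^ α :=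
    h.ctrl.mono_pow hα trivial trivial trivial trivial le_rfl hum hmv
  have h2 : ω m v ^ α ≤ ω u v ^ α :=
    h.ctrl.mono_pow hα trivial trivial trivial trivial hum hmv le_rfl
  have n1 := h.rpow_nonneg hum
  have n2 := h.rpow_nonneg hmv
  have n3 := h.rpow_nonneg (hum.trans hmv)
  have hS0 : 0 ≤ S := h.theta_nonneg.trans hS
  refine h.coef.norm_defect_sub_le (S := S) (φ := ω u v ^ α) hS hu hm hφ
    ((h.left.path_le u m hum).trans h1) ((h.right.path_le u m hum).trans h1)
    ((h.left.path_le m v hmv).trans h2) ((h.left.area_le u m hum).trans (by gcongr))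
    ((h.left.area_le m v hmv).trans (by gcongr)) ((h.path_sub u m hum).trans (by gcongr))
    ((h.path_sub m v hmv).trans (by gcongr)) ((h.area_sub u m hum).trans (by gcongr))
    ((h.area_sub m v hmv).trans (by gcongr)) ((h.rem_left u m hum).trans (by gcongr))
    ((h.rem_right u m hum).trans (by gcongr))

/-- Sewing applied to the difference of the two errors. On single steps this difference is not zero
but bounded by `ε`, which accounts for the summand 1 in the constant and for the order 2 instead of
3. -/
theorem block_le (h : DiscretePair f g M θ α x x' a a' y y' ω ε) (hα : 0 < α) {κ ρ S : ℝ}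
    (hκ : 2 * ((1 / 2 : ℝ) ^ α) ^ 3 ≤ κ) (hκ1 : κ < 1) (hρ1 : ρ ≤ 1)
    (hρ : 88 * tensConst d ^ 2 * M ^ 4 * ρ ≤ (1 - κ) / 2) (hS : θ ≤ S) {i j : ℕ} (hij : i ≤ j)
    (hφ : ω i j ^ α ≤ ρ) (hV : ∀ u, i ≤ u → u ≤ j → ‖y u - y' u‖ ≤ S) :
    ‖err f x a y i j - err g x' a' y' i j‖ ≤
      (8 * (88 * tensConst d ^ 2 * M ^ 4) / (1 - κ) + 1) * S * (ω i j ^ α) ^ 2 := by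
  have hM := h.coef.one_le
  have hD := one_le_tensConst d
  have hS0 : 0 ≤ S := h.theta_nonneg.trans hS
  have hκ0 : 0 < 1 - κ := by linarith
  have h0 := h.rpow_nonneg hij
  have main := IsControl.sewing_le (J := fun i j => err f x a y i j - err g x' a' y' i j)
    (C := 88 * tensConst d ^ 2 * M ^ 4) (S := S) (ρ := ρ) (κ := κ) (a := i) (b := j)
    h.ctrl h.ctrl_err hα (by positivity) hS0 hκ hκ1 hρ
    (fun u => by simp [h.left.err_self, h.right.err_self]) (fun u _ _ => h.err_le u)
    (fun u m v hu hum hmv hv => h.defect_le hα.le hS hum hmv (hV u hu ((hum.trans hmv).trans hv))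
      (hV m (hu.trans hum) (hmv.trans hv))
      ((h.ctrl.mono_pow hα.le trivial trivial trivial trivial hu (hum.trans hmv) hv).trans
        (hφ.trans hρ1)))
    (fun u v hu huv hv => (h.ctrl_err_le u v huv).trans (by
      have := h.rpow_nonneg huv
      gcongr)) hφ i j le_rfl hij le_rfl
  refine main.trans ?_
  have h2 : ε i j ≤ S * (ω i j ^ α) ^ 2 := (h.ctrl_err_le i j hij).trans (by gcongr)
  have h3 : (ω i j ^ α) ^ 3 ≤ (ω i j ^ α) ^ 2 :=
    pow_le_pow_of_le_one h0 (hφ.trans hρ1) (by norm_num)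
  have h4 : 8 * (88 * tensConst d ^ 2 * M ^ 4) / (1 - κ) * S * (ω i j ^ α) ^ 3 ≤
      8 * (88 * tensConst d ^ 2 * M ^ 4) / (1 - κ) * S * (ω i j ^ α) ^ 2 := by gcongr
  linarith

/-- The increments differ from the errors by the germs, and the remainders differ from the errors by
the area terms. Both are Lipschitz in the data. -/
theorem incr_le_of_err (h : DiscretePair f g M θ α x x' a a' y y' ω ε) {S A : ℝ} (hS : θ ≤ S)
    {i j : ℕ} (hij : i ≤ j) (hφ1 : ω i j ^ α ≤ 1) (hV : ‖y i - y' i‖ ≤ S) (hA : 0 ≤ A)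
    (he : ‖err f x a y i j - err g x' a' y' i j‖ ≤ A * S * (ω i j ^ α) ^ 2) :
    ‖(y j - y i) - (y' j - y' i)‖ ≤ (A + 8 * tensConst d * M ^ 2) * S * ω i j ^ α ∧
    ‖(y j - y i - f (y i) (x j - x i)) - (y' j - y' i - g (y' i) (x' j - x' i))‖ ≤
      (A + 8 * tensConst d * M ^ 2) * S * (ω i j ^ α) ^ 2 := by
  have hM := h.coef.one_le
  have hD := one_le_tensConst d
  have hS0 : 0 ≤ S := h.theta_nonneg.trans hS
  have h0 := h.rpow_nonneg hij
  have hpath : ‖(x j - x i) - (x' j - x' i)‖ ≤ S * ω i j ^ α :=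
    (h.path_sub i j hij).trans (by gcongr)
  have harea : ‖a i j - a' i j‖ ≤ S * (ω i j ^ α) ^ 2 :=
    (h.area_sub i j hij).trans (by gcongr)
  set φ := ω i j ^ α
  have hφ2 : φ ^ 2 ≤ φ := pow_le_of_le_one h0 hφ1 (by norm_num)
  have hMM : M ≤ M ^ 2 := le_self_pow₀ hM (by norm_num)
  constructor
  · have e : (y j - y i) - (y' j - y' i) = (err f x a y i j - err g x' a' y' i j) +
        (germ f (y i) (x j - x i) (a i j) - germ g (y' i) (x' j - x' i) (a' i j)) := by
      simp only [err]; abel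
    rw [e]
    have h2 := h.coef.norm_germ_sub_le hS hV (h.left.path_le i j hij) hpath
      (h.left.area_le i j hij) harea
    refine (norm_add_le _ _).trans ((add_le_add he h2).trans ?_)
    calc _ ≤ A * S * φ + (3 * (tensConst d * M ^ 2) * S * φ +
          5 * tensConst d * M ^ 2 * S * φ) := by
          gcongr
          nlinarith
      _ = _ := by ring
  · have e : (y j - y i - f (y i) (x j - x i)) - (y' j - y' i - g (y' i) (x' j - x' i)) =
        (err f x a y i j - err g x' a' y' i j) +
        (tensApply (coefD f (y i)) (a i j) - tensApply (coefD g (y' i)) (a' i j)) := by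
      simp only [err, germ]; abel
    rw [e]
    have h2 := h.coef.norm_tensApply_sub_le hS hV (h.left.area_le i j hij) harea
    refine (norm_add_le _ _).trans ((add_le_add he h2).trans ?_)
    have : 0 ≤ tensConst d * M ^ 2 * S * φ ^ 2 := by positivity
    linarith

end DiscretePair

/-- A discrete Gronwall argument. Over a block of small control the distance of the two sequences at
most doubles, and over a single step it grows by at most a fixed factor. The number of blocks is
bounded through `Ω`. Once the distance is bounded globally, the local estimates hold with that bound
as `S`, and intervals of large control are treated by dividing by powers of `ρ`. -/
theorem exists_stability (d k : ℕ) {α₀ M Ω : ℝ} (hα₀ : 1 / 3 < α₀) (hM : 1 ≤ M) (hΩ : 1 ≤ Ω) :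
    ∃ B : ℝ, 0 ≤ B ∧ ∀ α, α₀ ≤ α → α ≤ 1 → ∀ (f g : Vec k → Vec d →L[ℝ] Vec k) (θ : ℝ)
      (x x' : ℕ → Vec d) (a a' : ℕ → ℕ → Tens d) (y y' : ℕ → Vec k) (ω ε : ℕ → ℕ → ℝ),
      DiscretePair f g M θ α x x' a a' y y' ω ε → (∀ i j, i ≤ j → ω i j ≤ Ω) →
      ∀ i j, i ≤ j → ‖y j - y' j‖ ≤ B * (‖y 0 - y' 0‖ + θ) ∧
        ‖(y j - y i) - (y' j - y' i)‖ ≤ B * (‖y 0 - y' 0‖ + θ) * ω i j ^ α ∧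
        ‖(y j - y i - f (y i) (x j - x i)) - (y' j - y' i - g (y' i) (x' j - x' i))‖ ≤
          B * (‖y 0 - y' 0‖ + θ) * (ω i j ^ α) ^ 2 := by
  obtain ⟨κ, hκ1, hκ⟩ := exists_sewing_factor hα₀
  have hD := one_le_tensConst d
  have hκ0 : 0 < 1 - κ := by linarith
  set C := 88 * tensConst d ^ 2 * M ^ 4 with hC
  have hC0 : 0 < C := by positivity
  set A := 8 * C / (1 - κ) + 1 with hA
  set A' := A + 8 * tensConst d * M ^ 2 with hA'
  have hA0 : 0 ≤ A := by positivity
  have hA'0 : 0 < A' := by positivity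
  -- The second entry is what sewing requires. The third lets half of the supremum over a block be
  -- absorbed into the left-hand side.
  set ρ := min 1 (min ((1 - κ) / 2 / C) (1 / 2 / A')) with hρdef
  have hρ : 0 < ρ := by positivity
  have hρ1 : ρ ≤ 1 := min_le_left _ _
  have hρC : C * ρ ≤ (1 - κ) / 2 := by
    calc C * ρ ≤ C * ((1 - κ) / 2 / C) := by
          gcongr; exact (min_le_right _ _).trans (min_le_left _ _)
      _ = (1 - κ) / 2 := by field_simp
  have hρA : A' * ρ ≤ 1 / 2 := by
    calc A' * ρ ≤ A' * (1 / 2 / A') := by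
          gcongr; exact (min_le_right _ _).trans (min_le_right _ _)
      _ = 1 / 2 := by field_simp
  set c := 1 + 3 * M * Ω + 5 * tensConst d * M ^ 2 * Ω ^ 2 + Ω ^ 2 with hc
  have hc1 : 1 ≤ c := by
    have : 0 ≤ 3 * M * Ω + 5 * tensConst d * M ^ 2 * Ω ^ 2 + Ω ^ 2 := by positivity
    rw [hc]; linarith
  set N := ⌈Ω / ρ ^ 3⌉₊ with hN
  -- A factor 2 for each of `N + 1` blocks and a factor `c` for each of the `N` steps between them.
  set B₀ := (2 * c) ^ N * 2 with hB₀
  have hB₀1 : 1 ≤ B₀ := by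
    have : 1 ≤ (2 * c) ^ N := one_le_pow₀ (by linarith)
    rw [hB₀]; linarith
  set E := 1 + A' + 2 / ρ + (2 + 3 * M * Ω) / ρ ^ 2 with hE
  have hE2 : 0 ≤ 2 / ρ := by positivity
  have hE3 : 0 ≤ (2 + 3 * M * Ω) / ρ ^ 2 := by positivity
  have hE1 : 1 ≤ E := by rw [hE]; linarith
  refine ⟨E * B₀, by positivity, ?_⟩
  intro α hα hα1 f g θ x x' a a' y y' ω ε h hΩω i j hij
  have hα0 : 0 < α := by linarith
  have hθ := h.theta_nonneg
  have hφΩ : ∀ i j, i ≤ j → ω i j ^ α ≤ Ω := fun i j hij =>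
    rpow_le_of_le (h.ctrl.nonneg i trivial j trivial hij) hΩ hα0.le hα1 (hΩω i j hij)
  have hsmall : ∀ i j, i ≤ j → ω i j ≤ ρ ^ 3 → ω i j ^ α ≤ ρ := fun i j hij hr =>
    rpow_le_of_le_cube (h.ctrl.nonneg i trivial j trivial hij) hρ hρ1 (by linarith) hr
  have hloc : ∀ i j S, i ≤ j → ω i j ^ α ≤ ρ → θ ≤ S →
      (∀ u, i ≤ u → u ≤ j → ‖y u - y' u‖ ≤ S) → _ := fun i j S hij hr hS hV =>
    h.incr_le_of_err hS hij (hr.trans hρ1) (hV i le_rfl hij) hA0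
      (h.block_le hα0 (hκ α hα) hκ1 hρ1 hρC hS hij hr hV)
  have hblock : ∀ i j, i ≤ j → ω i j ≤ ρ ^ 3 →
      ‖y j - y' j‖ + θ ≤ 2 * (‖y i - y' i‖ + θ) := by
    intro i j hij hr
    -- The local estimate is applied at the point `v` where the distance is largest. There the
    -- growth since `i` is at most half of the maximum itself, which can be absorbed.
    obtain ⟨v, hv, hmax⟩ := Finset.exists_max_image (Finset.Icc i j) (fun u => ‖y u - y' u‖)
      ⟨i, by simp [hij]⟩
    set S := ‖y v - y' v‖ + θ with hS
    have hv' := Finset.mem_Icc.1 hv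
    have hSV : ∀ u, i ≤ u → u ≤ j → ‖y u - y' u‖ ≤ S := fun u h1 h2 => by
      have := hmax u (by simp [h1, h2])
      linarith
    have hS0 : 0 ≤ S := by positivity
    have hr' : ω i v ^ α ≤ ρ := (h.ctrl.mono_pow hα0.le trivial trivial trivial trivial le_rfl
      hv'.1 hv'.2).trans (hsmall i j hij hr)
    have h1 := (hloc i v S hv'.1 hr' (by rw [hS]; linarith [norm_nonneg (y v - y' v)])
      (fun u h1 h2 => hSV u h1 (h2.trans hv'.2))).1
    have h2 : A' * S * ω i v ^ α ≤ 1 / 2 * S := by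
      calc A' * S * ω i v ^ α ≤ A' * S * ρ := by gcongr
        _ = (A' * ρ) * S := by ring
        _ ≤ 1 / 2 * S := by gcongr
    have e : y v - y' v = ((y v - y i) - (y' v - y' i)) + (y i - y' i) := by abel
    have h3 := norm_add_le ((y v - y i) - (y' v - y' i)) (y i - y' i)
    rw [← e] at h3
    have h4 := hmax j (by simp [hij])
    linarith
  have hstep : ∀ i, ‖y (i + 1) - y' (i + 1)‖ + θ ≤ c * (‖y i - y' i‖ + θ) := by
    intro i
    set S := ‖y i - y' i‖ + θ with hS
    have hS0 : 0 ≤ S := by positivity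
    have hSθ : θ ≤ S := by rw [hS]; linarith [norm_nonneg (y i - y' i)]
    have hi : i ≤ i + 1 := by omega
    have h0 := h.rpow_nonneg hi
    have e : y (i + 1) - y' (i + 1) = (y i - y' i) +
        (err f x a y i (i + 1) - err g x' a' y' i (i + 1)) +
        (germ f (y i) (x (i + 1) - x i) (a i (i + 1)) -
          germ g (y' i) (x' (i + 1) - x' i) (a' i (i + 1))) := by
      simp only [err]; abel
    have h1 : ‖err f x a y i (i + 1) - err g x' a' y' i (i + 1)‖ ≤ Ω ^ 2 * S := by
      refine (h.err_le i).trans ((h.ctrl_err_le i _ hi).trans ?_)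
      rw [mul_comm]
      gcongr
      exact hφΩ i _ hi
    have h2 := h.coef.norm_germ_sub_le hSθ (by rw [hS]; linarith : ‖y i - y' i‖ ≤ S)
      (h.left.path_le i (i + 1) hi) ((h.path_sub i (i + 1) hi).trans (by gcongr))
      (h.left.area_le i (i + 1) hi) ((h.area_sub i (i + 1) hi).trans (by gcongr))
    have h3 : 3 * M * S * ω i (i + 1) ^ α + 5 * tensConst d * M ^ 2 * S * (ω i (i + 1) ^ α) ^ 2 ≤
        3 * M * S * Ω + 5 * tensConst d * M ^ 2 * S * Ω ^ 2 := by
      gcongr <;> exact hφΩ i _ hi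
    rw [e]
    have h4 := norm_add₃_le (a := y i - y' i)
      (b := err f x a y i (i + 1) - err g x' a' y' i (i + 1))
      (c := germ f (y i) (x (i + 1) - x i) (a i (i + 1)) -
          germ g (y' i) (x' (i + 1) - x' i) (a' i (i + 1)))
    rw [hc]
    linarith
  have hglob : ∀ j, ‖y j - y' j‖ + θ ≤ B₀ * (‖y 0 - y' 0‖ + θ) := by
    intro j
    refine IsControl.block_induction h.ctrl (r := ρ ^ 3) (by positivity)
      (Q := fun N i j => ‖y j - y' j‖ + θ ≤ (2 * c) ^ N * 2 * (‖y i - y' i‖ + θ)) ?_ ?_ N 0 j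
      (Nat.zero_le _) ?_
    · intro N i j hij hr
      refine (hblock i j hij hr).trans ?_
      have h1 : 1 ≤ (2 * c) ^ N := one_le_pow₀ (by linarith)
      have h2 : 0 ≤ 2 * (‖y i - y' i‖ + θ) := by positivity
      nlinarith
    · intro N i b j hib hbj hr hQ
      refine hQ.trans ?_
      calc _ ≤ (2 * c) ^ N * 2 * (c * (2 * (‖y i - y' i‖ + θ))) := by
            gcongr
            exact (hstep b).trans (by gcongr; exact hblock i b hib hr)
        _ = _ := by ring
    · calc ω 0 j ≤ Ω := hΩω 0 j (Nat.zero_le _)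
        _ = Ω / ρ ^ 3 * ρ ^ 3 := by field_simp
        _ ≤ N * ρ ^ 3 := by gcongr; exact Nat.le_ceil _
  set S := B₀ * (‖y 0 - y' 0‖ + θ) with hS
  have hS0 : 0 ≤ S := by positivity
  have hSV : ∀ u, ‖y u - y' u‖ ≤ S := fun u => by linarith [hglob u]
  have hSθ : θ ≤ S := by linarith [hglob 0, norm_nonneg (y 0 - y' 0)]
  have h0 := h.rpow_nonneg hij
  have eS : E * B₀ * (‖y 0 - y' 0‖ + θ) = E * S := by rw [hS]; ring
  rw [eS]
  have hle : ∀ {u v : ℝ}, u ≤ E → 0 ≤ v → u * S * v ≤ E * S * v := fun hu hv => by gcongr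
  refine ⟨(hSV j).trans (by nlinarith), ?_⟩
  rcases le_total (ω i j ^ α) ρ with hr | hr
  · obtain ⟨h1, h2⟩ := hloc i j S hij hr hSθ (fun u _ _ => hSV u)
    exact ⟨h1.trans (hle (by rw [hE]; linarith) h0), h2.trans (hle (by rw [hE]; linarith)
      (by positivity))⟩
  · have h1 : ‖(y j - y i) - (y' j - y' i)‖ ≤ 2 * S := by
      have e : (y j - y i) - (y' j - y' i) = (y j - y' j) - (y i - y' i) := by abel
      rw [e]
      linarith [_root_.norm_sub_le (y j - y' j) (y i - y' i), hSV i, hSV j]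
    constructor
    · refine le_trans ?_ (hle (u := 2 / ρ) (by rw [hE]; linarith) h0)
      calc _ ≤ 2 * S := h1
        _ = 2 / ρ * S * ρ := by field_simp
        _ ≤ _ := by gcongr
    · refine le_trans ?_ (hle (u := (2 + 3 * M * Ω) / ρ ^ 2) (by rw [hE]; linarith)
        (by positivity))
      have e : (y j - y i - f (y i) (x j - x i)) - (y' j - y' i - g (y' i) (x' j - x' i)) =
          ((y j - y i) - (y' j - y' i)) -
            (f (y i) (x j - x i) - g (y' i) (x' j - x' i)) := by abel
      have h2 := h.coef.norm_apply_sub_le hSθ (hSV i)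
        ((h.left.path_le i j hij).trans (hφΩ i j hij))
        ((h.path_sub i j hij).trans (mul_le_mul hSθ (hφΩ i j hij) h0 hS0))
      rw [e]
      calc _ ≤ 2 * S + 3 * M * S * Ω := (_root_.norm_sub_le _ _).trans (add_le_add h1 h2)
        _ = (2 + 3 * M * Ω) / ρ ^ 2 * S * ρ ^ 2 := by field_simp
        _ ≤ _ := by gcongr

end CadlagRDE

/-! ### Partitions of real intervals -/

namespace CadlagRDE

namespace Partition

variable {a b c : ℝ}

theorem pts_mono (π : Partition a b) {i j : ℕ} (hij : i ≤ j) (hj : j ≤ π.n) :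
    π.pts i ≤ π.pts j := by
  induction j, hij using Nat.le_induction with
  | base => exact le_rfl
  | succ j hij ih => exact (ih (by omega)).trans (π.lt_succ j (by omega)).le

theorem pts_mem (π : Partition a b) {i : ℕ} (hi : i ≤ π.n) : π.pts i ∈ Icc a b :=
  ⟨π.first.ge.trans (π.pts_mono (Nat.zero_le i) hi), (π.pts_mono hi le_rfl).trans π.last.le⟩

theorem le (π : Partition a b) : a ≤ b := (π.pts_mem le_rfl).1.trans (π.pts_mem le_rfl).2

/-- The points of a partition, continued by the right endpoint. -/
def time (π : Partition a b) (i : ℕ) : ℝ := π.pts (min i π.n)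

theorem time_monotone (π : Partition a b) : Monotone π.time := fun _ _ h =>
  π.pts_mono (min_le_min_right _ h) (min_le_right _ _)

theorem time_mem (π : Partition a b) (i : ℕ) : π.time i ∈ Icc a b := π.pts_mem (min_le_right _ _)

theorem time_of_le (π : Partition a b) {i : ℕ} (hi : i ≤ π.n) : π.time i = π.pts i := by
  rw [time, min_eq_left hi]

theorem time_of_ge (π : Partition a b) {i : ℕ} (hi : π.n ≤ i) : π.time i = b := by
  rw [time, min_eq_right hi, π.last]

theorem time_zero (π : Partition a b) : π.time 0 = a := by
  rw [time, Nat.zero_min, π.first]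

/-- All intervals of the partition are shorter than `δ`. -/
def MeshLT (π : Partition a b) (δ : ℝ) : Prop := ∀ i < π.n, π.pts (i + 1) - π.pts i < δ

/-- The partition of a degenerate interval. -/
def refl (a : ℝ) : Partition a a := ⟨0, fun _ => a, rfl, rfl, by simp⟩

/-- The partition consisting of one interval. -/
noncomputable def single (h : a < b) : Partition a b where
  n := 1
  pts i := if i = 0 then a else b
  first := by simp
  last := by simp
  lt_succ i hi := by
    have : i = 0 := by omega
    simpa [this] using h

/-- The concatenation of two partitions. -/
noncomputable def append (π : Partition a b) (σ : Partition b c) : Partition a c where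
  n := π.n + σ.n
  pts i := if i ≤ π.n then π.pts i else σ.pts (i - π.n)
  first := by simp [π.first]
  last := by
    by_cases h : σ.n = 0
    · have h1 := σ.first
      have h2 := σ.last
      rw [h] at h2
      simp [h, π.last, ← h1, h2]
    · have : ¬ π.n + σ.n ≤ π.n := by omega
      simp [this, σ.last]
  lt_succ i hi := by
    rcases lt_trichotomy i π.n with h | h | h
    · simp only [h.le, if_true, show i + 1 ≤ π.n from h]
      exact π.lt_succ i h
    · subst h
      have h1 := σ.lt_succ 0 (by omega)
      simp only [le_refl, if_true, show ¬ π.n + 1 ≤ π.n by omega, if_false, π.last,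
        Nat.add_sub_cancel_left]
      rwa [σ.first] at h1
    · simp only [show ¬ i ≤ π.n by omega, show ¬ i + 1 ≤ π.n by omega, if_false,
        show i + 1 - π.n = (i - π.n) + 1 by omega]
      exact σ.lt_succ _ (by omega)

variable (π : Partition a b) (σ : Partition b c)

theorem append_n : (π.append σ).n = π.n + σ.n := rfl

theorem append_pts_left {i : ℕ} (hi : i ≤ π.n) : (π.append σ).pts i = π.pts i := by
  simp [append, hi]

theorem append_pts_right (i : ℕ) : (π.append σ).pts (π.n + i) = σ.pts i := by
  rcases Nat.eq_zero_or_pos i with rfl | h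
  · simp [append, π.last, σ.first]
  · simp [append, show ¬ π.n + i ≤ π.n by omega]

theorem sum_append {E : Type*} [AddCommMonoid E] (J : ℝ → ℝ → E) :
    ∑ i ∈ Finset.range (π.append σ).n, J ((π.append σ).pts i) ((π.append σ).pts (i + 1)) =
      ∑ i ∈ Finset.range π.n, J (π.pts i) (π.pts (i + 1)) +
        ∑ i ∈ Finset.range σ.n, J (σ.pts i) (σ.pts (i + 1)) := by
  rw [append_n, Finset.sum_range_add]
  congr 1
  · refine Finset.sum_congr rfl fun i hi => ?_
    have := Finset.mem_range.1 hi
    rw [append_pts_left _ _ (by omega), append_pts_left _ _ (by omega)]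
  · refine Finset.sum_congr rfl fun i _ => ?_
    rw [append_pts_right, add_assoc, append_pts_right]

variable {π σ} in
theorem MeshLT.append {δ : ℝ} (hπ : π.MeshLT δ) (hσ : σ.MeshLT δ) :
    (π.append σ).MeshLT δ := by
  intro i hi
  rcases lt_or_ge i π.n with h | h
  · rw [append_pts_left _ _ (by omega), append_pts_left _ _ (by omega)]
    exact hπ i h
  · obtain ⟨j, rfl⟩ := Nat.exists_eq_add_of_le h
    rw [append_pts_right, add_assoc, append_pts_right]
    exact hσ j (by rw [append_n] at hi; omega)

theorem sum_single {E : Type*} [AddCommMonoid E] (J : ℝ → ℝ → E) (h : a < b) :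
    ∑ i ∈ Finset.range (single h).n, J ((single h).pts i) ((single h).pts (i + 1)) = J a b := by
  simp [single]

theorem exists_meshLT (hab : a ≤ b) {δ : ℝ} (hδ : 0 < δ) : ∃ π : Partition a b, π.MeshLT δ := by
  rcases hab.eq_or_lt with rfl | hlt
  · exact ⟨refl a, fun i hi => absurd hi (Nat.not_lt_zero i)⟩
  obtain ⟨N, hN⟩ := exists_nat_gt ((b - a) / δ)
  have h0 : 0 < (b - a) / δ := div_pos (sub_pos.2 hlt) hδ
  have hN0 : (0 : ℝ) < N := h0.trans hN
  have hs : 0 < (b - a) / N := div_pos (sub_pos.2 hlt) hN0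
  refine ⟨⟨N, fun i => a + i * ((b - a) / N), by simp, by field_simp; ring, fun i _ => ?_⟩,
    fun i _ => ?_⟩
  · push_cast; nlinarith
  · push_cast
    have : (b - a) / N < δ := by
      rw [div_lt_iff₀ hN0]
      rwa [div_lt_iff₀ hδ, mul_comm] at hN
    nlinarith

theorem exists_subset (F : Finset ℝ) {a b : ℝ} (hab : a ≤ b) (hF : ∀ x ∈ F, x ∈ Icc a b) :
    ∃ π : Partition a b, ∀ x ∈ F, ∃ i, π.time i = x := by
  induction F using Finset.induction_on_max generalizing b with
  | empty =>
    obtain ⟨π, -⟩ := exists_meshLT hab one_pos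
    exact ⟨π, by simp⟩
  | insert x F hx ih =>
    have hxm := hF x (Finset.mem_insert_self x F)
    obtain ⟨π, hπ⟩ := ih hxm.1 fun y hy =>
      ⟨(hF y (Finset.mem_insert_of_mem hy)).1, (hx y hy).le⟩
    rcases hxm.2.eq_or_lt with rfl | hlt
    · refine ⟨π, fun y hy => ?_⟩
      rcases Finset.mem_insert.1 hy with rfl | hy
      · exact ⟨π.n, π.time_of_ge le_rfl⟩
      · exact hπ y hy
    · refine ⟨π.append (single hlt), fun y hy => ?_⟩
      have key : ∀ i ≤ π.n, (π.append (single hlt)).time i = π.time i := fun i hi => by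
        rw [time_of_le _ (by rw [append_n]; omega), time_of_le _ hi, append_pts_left _ _ hi]
      rcases Finset.mem_insert.1 hy with rfl | hy
      · exact ⟨π.n, by rw [key _ le_rfl, π.time_of_ge le_rfl]⟩
      · obtain ⟨i, hi⟩ := hπ y hy
        refine ⟨min i π.n, ?_⟩
        rw [key _ (min_le_right _ _), ← hi, time, time, min_assoc, min_self]

end Partition

theorem IsControl.sum_le {a b : ℝ} {ω : ℝ → ℝ → ℝ} (h : IsControl (Icc a b) ω)
    (π : Partition a b) : ∑ i ∈ Finset.range π.n, ω (π.pts i) (π.pts (i + 1)) ≤ ω a b := by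
  have key : ∀ m ≤ π.n, ∑ i ∈ Finset.range m, ω (π.pts i) (π.pts (i + 1)) ≤ ω a (π.pts m) := by
    intro m
    induction m with
    | zero => intro _; simp [π.first, h.self_eq_zero (⟨le_rfl, π.le⟩ : a ∈ Icc a b)]
    | succ m ih =>
      intro hm
      rw [Finset.sum_range_succ]
      have h1 := h.superadd a ⟨le_rfl, π.le⟩ _ (π.pts_mem (i := m) (by omega)) _
        (π.pts_mem (i := m + 1) hm) (π.pts_mem (i := m) (by omega)).1 (π.lt_succ m (by omega)).le
      linarith [ih (by omega)]
  simpa [π.last] using key π.n le_rfl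

/-- The oscillation of a control over intervals that end shortly before `t` is small. -/
theorem IsControl.exists_left_small {T t η : ℝ} {ω : ℝ → ℝ → ℝ} (h : IsControl (Icc 0 T) ω)
    (ht : t ∈ Icc 0 T) (hη : 0 < η) :
    ∃ δ > 0, ∀ u v, 0 ≤ u → t - δ < u → u ≤ v → v < t → ω u v ≤ η := by
  have hT : 0 ≤ T := ht.1.trans ht.2
  rcases ht.1.eq_or_lt with rfl | ht0
  · exact ⟨1, one_pos, fun u v h1 _ h2 h3 => by linarith⟩
  have h0 : (0 : ℝ) ∈ Icc 0 T := ⟨le_rfl, hT⟩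
  have hTm : T ∈ Icc 0 T := ⟨hT, le_rfl⟩
  set A := (fun s => ω 0 s) '' Ico 0 t with hA
  have hne : A.Nonempty := ⟨ω 0 0, 0, ⟨le_rfl, ht0⟩, rfl⟩
  have hbdd : BddAbove A := by
    refine ⟨ω 0 T, ?_⟩
    rintro _ ⟨s, hs, rfl⟩
    have : s ∈ Icc 0 T := ⟨hs.1, hs.2.le.trans ht.2⟩
    exact h.mono h0 h0 this hTm le_rfl hs.1 this.2
  -- The function `ω 0 ·` is nondecreasing and bounded on `Ico 0 t`. After `s` it is within `η` of
  -- its supremum, and superadditivity bounds `ω u v` by its increment.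
  obtain ⟨_, ⟨s, hs, rfl⟩, hlt⟩ := exists_lt_of_lt_csSup hne (show sSup A - η < sSup A by linarith)
  refine ⟨t - s, by linarith [hs.2], fun u v h1 h2 h3 h4 => ?_⟩
  have hu : u ∈ Icc 0 T := ⟨h1, (h3.trans h4.le).trans ht.2⟩
  have hv : v ∈ Icc 0 T := ⟨h1.trans h3, h4.le.trans ht.2⟩
  have hsT : s ∈ Icc 0 T := ⟨hs.1, hs.2.le.trans ht.2⟩
  have e1 := h.superadd 0 h0 u hu v hv h1 h3
  have e2 : ω 0 v ≤ sSup A := le_csSup hbdd ⟨v, ⟨hv.1, h4⟩, rfl⟩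
  have e3 : ω 0 s ≤ ω 0 u := h.mono h0 h0 hsT hu le_rfl hs.1 (by linarith)
  simp only at hlt
  linarith

/-! ### The power of the variation as a control -/

section Variation

variable {E : Type*} [NormedAddCommGroup E]

/-- The `q`-th power of the `q`-variation over `[s, t]`. -/
noncomputable def vr (q : ℝ) (Ξ : ℝ → ℝ → E) (s t : ℝ) : ℝ :=
  (⨆ π : Partition s t, ∑ i ∈ Finset.range π.n, ‖Ξ (π.pts i) (π.pts (i + 1))‖ₑ ^ q).toReal

variable {q T : ℝ} {Ξ : ℝ → ℝ → E}

theorem vr_nonneg (q : ℝ) (Ξ : ℝ → ℝ → E) (s t : ℝ) : 0 ≤ vr q Ξ s t := ENNReal.toReal_nonneg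

theorem enorm_rpow_eq (hq : 0 ≤ q) (x : E) : ‖x‖ₑ ^ q = ENNReal.ofReal (‖x‖ ^ q) := by
  rw [← ofReal_norm, ENNReal.ofReal_rpow_of_nonneg (norm_nonneg _) hq]

theorem sum_enorm_eq (hq : 0 ≤ q) {s t : ℝ} (π : Partition s t) :
    ∑ i ∈ Finset.range π.n, ‖Ξ (π.pts i) (π.pts (i + 1))‖ₑ ^ q =
      ENNReal.ofReal (∑ i ∈ Finset.range π.n, ‖Ξ (π.pts i) (π.pts (i + 1))‖ ^ q) := by
  rw [ENNReal.ofReal_sum_of_nonneg fun _ _ => Real.rpow_nonneg (norm_nonneg _) _]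
  exact Finset.sum_congr rfl fun i _ => enorm_rpow_eq hq _

theorem iSup_lt_top_of_eVar (hq : 0 < q) {a b : ℝ} (h : eVar q Ξ a b < ∞) :
    ⨆ π : Partition a b, ∑ i ∈ Finset.range π.n, ‖Ξ (π.pts i) (π.pts (i + 1))‖ₑ ^ q < ∞ := by
  rwa [eVar, ENNReal.rpow_lt_top_iff_of_pos (by positivity)] at h

theorem iSup_superadd {s u t : ℝ} (hsu : s ≤ u) (hut : u ≤ t) :
    (⨆ π : Partition s u, ∑ i ∈ Finset.range π.n, ‖Ξ (π.pts i) (π.pts (i + 1))‖ₑ ^ q) +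
      (⨆ π : Partition u t, ∑ i ∈ Finset.range π.n, ‖Ξ (π.pts i) (π.pts (i + 1))‖ₑ ^ q) ≤
      ⨆ π : Partition s t, ∑ i ∈ Finset.range π.n, ‖Ξ (π.pts i) (π.pts (i + 1))‖ₑ ^ q := by
  have : Nonempty (Partition s u) := ⟨(Partition.exists_meshLT hsu one_pos).choose⟩
  have : Nonempty (Partition u t) := ⟨(Partition.exists_meshLT hut one_pos).choose⟩
  refine ENNReal.iSup_add_iSup_le fun π σ => ?_
  rw [← Partition.sum_append π σ (fun u v => ‖Ξ u v‖ₑ ^ q)]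
  exact le_iSup (fun π : Partition s t =>
    ∑ i ∈ Finset.range π.n, ‖Ξ (π.pts i) (π.pts (i + 1))‖ₑ ^ q) (π.append σ)

theorem iSup_lt_top_of_mem (hq : 0 < q) (h : eVar q Ξ 0 T < ∞) {s t : ℝ} (hs : 0 ≤ s)
    (hst : s ≤ t) (ht : t ≤ T) :
    ⨆ π : Partition s t, ∑ i ∈ Finset.range π.n, ‖Ξ (π.pts i) (π.pts (i + 1))‖ₑ ^ q < ∞ := by
  have h1 := iSup_superadd (q := q) (Ξ := Ξ) hs hst
  have h2 := iSup_superadd (q := q) (Ξ := Ξ) (hs.trans hst) ht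
  exact ((le_add_self.trans h1).trans (le_self_add.trans h2)).trans_lt (iSup_lt_top_of_eVar hq h)

theorem isControl_vr (hq : 0 < q) (h : eVar q Ξ 0 T < ∞) : IsControl (Icc 0 T) (vr q Ξ) where
  nonneg _ _ _ _ _ := ENNReal.toReal_nonneg
  superadd s hs u hu t ht hsu hut := by
    rw [vr, vr, ← ENNReal.toReal_add (iSup_lt_top_of_mem hq h hs.1 hsu hu.2).ne
      (iSup_lt_top_of_mem hq h hu.1 hut ht.2).ne]
    exact ENNReal.toReal_mono (iSup_lt_top_of_mem hq h hs.1 (hsu.trans hut) ht.2).ne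
      (iSup_superadd hsu hut)

theorem sum_le_vr (hq : 0 < q) (h : eVar q Ξ 0 T < ∞) {s t : ℝ} (hs : 0 ≤ s) (ht : t ≤ T)
    (π : Partition s t) :
    ∑ i ∈ Finset.range π.n, ‖Ξ (π.pts i) (π.pts (i + 1))‖ ^ q ≤ vr q Ξ s t := by
  rw [vr, ← ENNReal.ofReal_le_iff_le_toReal (iSup_lt_top_of_mem hq h hs π.le ht).ne,
    ← sum_enorm_eq hq.le]
  exact le_iSup (fun π : Partition s t =>
    ∑ i ∈ Finset.range π.n, ‖Ξ (π.pts i) (π.pts (i + 1))‖ₑ ^ q) π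

theorem vr_le (hq : 0 < q) {s t c : ℝ} (hc : 0 ≤ c) (h : ∀ π : Partition s t,
    ∑ i ∈ Finset.range π.n, ‖Ξ (π.pts i) (π.pts (i + 1))‖ ^ q ≤ c) : vr q Ξ s t ≤ c := by
  refine ENNReal.toReal_le_of_le_ofReal hc (iSup_le fun π => ?_)
  rw [sum_enorm_eq hq.le]
  exact ENNReal.ofReal_le_ofReal (h π)

theorem norm_le_vr (hq : 0 < q) (h : eVar q Ξ 0 T < ∞) {s t : ℝ} (hs : 0 ≤ s) (hst : s < t)
    (ht : t ≤ T) : ‖Ξ s t‖ ≤ vr q Ξ s t ^ (1 / q) := by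
  have h1 := sum_le_vr hq h hs ht (Partition.single hst)
  rw [Partition.sum_single (fun u v => ‖Ξ u v‖ ^ q)] at h1
  calc ‖Ξ s t‖ = (‖Ξ s t‖ ^ q) ^ (1 / q) := by
        rw [← Real.rpow_mul (norm_nonneg _), mul_one_div_cancel hq.ne', Real.rpow_one]
    _ ≤ _ := Real.rpow_le_rpow (by positivity) h1 (by positivity)

theorem vr_eq_pVar_rpow (hq : 0 < q) (a b : ℝ) : vr q Ξ a b = pVar q Ξ a b ^ q := by
  rw [pVar, eVar, ← ENNReal.toReal_rpow, ← Real.rpow_mul ENNReal.toReal_nonneg,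
    one_div_mul_cancel hq.ne', Real.rpow_one, vr]

/-- The converse of `norm_le_vr`: taking `q`-th powers makes the bound linear in `ω`, and
superadditivity sums it over any partition. All variation bounds in the conclusions come from
pointwise bounds in this way. -/
theorem eVar_lt_top_and_pVar_le (hq : 0 < q) {ω : ℝ → ℝ → ℝ} (hω : IsControl (Icc 0 T) ω)
    (hT : 0 ≤ T) {c : ℝ} (hc : 0 ≤ c)
    (h : ∀ s t, 0 ≤ s → s < t → t ≤ T → ‖Ξ s t‖ ≤ c * ω s t ^ (1 / q)) :
    eVar q Ξ 0 T < ∞ ∧ pVar q Ξ 0 T ≤ c * ω 0 T ^ (1 / q) := by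
  have hω0 : 0 ≤ ω 0 T := hω.nonneg 0 ⟨le_rfl, hT⟩ T ⟨hT, le_rfl⟩ hT
  have key : eVar q Ξ 0 T ≤ ENNReal.ofReal (c * ω 0 T ^ (1 / q)) := by
    have e : ENNReal.ofReal (c * ω 0 T ^ (1 / q)) =
        ENNReal.ofReal (c ^ q * ω 0 T) ^ (1 / q) := by
      rw [ENNReal.ofReal_rpow_of_nonneg (by positivity) (by positivity),
        Real.mul_rpow (by positivity) hω0, ← Real.rpow_mul hc, mul_one_div_cancel hq.ne',
        Real.rpow_one]
    rw [e, eVar]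
    refine ENNReal.rpow_le_rpow (iSup_le fun π => ?_) (by positivity)
    rw [sum_enorm_eq hq.le]
    refine ENNReal.ofReal_le_ofReal ?_
    calc _ ≤ ∑ i ∈ Finset.range π.n, c ^ q * ω (π.pts i) (π.pts (i + 1)) := by
          refine Finset.sum_le_sum fun i hi => ?_
          have hi' := Finset.mem_range.1 hi
          have h1 := π.pts_mem (i := i) hi'.le
          have h2 := π.pts_mem (i := i + 1) hi'
          have h3 := hω.nonneg _ h1 _ h2 (π.lt_succ i hi').le
          calc _ ≤ (c * ω (π.pts i) (π.pts (i + 1)) ^ (1 / q)) ^ q :=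
                Real.rpow_le_rpow (norm_nonneg _) (h _ _ h1.1 (π.lt_succ i hi') h2.2) hq.le
            _ = _ := by
                rw [Real.mul_rpow hc (by positivity), ← Real.rpow_mul h3,
                  one_div_mul_cancel hq.ne', Real.rpow_one]
      _ = c ^ q * ∑ i ∈ Finset.range π.n, ω (π.pts i) (π.pts (i + 1)) := by
          rw [Finset.mul_sum]
      _ ≤ c ^ q * ω 0 T := by gcongr; exact hω.sum_le π
  exact ⟨key.trans_lt ENNReal.ofReal_lt_top,
    ENNReal.toReal_le_of_le_ofReal (by positivity) key⟩

theorem pVar_nonneg (q : ℝ) (Ξ : ℝ → ℝ → E) (a b : ℝ) : 0 ≤ pVar q Ξ a b :=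
  ENNReal.toReal_nonneg

/-- The variation of a function that is right-continuous in the first variable vanishes on
shrinking intervals with a fixed left endpoint. -/
theorem exists_right_small (hq : 0 < q) (h : eVar q Ξ 0 T < ∞)
    (hc : ∀ t ∈ Icc 0 T, ∀ s ∈ Ico 0 t, ContinuousWithinAt (fun s => Ξ s t) (Ici s) s)
    {t η : ℝ} (ht : t ∈ Icc 0 T) (hη : 0 < η) :
    ∃ δ > 0, ∀ v, t ≤ v → v < t + δ → v ≤ T → vr q Ξ t v ≤ η := by
  have hω := isControl_vr hq h
  rcases ht.2.eq_or_lt with rfl | htT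
  · refine ⟨1, one_pos, fun v h1 _ h2 => ?_⟩
    rw [le_antisymm h2 h1, hω.self_eq_zero ht]
    exact hη.le
  have hTm : T ∈ Icc 0 T := ⟨ht.1.trans ht.2, le_rfl⟩
  by_contra! hcon
  have hall : ∀ v, t < v → v ≤ T → η < vr q Ξ t v := by
    intro v h1 h2
    obtain ⟨v', h3, h4, h5, h6⟩ := hcon (v - t) (by linarith)
    refine h6.trans_le (hω.mono ht ht ⟨ht.1.trans h3, h5⟩ ⟨ht.1.trans h1.le, h2⟩ le_rfl h3 ?_)
    linarith
  -- If the variation over `[t, r]` exceeds `η` for all `r > t`, the variation over `[r, T]` falls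
  -- short of that over `[t, T]` by `η`. Moving the first point of a partition of `[t, T]` to `r`
  -- and letting `r` decrease to `t`, right-continuity gives the same shortfall for the original
  -- sum, which is absurd after taking the supremum.
  have hle : vr q Ξ t T ≤ vr q Ξ t T - η := by
    refine vr_le hq (by linarith [hall T htT le_rfl]) fun π => ?_
    obtain ⟨m, hm⟩ : ∃ m, π.n = m + 1 := by
      refine Nat.exists_eq_succ_of_ne_zero fun h0 => ?_
      have h1 := π.first
      have h2 := π.last
      rw [h0, h1] at h2
      exact htT.ne h2
    have h1 := π.lt_succ 0 (by omega)
    rw [π.first] at h1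
    have h1m := π.pts_mem (i := 1) (by omega)
    have hcont : Tendsto (fun r => (∑ i ∈ Finset.range m,
        ‖Ξ (π.pts (i + 1)) (π.pts (i + 1 + 1))‖ ^ q) + ‖Ξ r (π.pts 1)‖ ^ q) (𝓝[>] t)
        (𝓝 ((∑ i ∈ Finset.range m, ‖Ξ (π.pts (i + 1)) (π.pts (i + 1 + 1))‖ ^ q) +
          ‖Ξ t (π.pts 1)‖ ^ q)) := by
      have hct : Tendsto (fun r => Ξ r (π.pts 1)) (𝓝[>] t) (𝓝 (Ξ t (π.pts 1))) :=
        (hc (π.pts 1) ⟨ht.1.trans h1m.1, h1m.2⟩ t ⟨ht.1, h1⟩).mono_left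
          (nhdsWithin_mono _ Ioi_subset_Ici_self)
      exact tendsto_const_nhds.add (hct.norm.rpow_const (Or.inr hq.le))
    rw [hm, Finset.sum_range_succ', zero_add, π.first]
    refine le_of_tendsto hcont ?_
    filter_upwards [Ioo_mem_nhdsGT h1] with r hr
    have hrm : r ∈ Icc 0 T := ⟨ht.1.trans hr.1.le, hr.2.le.trans h1m.2⟩
    let σ : Partition r T :=
      { n := m + 1
        pts := fun i => if i = 0 then r else π.pts i
        first := by simp
        last := by simpa [hm] using π.last
        lt_succ := fun i hi => by
          rcases Nat.eq_zero_or_pos i with rfl | hi0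
          · simpa using hr.2
          · simpa [hi0.ne'] using π.lt_succ i (by omega) }
    have h2 := sum_le_vr hq h hrm.1 le_rfl σ
    have h3 := hω.superadd t ht r hrm T hTm hr.1.le hrm.2
    have h4 := hall r hr.1 hrm.2
    have e : ∑ i ∈ Finset.range σ.n, ‖Ξ (σ.pts i) (σ.pts (i + 1))‖ ^ q =
        (∑ i ∈ Finset.range m, ‖Ξ (π.pts (i + 1)) (π.pts (i + 1 + 1))‖ ^ q) +
          ‖Ξ r (π.pts 1)‖ ^ q := by
      show ∑ i ∈ Finset.range (m + 1), _ = _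
      rw [Finset.sum_range_succ']
      simp [σ]
    linarith
  linarith

end Variation

end CadlagRDE

/-! ### The Saks–Henstock lemma for mesh integrals -/

namespace CadlagRDE

section Henstock

variable {E : Type*} [NormedAddCommGroup E]

/-- `Y` has increments given by the Riemann sums of `G`, in the sense of mesh convergence. -/
def IsMeshIntegral (T : ℝ) (G : ℝ → ℝ → E) (Y : ℝ → E) : Prop :=
  ∀ t ∈ Icc 0 T, ∀ ε > 0, ∃ δ > 0, ∀ π : Partition 0 t, π.MeshLT δ →
    ‖∑ i ∈ Finset.range π.n, G (π.pts i) (π.pts (i + 1)) - (Y t - Y 0)‖ < ε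

variable {T : ℝ} {G : ℝ → ℝ → E} {Y : ℝ → E}

theorem Partition.MeshLT.mono {a b δ δ' : ℝ} {π : Partition a b} (h : π.MeshLT δ)
    (hδ : δ ≤ δ') : π.MeshLT δ' := fun i hi => (h i hi).trans_le hδ

/-- Convergence is assumed only on intervals starting at 0. Append a fine partition of `[s, t]` to a
fine one of `[0, s]` and subtract the two estimates. -/
theorem IsMeshIntegral.exists_partition (h : IsMeshIntegral T G Y) {s t : ℝ} (hs : 0 ≤ s)
    (hst : s ≤ t) (ht : t ≤ T) {η δ : ℝ} (hη : 0 < η) (hδ : 0 < δ) :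
    ∃ π : Partition s t, π.MeshLT δ ∧
      ‖∑ i ∈ Finset.range π.n, G (π.pts i) (π.pts (i + 1)) - (Y t - Y s)‖ ≤ η := by
  obtain ⟨δ₁, hδ₁, h1⟩ := h s ⟨hs, hst.trans ht⟩ (η / 2) (by linarith)
  obtain ⟨δ₂, hδ₂, h2⟩ := h t ⟨hs.trans hst, ht⟩ (η / 2) (by linarith)
  have hm : 0 < min δ (min δ₁ δ₂) := by positivity
  obtain ⟨π, hπ⟩ := Partition.exists_meshLT hs hm
  obtain ⟨σ, hσ⟩ := Partition.exists_meshLT hst hm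
  refine ⟨σ, hσ.mono (min_le_left _ _), ?_⟩
  have e1 := h1 π (hπ.mono ((min_le_right _ _).trans (min_le_left _ _)))
  have e2 := h2 (π.append σ) ((hπ.append hσ).mono ((min_le_right _ _).trans (min_le_right _ _)))
  rw [Partition.sum_append] at e2
  set A := ∑ i ∈ Finset.range π.n, G (π.pts i) (π.pts (i + 1))
  set B := ∑ i ∈ Finset.range σ.n, G (σ.pts i) (σ.pts (i + 1))
  have e : B - (Y t - Y s) = (A + B - (Y t - Y 0)) - (A - (Y s - Y 0)) := by abel
  rw [e]
  exact (norm_sub_le _ _).trans (by linarith)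

/-- Keep the cells with index in `S`, and replace each other cell by a fine partition whose Riemann
sum is almost exact. The resulting partition is still fine, so its Riemann sum is close to the full
increment; up to an arbitrarily small error, the discrepancy is the sum over `S`. -/
theorem IsMeshIntegral.exists_norm_sum_filter_le (h : IsMeshIntegral T G Y) (hT : 0 ≤ T) {ε : ℝ}
    (hε : 0 < ε) : ∃ δ > 0, ∀ π : Partition 0 T, π.MeshLT δ → ∀ S : Finset ℕ,
      ‖∑ i ∈ Finset.range π.n with i ∈ S,
        (Y (π.pts (i + 1)) - Y (π.pts i) - G (π.pts i) (π.pts (i + 1)))‖ ≤ ε := by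
  obtain ⟨δ, hδ, hI⟩ := h T ⟨hT, le_rfl⟩ ε hε
  refine ⟨δ, hδ, fun π hπ S => ?_⟩
  set e : ℕ → E := fun i => Y (π.pts (i + 1)) - Y (π.pts i) - G (π.pts i) (π.pts (i + 1)) with he
  have key : ∀ η > 0, ∀ j ≤ π.n, ∃ σ : Partition 0 (π.pts j), σ.MeshLT δ ∧
      ‖∑ i ∈ Finset.range σ.n, G (σ.pts i) (σ.pts (i + 1)) - (Y (π.pts j) - Y 0) +
        ∑ i ∈ Finset.range j with i ∈ S, e i‖ ≤ j * η := by
    intro η hη j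
    induction j with
    | zero =>
      intro _
      rw [π.first]
      exact ⟨Partition.refl 0, fun i hi => absurd hi (Nat.not_lt_zero i),
        by simp [Partition.refl]⟩
    | succ j ih =>
      intro hj
      obtain ⟨σ, hσ, hσe⟩ := ih (by omega)
      have hlt := π.lt_succ j (by omega)
      rw [Finset.sum_filter] at hσe
      rw [Finset.sum_filter, Finset.sum_range_succ]
      set A := ∑ i ∈ Finset.range σ.n, G (σ.pts i) (σ.pts (i + 1))
      set B := ∑ i ∈ Finset.range j, if i ∈ S then e i else 0
      by_cases hjS : j ∈ S
      · have hτ : (Partition.single hlt).MeshLT δ := by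
          intro i hi
          have : i = 0 := by
            have : i < 1 := hi
            omega
          subst this
          simpa [Partition.single] using hπ j (by omega)
        refine ⟨σ.append (Partition.single hlt), hσ.append hτ, ?_⟩
        rw [Partition.sum_append, Partition.sum_single, if_pos hjS]
        have e1 : A + G (π.pts j) (π.pts (j + 1)) - (Y (π.pts (j + 1)) - Y 0) + (B + e j) =
            A - (Y (π.pts j) - Y 0) + B := by
          simp only [he]; abel
        rw [e1]
        push_cast
        linarith
      · obtain ⟨τ, hτ, hτe⟩ := h.exists_partition (π.pts_mem (i := j) (by omega)).1 hlt.le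
          (π.pts_mem hj).2 hη hδ
        refine ⟨σ.append τ, hσ.append hτ, ?_⟩
        rw [Partition.sum_append, if_neg hjS, add_zero]
        set C := ∑ i ∈ Finset.range τ.n, G (τ.pts i) (τ.pts (i + 1))
        have e1 : A + C - (Y (π.pts (j + 1)) - Y 0) + B =
            (A - (Y (π.pts j) - Y 0) + B) + (C - (Y (π.pts (j + 1)) - Y (π.pts j))) := by abel
        rw [e1]
        push_cast
        exact (norm_add_le _ _).trans (by linarith)
  refine le_of_forall_pos_le_add fun η hη => ?_
  obtain ⟨σ, hσ, hσe⟩ := key (η / (π.n + 1)) (by positivity) π.n le_rfl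
  -- The partition obtained ends at `π.pts π.n`, which equals `T` only propositionally; hence the
  -- statement for a variable endpoint.
  have e1 : ∀ b, b = T → ∀ σ : Partition 0 b, σ.MeshLT δ →
      ‖∑ i ∈ Finset.range σ.n, G (σ.pts i) (σ.pts (i + 1)) - (Y b - Y 0)‖ < ε := by
    rintro b rfl σ hσ
    exact hI σ hσ
  have e2 := e1 _ π.last σ hσ
  set A := ∑ i ∈ Finset.range σ.n, G (σ.pts i) (σ.pts (i + 1)) - (Y (π.pts π.n) - Y 0)
  set B := ∑ i ∈ Finset.range π.n with i ∈ S, e i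
  have e3 : B = (A + B) - A := by abel
  have e4 : (π.n : ℝ) * (η / (π.n + 1)) ≤ η := by
    rw [← mul_div_assoc, div_le_iff₀ (by positivity)]
    nlinarith
  rw [e3]
  exact (norm_sub_le _ _).trans (by linarith)

end Henstock

/-- The Saks--Henstock lemma. -/
theorem IsMeshIntegral.exists_sum_norm_le {k : ℕ} {T : ℝ} {G : ℝ → ℝ → Vec k} {Y : ℝ → Vec k}
    (h : IsMeshIntegral T G Y) (hT : 0 ≤ T) {ε : ℝ} (hε : 0 < ε) :
    ∃ δ > 0, ∀ π : Partition 0 T, π.MeshLT δ →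
      ∑ i ∈ Finset.range π.n,
        ‖Y (π.pts (i + 1)) - Y (π.pts i) - G (π.pts i) (π.pts (i + 1))‖ ≤ ε := by
  obtain ⟨δ, hδ, hI⟩ := h.exists_norm_sum_filter_le hT
    (show 0 < ε / (2 * (k + 1)) by positivity)
  refine ⟨δ, hδ, fun π hπ => ?_⟩
  have hS := hI π hπ
  set e : ℕ → Vec k := fun i =>
    Y (π.pts (i + 1)) - Y (π.pts i) - G (π.pts i) (π.pts (i + 1)) with he
  set ε' := ε / (2 * (k + 1)) with hε'
  have h1 : ∀ v : Vec k, ‖v‖ ≤ ∑ c, |v c| := fun v => by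
    have hv : v = ∑ c, v c • EuclideanSpace.single c (1 : ℝ) := by
      ext j
      simp [Pi.single_apply]
    calc ‖v‖ = ‖∑ c, v c • EuclideanSpace.single c (1 : ℝ)‖ := by rw [← hv]
      _ ≤ ∑ c, ‖v c • EuclideanSpace.single c (1 : ℝ)‖ := norm_sum_le _ _
      _ = ∑ c, |v c| := by simp [norm_smul]
  have hc : ∀ c : Fin k, ∑ i ∈ Finset.range π.n, |e i c| ≤ 2 * ε' := by
    intro c
    have hcS : ∀ S : Finset ℕ, |∑ i ∈ Finset.range π.n with i ∈ S, e i c| ≤ ε' := fun S => by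
      have h2 := PiLp.norm_apply_le (∑ i ∈ Finset.range π.n with i ∈ S, e i) c
      have h3 : (∑ i ∈ Finset.range π.n with i ∈ S, e i) c =
          ∑ i ∈ Finset.range π.n with i ∈ S, e i c := by simp
      rw [h3, Real.norm_eq_abs] at h2
      exact h2.trans (hS S)
    -- In each coordinate, the cells with nonnegative and with negative error are chosen separately
    -- as `S`, so that sums of absolute values are bounded.
    have hp := hcS ((Finset.range π.n).filter fun i => 0 ≤ e i c)
    have hn := hcS ((Finset.range π.n).filter fun i => ¬ 0 ≤ e i c)
    have es : ∑ i ∈ Finset.range π.n, |e i c| =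
        (∑ i ∈ Finset.range π.n with i ∈ (Finset.range π.n).filter (fun i => 0 ≤ e i c), e i c) -
        ∑ i ∈ Finset.range π.n with i ∈ (Finset.range π.n).filter (fun i => ¬ 0 ≤ e i c),
          e i c := by
      rw [Finset.sum_filter, Finset.sum_filter, ← Finset.sum_sub_distrib]
      refine Finset.sum_congr rfl fun i hi => ?_
      by_cases h0 : 0 ≤ e i c
      · simp only [Finset.mem_filter, hi, h0, not_true, and_true, and_false, if_true, if_false,
          sub_zero, abs_of_nonneg h0]
      · simp only [Finset.mem_filter, hi, h0, not_false_iff, and_true, and_false, if_true,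
          if_false, zero_sub, abs_of_neg (not_le.1 h0)]
    rw [es]
    have := abs_le.1 hp
    have := abs_le.1 hn
    linarith
  calc ∑ i ∈ Finset.range π.n, ‖e i‖ ≤ ∑ i ∈ Finset.range π.n, ∑ c, |e i c| :=
        Finset.sum_le_sum fun i _ => h1 (e i)
    _ = ∑ c, ∑ i ∈ Finset.range π.n, |e i c| := Finset.sum_comm
    _ ≤ ∑ _c : Fin k, 2 * ε' := Finset.sum_le_sum fun c _ => hc c
    _ = k * (2 * ε') := by simp
    _ ≤ ε := by
      rw [hε', ← mul_div_assoc, ← mul_div_assoc, div_le_iff₀ (by positivity)]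
      nlinarith

/-! ### The control of a rough path -/

section RoughPath

variable {d : ℕ} {p T : ℝ}

theorem rpow_one_div_half {x p : ℝ} (hx : 0 ≤ x) : x ^ (1 / (p / 2)) = (x ^ (1 / p)) ^ 2 := by
  rw [← Real.rpow_natCast, ← Real.rpow_mul hx]
  congr 1
  rw [one_div_div, Nat.cast_ofNat]
  ring

theorem rpow_le_cube {v R q : ℝ} (hv : 0 ≤ v) (hvR : v ≤ R) (hR : 1 ≤ R) (hq : 0 ≤ q)
    (hq3 : q ≤ 3) : v ^ q ≤ R ^ 3 := by
  calc v ^ q ≤ R ^ q := Real.rpow_le_rpow hv hvR hq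
    _ ≤ R ^ (3 : ℝ) := Real.rpow_le_rpow_of_exponent_le hR hq3
    _ = R ^ 3 := by norm_cast

theorem vr_le_cube {E : Type*} [NormedAddCommGroup E] {Ξ : ℝ → ℝ → E} {q R a b : ℝ} (hq : 0 < q)
    (hq3 : q ≤ 3) (hR : 1 ≤ R) (h : pVar q Ξ a b ≤ R) : vr q Ξ a b ≤ R ^ 3 := by
  rw [vr_eq_pVar_rpow hq]
  exact rpow_le_cube (pVar_nonneg _ _ _ _) h hR hq.le hq3

namespace RoughPath

variable (X : RoughPath d p T)

theorem area_add {s u t : ℝ} (hs : 0 ≤ s) (hsu : s ≤ u) (hut : u ≤ t) (ht : t ≤ T) :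
    X.area s t = X.area s u + X.area u t + tens (incr X.path s u) (incr X.path u t) := by
  ext ⟨i, j⟩
  simpa [tens] using X.chen s u t hs hsu hut ht i j

theorem area_self {s : ℝ} (hs : s ∈ Icc 0 T) : X.area s s = 0 := by
  have h := X.area_add hs.1 le_rfl le_rfl hs.2
  have h0 : tens (incr X.path s s) (incr X.path s s) = 0 := by ext; simp [tens, incr]
  rw [h0, add_zero] at h
  exact left_eq_add.1 h

/-- The control of a rough path. -/
noncomputable def ctrl (s t : ℝ) : ℝ := vr p (incr X.path) s t + vr (p / 2) X.area s t

variable {X}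

theorem isControl_path (hp : 0 < p) : IsControl (Icc 0 T) (vr p (incr X.path)) :=
  isControl_vr hp X.path_mem.2

theorem isControl_area (hp : 0 < p) : IsControl (Icc 0 T) (vr (p / 2) X.area) :=
  isControl_vr (by positivity) X.area_mem.2.2

theorem isControl (hp : 0 < p) : IsControl (Icc 0 T) X.ctrl :=
  (isControl_path hp).add (isControl_area hp)

theorem norm_path_le (hp : 0 < p) {s t : ℝ} (hs : 0 ≤ s) (hst : s ≤ t) (ht : t ≤ T) :
    ‖incr X.path s t‖ ≤ vr p (incr X.path) s t ^ (1 / p) := by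
  rcases hst.eq_or_lt with rfl | h
  · have h0 : incr X.path s s = 0 := by simp [incr]
    rw [h0, norm_zero]
    exact Real.rpow_nonneg (vr_nonneg _ _ _ _) _
  · exact norm_le_vr hp X.path_mem.2 hs h ht

theorem norm_area_le (hp : 0 < p) {s t : ℝ} (hs : 0 ≤ s) (hst : s ≤ t) (ht : t ≤ T) :
    ‖X.area s t‖ ≤ (vr (p / 2) X.area s t ^ (1 / p)) ^ 2 := by
  rw [← rpow_one_div_half (vr_nonneg _ _ _ _)]
  rcases hst.eq_or_lt with rfl | h
  · rw [X.area_self ⟨hs, ht⟩, norm_zero]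
    exact Real.rpow_nonneg (vr_nonneg _ _ _ _) _
  · exact norm_le_vr (by positivity) X.area_mem.2.2 hs h ht

end RoughPath

end RoughPath

end CadlagRDE

/-! ### Stability of solutions in continuous time -/

namespace CadlagRDE

variable {d k : ℕ} {p T : ℝ}

theorem Partition.exists_through {s t δ : ℝ} (hs : 0 ≤ s) (hst : s ≤ t) (ht : t ≤ T)
    (hδ : 0 < δ) : ∃ π : Partition 0 T, π.MeshLT δ ∧
      ∃ i j, i ≤ j ∧ π.time i = s ∧ π.time j = t := by
  obtain ⟨π, hπ⟩ := exists_meshLT hs hδ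
  obtain ⟨σ, hσ⟩ := exists_meshLT hst hδ
  obtain ⟨τ, hτ⟩ := exists_meshLT ht hδ
  refine ⟨(π.append σ).append τ, (hπ.append hσ).append hτ, π.n, π.n + σ.n, by omega, ?_, ?_⟩
  · rw [time_of_le _ (by simp only [append_n]; omega),
      append_pts_left _ _ (by simp only [append_n]; omega), append_pts_left _ _ le_rfl, π.last]
  · rw [time_of_le _ (by simp only [append_n]; omega),
      append_pts_left _ _ (by simp only [append_n]; omega), append_pts_right, σ.last]

namespace IsSolution

variable {X : RoughPath d p T} {f : Vec k → Vec d →L[ℝ] Vec k} {y₀ : Vec k} {Y : ℝ → Vec k}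
  {Y' : ℝ → Vec d →L[ℝ] Vec k}

/-- The integral over `[0, 0]` is tested with the empty partition, whose Riemann sum is zero. -/
theorem path_zero (h : IsSolution X f y₀ Y Y') (hT : 0 ≤ T) : Y 0 = y₀ := by
  have h1 := h.integral_eq 0 ⟨le_rfl, hT⟩
  rw [← sub_eq_zero, ← norm_le_zero_iff]
  refine le_of_forall_pos_le_add fun ε hε => ?_
  obtain ⟨δ, -, h2⟩ := h1 ε hε
  have h3 := h2 (Partition.refl 0) fun i hi => absurd hi (Nat.not_lt_zero i)
  simp only [Partition.refl, Finset.range_zero, Finset.sum_empty, zero_sub, norm_neg] at h3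
  linarith

theorem isMeshIntegral (h : IsSolution X f y₀ Y Y') (hT : 0 ≤ T) :
    IsMeshIntegral T (fun s t => germ f (Y s) (incr X.path s t) (X.area s t)) Y := by
  intro t ht ε hε
  obtain ⟨δ, hδ, h1⟩ := h.integral_eq t ht ε hε
  refine ⟨δ, hδ, fun π hπ => ?_⟩
  have h2 := h1 π hπ
  rw [h.path_zero hT]
  refine lt_of_eq_of_lt ?_ h2
  congr 2
  refine Finset.sum_congr rfl fun i hi => ?_
  have hm := π.pts_mem (Finset.mem_range.1 hi).le
  simp only [germ, coefD, h.deriv_eq _ ⟨hm.1, hm.2.trans ht.2⟩]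

theorem remainder_eq (h : IsSolution X f y₀ Y Y') {s : ℝ} (hs : s ∈ Icc 0 T) (t : ℝ) :
    remainder X.path Y Y' s t = Y t - Y s - f (Y s) (X.path t - X.path s) := by
  rw [remainder, h.deriv_eq s hs, incr, incr]

theorem norm_remainder_le (h : IsSolution X f y₀ Y Y') (hp : 0 < p) {s t : ℝ} (hs : 0 ≤ s)
    (hst : s ≤ t) (ht : t ≤ T) : ‖Y t - Y s - f (Y s) (X.path t - X.path s)‖ ≤
      (vr (p / 2) (remainder X.path Y Y') s t ^ (1 / p)) ^ 2 := by
  rw [← h.remainder_eq ⟨hs, hst.trans ht⟩, ← rpow_one_div_half (vr_nonneg _ _ _ _)]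
  rcases hst.eq_or_lt with rfl | hlt
  · simpa [remainder, incr] using Real.rpow_nonneg (vr_nonneg _ _ _ _) _
  · exact norm_le_vr (by positivity) h.controlled.rem.2.2 hs hlt ht

end IsSolution

theorem eVar_sub_lt_top {E : Type*} [NormedAddCommGroup E] {q : ℝ} (hq : 0 < q) (hT : 0 ≤ T)
    {Ξ Θ : ℝ → ℝ → E} (h1 : eVar q Ξ 0 T < ∞) (h2 : eVar q Θ 0 T < ∞) :
    eVar q (fun s t => Ξ s t - Θ s t) 0 T < ∞ := by
  refine (eVar_lt_top_and_pVar_le hq ((isControl_vr hq h1).add (isControl_vr hq h2)) hT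
    zero_le_two fun s t hs hst ht => ?_).1
  have n1 := vr_nonneg q Ξ s t
  have n2 := vr_nonneg q Θ s t
  have e1 := (norm_le_vr hq h1 hs hst ht).trans
    (Real.rpow_le_rpow n1 (le_add_of_nonneg_right n2) (by positivity))
  have e2 := (norm_le_vr hq h2 hs hst ht).trans
    (Real.rpow_le_rpow n2 (le_add_of_nonneg_left n1) (by positivity))
  refine (norm_sub_le _ _).trans ((add_le_add e1 e2).trans_eq (by ring))

theorem mul_rpow_scale {θ w q : ℝ} (hθ : 0 < θ) (hw : 0 ≤ w) (hq : 0 < q) :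
    w ^ (1 / q) = θ * ((θ ^ q)⁻¹ * w) ^ (1 / q) := by
  have h1 : θ ^ q * ((θ ^ q)⁻¹ * w) = w := by
    have := (Real.rpow_pos_of_pos hθ q).ne'
    field_simp
  have h2 : 0 ≤ (θ ^ q)⁻¹ * w := by positivity
  conv_lhs => rw [← h1, Real.mul_rpow (by positivity) h2, ← Real.rpow_mul hθ.le,
    mul_one_div_cancel hq.ne', Real.rpow_one]

namespace RoughPath

variable (X W : RoughPath d p T)

theorem eVar_path_sub_lt_top (hp : 0 < p) (hT : 0 ≤ T) :
    eVar p (incr (fun t => X.path t - W.path t)) 0 T < ∞ := by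
  have h := eVar_sub_lt_top hp hT X.path_mem.2 W.path_mem.2
  have e : incr (fun t => X.path t - W.path t) =
      fun s t => incr X.path s t - incr W.path s t := by
    funext s t
    simp only [incr]; abel
  rwa [e]

theorem eVar_area_sub_lt_top (hp : 0 < p) (hT : 0 ≤ T) :
    eVar (p / 2) (fun s t => X.area s t - W.area s t) 0 T < ∞ :=
  eVar_sub_lt_top (by positivity) hT X.area_mem.2.2 W.area_mem.2.2

/-- The control of the distance of two rough paths, normalised by `θ`. -/
noncomputable def distCtrl (θ s t : ℝ) : ℝ :=
  (θ ^ p)⁻¹ * vr p (incr (fun t => X.path t - W.path t)) s t +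
    (θ ^ (p / 2))⁻¹ * vr (p / 2) (fun s t => X.area s t - W.area s t) s t

variable {X W} {θ : ℝ}

theorem isControl_distCtrl (hp : 0 < p) (hT : 0 ≤ T) (hθ : 0 < θ) :
    IsControl (Icc 0 T) (X.distCtrl W θ) :=
  ((isControl_vr hp (eVar_path_sub_lt_top X W hp hT)).const_mul (by positivity)).add
    ((isControl_vr (by positivity) (eVar_area_sub_lt_top X W hp hT)).const_mul (by positivity))

theorem norm_path_sub_le (hp : 0 < p) (hθ : 0 < θ) {s t : ℝ} (hs : 0 ≤ s) (hst : s ≤ t)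
    (ht : t ≤ T) : ‖(X.path t - X.path s) - (W.path t - W.path s)‖ ≤
      θ * X.distCtrl W θ s t ^ (1 / p) := by
  have hT : 0 ≤ T := hs.trans (hst.trans ht)
  have n1 := vr_nonneg p (incr (fun t => X.path t - W.path t)) s t
  have n2 := vr_nonneg (p / 2) (fun s t => X.area s t - W.area s t) s t
  have e : (X.path t - X.path s) - (W.path t - W.path s) =
      incr (fun t => X.path t - W.path t) s t := by simp only [incr]; abel
  have h1 : ‖incr (fun t => X.path t - W.path t) s t‖ ≤
      vr p (incr (fun t => X.path t - W.path t)) s t ^ (1 / p) := by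
    rcases hst.eq_or_lt with rfl | hlt
    · have h0 : incr (fun t => X.path t - W.path t) s s = 0 := by simp [incr]
      rw [h0, norm_zero]
      exact Real.rpow_nonneg n1 _
    · exact norm_le_vr hp (eVar_path_sub_lt_top X W hp hT) hs hlt ht
  rw [e]
  rw [mul_rpow_scale hθ n1 hp] at h1
  refine h1.trans ?_
  gcongr
  exact le_add_of_nonneg_right (by positivity)

theorem norm_area_sub_le (hp : 0 < p) (hθ : 0 < θ) {s t : ℝ} (hs : 0 ≤ s) (hst : s ≤ t)
    (ht : t ≤ T) : ‖X.area s t - W.area s t‖ ≤ θ * (X.distCtrl W θ s t ^ (1 / p)) ^ 2 := by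
  have hT : 0 ≤ T := hs.trans (hst.trans ht)
  have n1 := vr_nonneg p (incr (fun t => X.path t - W.path t)) s t
  have n2 := vr_nonneg (p / 2) (fun s t => X.area s t - W.area s t) s t
  have n3 : 0 ≤ X.distCtrl W θ s t := by unfold distCtrl; positivity
  have h1 : ‖X.area s t - W.area s t‖ ≤
      vr (p / 2) (fun s t => X.area s t - W.area s t) s t ^ (1 / (p / 2)) := by
    rcases hst.eq_or_lt with rfl | hlt
    · rw [X.area_self ⟨hs, ht⟩, W.area_self ⟨hs, ht⟩, sub_zero, norm_zero]
      exact Real.rpow_nonneg n2 _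
    · exact norm_le_vr (by positivity) (eVar_area_sub_lt_top X W hp hT) hs hlt ht
  rw [mul_rpow_scale hθ n2 (by positivity)] at h1
  rw [← rpow_one_div_half n3]
  refine h1.trans ?_
  gcongr
  exact le_add_of_nonneg_left (by positivity)

/-- Each variation is at most `θ`, so each of the two normalised powers is at most 1, whatever `p`
is. -/
theorem distCtrl_le (hp : 0 < p) (hθ : 0 < θ) (h : X.dist W ≤ θ) : X.distCtrl W θ 0 T ≤ 2 := by
  have n1 := pVar_nonneg p (incr (fun t => X.path t - W.path t)) 0 T
  have n2 := pVar_nonneg (p / 2) (fun s t => X.area s t - W.area s t) 0 T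
  have hd : pVar p (incr (fun t => X.path t - W.path t)) 0 T +
    pVar (p / 2) (fun s t => X.area s t - W.area s t) 0 T ≤ θ := h
  have key : ∀ v q : ℝ, 0 ≤ v → 0 < q → v ≤ θ → (θ ^ q)⁻¹ * v ^ q ≤ 1 := fun v q hv hq hvθ => by
    rw [inv_mul_le_one₀ (Real.rpow_pos_of_pos hθ q)]
    exact Real.rpow_le_rpow hv hvθ hq.le
  rw [distCtrl, vr_eq_pVar_rpow hp, vr_eq_pVar_rpow (by positivity)]
  have h1 := key _ p n1 hp (by linarith)
  have h2 := key _ (p / 2) n2 (by positivity) (by linarith)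
  linarith

theorem ctrl_le (X : RoughPath d p T) (hp : 0 < p) (hp3 : p ≤ 3) {R : ℝ} (hR : 1 ≤ R)
    (h : X.norm ≤ R) : X.ctrl 0 T ≤ 2 * R ^ 3 := by
  have n1 := pVar_nonneg p (incr X.path) 0 T
  have n2 := pVar_nonneg (p / 2) X.area 0 T
  have hd : pVar p (incr X.path) 0 T + pVar (p / 2) X.area 0 T ≤ R := h
  have h1 : vr p (incr X.path) 0 T ≤ R ^ 3 := vr_le_cube hp hp3 hR (by linarith)
  have h2 : vr (p / 2) X.area 0 T ≤ R ^ 3 :=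
    vr_le_cube (by positivity) (by linarith) hR (by linarith)
  rw [ctrl]; linarith

theorem discreteRough (X : RoughPath d p T) (hp : 0 < p) (π : Partition 0 T) {ω : ℕ → ℕ → ℝ}
    (hω : ∀ i j, i ≤ j → X.ctrl (π.time i) (π.time j) ≤ ω i j) :
    DiscreteRough (fun i => X.path (π.time i)) (fun i j => X.area (π.time i) (π.time j)) ω
      (1 / p) where
  chen i m j him hmj := X.area_add (π.time_mem i).1 (π.time_monotone him) (π.time_monotone hmj)
    (π.time_mem j).2
  path_le i j hij := by
    refine (norm_path_le hp (π.time_mem i).1 (π.time_monotone hij) (π.time_mem j).2).trans ?_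
    refine Real.rpow_le_rpow (vr_nonneg _ _ _ _) (le_trans ?_ (hω i j hij)) (by positivity)
    exact le_add_of_nonneg_right (vr_nonneg _ _ _ _)
  area_le i j hij := by
    refine (norm_area_le hp (π.time_mem i).1 (π.time_monotone hij) (π.time_mem j).2).trans ?_
    have n := vr_nonneg (p / 2) X.area (π.time i) (π.time j)
    gcongr
    exact le_trans (le_add_of_nonneg_left (vr_nonneg _ _ _ _)) (hω i j hij)

end RoughPath

set_option maxHeartbeats 2000000 in
-- For fixed `s < t`, both solutions are sampled along a partition through `s` and `t` that is so
-- fine that, by Saks–Henstock, their errors on single steps have a negligible sum. The discrete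
-- stability theorem then applies at the two indices of `s` and `t`. The control `ω` does not depend
-- on `s` and `t`, so the pointwise bounds can afterwards be summed to bounds on variations. The
-- variations of the two remainders belong to `ω`, which is where the bounds on the controlled norms
-- are used.
theorem exists_pathwise_stability (d k : ℕ) {p₁ R : ℝ} (hp₁ : p₁ < 3) (hR : 1 ≤ R) :
    ∃ B : ℝ, 1 ≤ B ∧ ∀ p, 2 < p → p ≤ p₁ → ∀ T : ℝ, 0 < T →
      ∀ (f g : Vec k → Vec d →L[ℝ] Vec k) (y₀ z₀ : Vec k) (X W : RoughPath d p T)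
        (Y : ℝ → Vec k) (Y' : ℝ → Vec d →L[ℝ] Vec k)
        (Z : ℝ → Vec k) (Z' : ℝ → Vec d →L[ℝ] Vec k) (θ : ℝ), 0 < θ →
        CoefPair f g R θ → X.norm ≤ R → W.norm ≤ R → X.dist W ≤ θ →
        IsSolution X f y₀ Y Y' → IsSolution W g z₀ Z Z' →
        controlledNorm p T X.path Y Y' ≤ R → controlledNorm p T W.path Z Z' ≤ R →
        ∃ ω : ℝ → ℝ → ℝ, IsControl (Icc 0 T) ω ∧ ω 0 T ≤ 6 * R ^ 3 + 3 ∧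
          ∀ s t, 0 ≤ s → s < t → t ≤ T →
            ‖Y t - Z t‖ ≤ B * (‖y₀ - z₀‖ + θ) ∧
            ‖Y t - Y s‖ ≤ B * ω s t ^ (1 / p) ∧ ‖Z t - Z s‖ ≤ B * ω s t ^ (1 / p) ∧
            ‖(Y t - Y s) - (Z t - Z s)‖ ≤ B * (‖y₀ - z₀‖ + θ) * ω s t ^ (1 / p) ∧
            ‖remainder X.path Y Y' s t - remainder W.path Z Z' s t‖ ≤
              B * (‖y₀ - z₀‖ + θ) * ω s t ^ (1 / (p / 2)) := by
  rcases le_or_gt p₁ 2 with hp₁2 | hp₁2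
  · exact ⟨1, le_rfl, fun p h1 h2 => by linarith⟩
  -- The contributions are `2 * R ^ 3` from each rough path, `R ^ 3` from each remainder, 2 from the
  -- normalised distance and 1 from the time control.
  set Ω := 6 * R ^ 3 + 3 with hΩ
  have hΩ1 : 1 ≤ Ω := by
    have : 0 ≤ R ^ 3 := by positivity
    rw [hΩ]; linarith
  obtain ⟨B, hB0, hB⟩ := exists_stability d k (α₀ := 1 / p₁) (M := R) (Ω := Ω)
    (by rw [div_lt_div_iff₀] <;> linarith) hR hΩ1
  refine ⟨B + Ω + R, by linarith, ?_⟩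
  intro p hp hpp T hT f g y₀ z₀ X W Y Y' Z Z' θ hθ hfg hX hW hXW hY hZ hYR hZR
  have hp0 : 0 < p := by linarith
  have hα : 1 / p₁ ≤ 1 / p := one_div_le_one_div_of_le hp0 hpp
  have hα1 : 1 / p ≤ 1 := by rw [div_le_one hp0]; linarith
  set rY := vr (p / 2) (remainder X.path Y Y') with hrY
  set rZ := vr (p / 2) (remainder W.path Z Z') with hrZ
  have crY : IsControl (Icc 0 T) rY := isControl_vr (by positivity) hY.controlled.rem.2.2
  have crZ : IsControl (Icc 0 T) rZ := isControl_vr (by positivity) hZ.controlled.rem.2.2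
  set ω₀ : ℝ → ℝ → ℝ := fun s t =>
    X.ctrl s t + W.ctrl s t + rY s t + rZ s t + X.distCtrl W θ s t with hω₀
  have cω₀ : IsControl (Icc 0 T) ω₀ :=
    ((((RoughPath.isControl hp0).add (RoughPath.isControl hp0)).add crY).add crZ).add
      (RoughPath.isControl_distCtrl hp0 hT.le hθ)
  have hω₀T : ω₀ 0 T ≤ 6 * R ^ 3 + 2 := by
    have h1 := X.ctrl_le hp0 (by linarith) hR hX
    have h2 := W.ctrl_le hp0 (by linarith) hR hW
    have h3 := RoughPath.distCtrl_le hp0 hθ hXW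
    have h4 : rY 0 T ≤ R ^ 3 := by
      refine vr_le_cube (by positivity) (by linarith) hR ?_
      have n1 := norm_nonneg (Y' 0)
      have n2 := pVar_nonneg p (incr Y') 0 T
      unfold controlledNorm at hYR
      linarith
    have h5 : rZ 0 T ≤ R ^ 3 := by
      refine vr_le_cube (by positivity) (by linarith) hR ?_
      have n1 := norm_nonneg (Z' 0)
      have n2 := pVar_nonneg p (incr Z') 0 T
      unfold controlledNorm at hZR
      linarith
    simp only [hω₀]
    linarith
  have cT : IsControl (Icc 0 T) (fun s t => T⁻¹ * (t - s)) :=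
    (IsControl.of_monotone (F := fun t : ℝ => t) _ monotone_id).const_mul (by positivity)
  have hT0 : (0 : ℝ) ∈ Icc 0 T := ⟨le_rfl, hT.le⟩
  have hTT : T ∈ Icc 0 T := ⟨hT.le, le_rfl⟩
  -- The time term is positive on every nondegenerate interval and leaves room for the
  -- discretisation error.
  set ω : ℝ → ℝ → ℝ := fun s t => ω₀ s t + T⁻¹ * (t - s) with hω
  have cω : IsControl (Icc 0 T) ω := cω₀.add cT
  have hωT : ω 0 T ≤ Ω := by
    have : T⁻¹ * (T - 0) = 1 := by rw [sub_zero, inv_mul_cancel₀ hT.ne']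
    simp only [hω]
    linarith
  refine ⟨ω, cω, hωT, ?_⟩
  intro s t hs hst ht
  have hsm : s ∈ Icc 0 T := ⟨hs, hst.le.trans ht⟩
  have htm : t ∈ Icc 0 T := ⟨hs.trans hst.le, ht⟩
  have hω0 : 0 ≤ ω s t := cω.nonneg s hsm t htm hst.le
  set φ := ω s t ^ (1 / p) with hφ
  have hφ0 : 0 ≤ φ := Real.rpow_nonneg hω0 _
  have hφΩ : φ ≤ Ω := rpow_le_of_le hω0 hΩ1 (by positivity) hα1
    ((cω.mono hT0 hsm htm hTT hs hst.le ht).trans hωT)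
  set S := ‖y₀ - z₀‖ + θ with hS
  have hS0 : 0 ≤ S := by positivity
  have hincr : ∀ s t, 0 ≤ s → s ≤ t → t ≤ T → vr (p / 2) (remainder X.path Y Y') s t ≤ ω s t ∧
      vr (p / 2) (remainder W.path Z Z') s t ≤ ω s t ∧ X.ctrl s t ≤ ω s t ∧
      W.ctrl s t ≤ ω s t := by
    intro s t hs hst ht
    have hsm : s ∈ Icc 0 T := ⟨hs, hst.trans ht⟩
    have htm : t ∈ Icc 0 T := ⟨hs.trans hst, ht⟩
    have n1 := (RoughPath.isControl (X := X) hp0).nonneg s hsm t htm hst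
    have n2 := (RoughPath.isControl (X := W) hp0).nonneg s hsm t htm hst
    have n3 := crY.nonneg s hsm t htm hst
    have n4 := crZ.nonneg s hsm t htm hst
    have n5 := (RoughPath.isControl_distCtrl (X := X) (W := W) hp0 hT.le hθ).nonneg s hsm t htm hst
    have n6 := cT.nonneg s hsm t htm hst
    simp only [hω, hω₀]
    refine ⟨?_, ?_, ?_, ?_⟩ <;> linarith
  obtain ⟨i1, i2, i3, i4⟩ := hincr s t hs hst.le ht
  have hYst : ‖Y t - Y s‖ ≤ (Ω + R) * φ := by
    have h1 := hY.norm_remainder_le hp0 hs hst.le ht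
    have h2 : vr (p / 2) (remainder X.path Y Y') s t ^ (1 / p) ≤ φ :=
      Real.rpow_le_rpow (vr_nonneg _ _ _ _) i1 (by positivity)
    have h3 : ‖X.path t - X.path s‖ ≤ φ := (RoughPath.norm_path_le hp0 hs hst.le ht).trans
      (Real.rpow_le_rpow (vr_nonneg _ _ _ _)
        ((le_add_of_nonneg_right (vr_nonneg _ _ _ _)).trans i3) (by positivity))
    have h4 := norm_apply_le_of_le hfg.left (Y s) h3
    have h5 := norm_add_le (Y t - Y s - f (Y s) (X.path t - X.path s))
      (f (Y s) (X.path t - X.path s))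
    rw [sub_add_cancel] at h5
    have h6 := Real.rpow_nonneg (vr_nonneg (p / 2) (remainder X.path Y Y') s t) (1 / p)
    nlinarith
  have hZst : ‖Z t - Z s‖ ≤ (Ω + R) * φ := by
    have h1 := hZ.norm_remainder_le hp0 hs hst.le ht
    have h2 : vr (p / 2) (remainder W.path Z Z') s t ^ (1 / p) ≤ φ :=
      Real.rpow_le_rpow (vr_nonneg _ _ _ _) i2 (by positivity)
    have h3 : ‖W.path t - W.path s‖ ≤ φ := (RoughPath.norm_path_le hp0 hs hst.le ht).trans
      (Real.rpow_le_rpow (vr_nonneg _ _ _ _)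
        ((le_add_of_nonneg_right (vr_nonneg _ _ _ _)).trans i4) (by positivity))
    have h4 := norm_apply_le_of_le hfg.right (Z s) h3
    have h5 := norm_add_le (Z t - Z s - g (Z s) (W.path t - W.path s))
      (g (Z s) (W.path t - W.path s))
    rw [sub_add_cancel] at h5
    have h6 := Real.rpow_nonneg (vr_nonneg (p / 2) (remainder W.path Z Z') s t) (1 / p)
    nlinarith
  -- The total error allowed is `θ * τ`: divided by `θ` and raised to the power `p / 2`, it becomes
  -- exactly the time term of `ω s t`.
  set τ := (T⁻¹ * (t - s)) ^ (1 / (p / 2)) with hτ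
  have hts : 0 < T⁻¹ * (t - s) := by
    have : 0 < t - s := by linarith
    positivity
  have hτ0 : 0 < τ := Real.rpow_pos_of_pos hts _
  have hτp : τ ^ (p / 2) = T⁻¹ * (t - s) := by
    rw [hτ, ← Real.rpow_mul hts.le, one_div_mul_cancel (by positivity), Real.rpow_one]
  obtain ⟨δ₁, hδ₁, hSY⟩ := (hY.isMeshIntegral hT.le).exists_sum_norm_le hT.le
    (show 0 < θ * τ / 2 by positivity)
  obtain ⟨δ₂, hδ₂, hSZ⟩ := (hZ.isMeshIntegral hT.le).exists_sum_norm_le hT.le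
    (show 0 < θ * τ / 2 by positivity)
  obtain ⟨π, hπ, i, j, hij, hi, hj⟩ := Partition.exists_through hs hst.le ht
    (show 0 < min δ₁ δ₂ by positivity)
  have hSY := hSY π (hπ.mono (min_le_left _ _))
  have hSZ := hSZ π (hπ.mono (min_le_right _ _))
  set x := fun i => X.path (π.time i) with hx
  set w := fun i => W.path (π.time i) with hw
  set a := fun i j => X.area (π.time i) (π.time j) with ha
  set b := fun i j => W.area (π.time i) (π.time j) with hb
  set y := fun i => Y (π.time i) with hy
  set z := fun i => Z (π.time i) with hz
  set e := fun i => ‖err f x a y i (i + 1) - err g w b z i (i + 1)‖ with he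
  set F := fun j => ∑ l ∈ Finset.range j, e l with hF
  have he0 : ∀ l, 0 ≤ e l := fun l => norm_nonneg _
  have hFm : Monotone F := monotone_nat_of_le_succ fun l => by
    simp only [hF, Finset.sum_range_succ]
    exact le_add_of_nonneg_right (he0 l)
  have heπ : ∀ l, π.n ≤ l → e l = 0 := by
    intro l hl
    simp only [he, err, hx, hw, ha, hb, hy, hz, π.time_of_ge hl, π.time_of_ge (hl.trans l.le_succ)]
    simp [germ, X.area_self hTT, W.area_self hTT, tensApply]
  have hFn : F π.n ≤ θ * τ := by
    have h1 : F π.n ≤ ∑ i ∈ Finset.range π.n, ‖Y (π.pts (i + 1)) - Y (π.pts i) -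
          germ f (Y (π.pts i)) (incr X.path (π.pts i) (π.pts (i + 1)))
            (X.area (π.pts i) (π.pts (i + 1)))‖ +
        ∑ i ∈ Finset.range π.n, ‖Z (π.pts (i + 1)) - Z (π.pts i) -
          germ g (Z (π.pts i)) (incr W.path (π.pts i) (π.pts (i + 1)))
            (W.area (π.pts i) (π.pts (i + 1)))‖ := by
      rw [← Finset.sum_add_distrib]
      refine Finset.sum_le_sum fun l hl => ?_
      have hl' := Finset.mem_range.1 hl
      simp only [he, err, hx, hw, ha, hb, hy, hz, π.time_of_le hl'.le,
        π.time_of_le (show l + 1 ≤ π.n from hl')]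
      exact norm_sub_le _ _
    linarith
  have hFle : ∀ l, F l ≤ θ * τ := by
    intro l
    rcases le_total l π.n with h | h
    · exact (hFm h).trans hFn
    · obtain ⟨m, rfl⟩ := Nat.exists_eq_add_of_le h
      refine le_trans (le_of_eq ?_) hFn
      simp only [hF, Finset.sum_range_add]
      rw [Finset.sum_eq_zero fun i _ => heπ (π.n + i) (by omega), add_zero]
  have hF0 : ∀ l, 0 ≤ F l := fun l => Finset.sum_nonneg fun i _ => he0 i
  set ε : ℕ → ℕ → ℝ := fun u v => F v - F u with hε
  have cε : IsControl univ ε := IsControl.of_monotone _ hFm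
  -- The power `p / 2 ≥ 1` of the rescaled error control is again superadditive, and adding it gives
  -- `ε ≤ θ σ^{2/p}`, as the discrete theorem requires.
  set σ : ℕ → ℕ → ℝ := fun u v => ω₀ (π.time u) (π.time v) + (θ⁻¹ * ε u v) ^ (p / 2) with hσ
  have cσ : IsControl univ σ := (cω₀.comp π.time_monotone π.time_mem).add
    ((cε.const_mul (by positivity)).rpow (by linarith))
  have hεle : ∀ u v, u ≤ v → (θ⁻¹ * ε u v) ^ (p / 2) ≤ T⁻¹ * (t - s) := by
    intro u v huv
    rw [← hτp]
    have h1 := cε.nonneg u trivial v trivial huv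
    refine Real.rpow_le_rpow (by positivity) ?_ (by positivity)
    rw [inv_mul_le_iff₀ hθ]
    have := hFle v
    have := hF0 u
    simp only [hε]
    linarith
  have hσΩ : ∀ u v, u ≤ v → σ u v ≤ Ω := by
    intro u v huv
    have h1 := hεle u v huv
    have h2 := cω₀.mono hT0 (π.time_mem u) (π.time_mem v) hTT (π.time_mem u).1
      (π.time_monotone huv) (π.time_mem v).2
    have h3 : T⁻¹ * (t - s) ≤ 1 := by
      rw [inv_mul_le_one₀ hT]; linarith
    simp only [hσ]
    linarith
  have hσst : σ i j ≤ ω s t := by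
    have h1 := hεle i j hij
    simp only [hσ, hω, hi, hj]
    linarith
  have hσn : ∀ u v, u ≤ v → 0 ≤ (θ⁻¹ * ε u v) ^ (p / 2) := fun u v huv => by
    have := cε.nonneg u trivial v trivial huv
    positivity
  have hparts : ∀ u v, u ≤ v → X.ctrl (π.time u) (π.time v) ≤ σ u v ∧
      W.ctrl (π.time u) (π.time v) ≤ σ u v ∧ rY (π.time u) (π.time v) ≤ σ u v ∧
      rZ (π.time u) (π.time v) ≤ σ u v ∧ X.distCtrl W θ (π.time u) (π.time v) ≤ σ u v := by
    intro u v huv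
    have hum := π.time_mem u
    have hvm := π.time_mem v
    have hle := π.time_monotone huv
    have n1 := (RoughPath.isControl (X := X) hp0).nonneg _ hum _ hvm hle
    have n2 := (RoughPath.isControl (X := W) hp0).nonneg _ hum _ hvm hle
    have n3 := crY.nonneg _ hum _ hvm hle
    have n4 := crZ.nonneg _ hum _ hvm hle
    have n5 := (RoughPath.isControl_distCtrl (X := X) (W := W) hp0 hT.le hθ).nonneg _ hum _ hvm hle
    have n6 := hσn u v huv
    simp only [hσ, hω₀]
    refine ⟨?_, ?_, ?_, ?_, ?_⟩ <;> linarith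
  have hpair : DiscretePair f g R θ (1 / p) x w a b y z σ ε :=
    { coef := hfg
      ctrl := cσ
      ctrl_err := cε
      left := X.discreteRough hp0 π fun u v huv => (hparts u v huv).1
      right := W.discreteRough hp0 π fun u v huv => (hparts u v huv).2.1
      path_sub := fun u v huv => by
        refine (RoughPath.norm_path_sub_le hp0 hθ (π.time_mem u).1 (π.time_monotone huv)
          (π.time_mem v).2).trans ?_
        have := (RoughPath.isControl_distCtrl (X := X) (W := W) hp0 hT.le hθ).nonneg _
          (π.time_mem u) _ (π.time_mem v) (π.time_monotone huv)
        gcongr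
        exact (hparts u v huv).2.2.2.2
      area_sub := fun u v huv => by
        refine (RoughPath.norm_area_sub_le hp0 hθ (π.time_mem u).1 (π.time_monotone huv)
          (π.time_mem v).2).trans ?_
        have := (RoughPath.isControl_distCtrl (X := X) (W := W) hp0 hT.le hθ).nonneg _
          (π.time_mem u) _ (π.time_mem v) (π.time_monotone huv)
        gcongr
        exact (hparts u v huv).2.2.2.2
      rem_left := fun u v huv => by
        refine (hY.norm_remainder_le hp0 (π.time_mem u).1 (π.time_monotone huv)
          (π.time_mem v).2).trans ?_
        have := vr_nonneg (p / 2) (remainder X.path Y Y') (π.time u) (π.time v)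
        gcongr
        exact (hparts u v huv).2.2.1
      rem_right := fun u v huv => by
        refine (hZ.norm_remainder_le hp0 (π.time_mem u).1 (π.time_monotone huv)
          (π.time_mem v).2).trans ?_
        have := vr_nonneg (p / 2) (remainder W.path Z Z') (π.time u) (π.time v)
        gcongr
        exact (hparts u v huv).2.2.2.1
      err_le := fun u => by
        simp only [hε, hF, Finset.sum_range_succ, add_sub_cancel_left]
        exact le_rfl
      ctrl_err_le := fun u v huv => by
        have h0 := cε.nonneg u trivial v trivial huv
        have h1 : 0 ≤ θ⁻¹ * ε u v := by positivity
        have h2 : θ⁻¹ * ε u v ≤ (σ u v ^ (1 / p)) ^ 2 := by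
          rw [← rpow_one_div_half (cσ.nonneg u trivial v trivial huv)]
          calc θ⁻¹ * ε u v = ((θ⁻¹ * ε u v) ^ (p / 2)) ^ (1 / (p / 2)) := by
                rw [← Real.rpow_mul h1, mul_one_div_cancel (by positivity), Real.rpow_one]
            _ ≤ _ := by
                have := hσn u v huv
                gcongr
                have := cω₀.nonneg _ (π.time_mem u) _ (π.time_mem v) (π.time_monotone huv)
                simp only [hσ]
                linarith
        rwa [inv_mul_le_iff₀ hθ] at h2 }
  have hσφ : σ i j ^ (1 / p) ≤ φ :=
    Real.rpow_le_rpow (cσ.nonneg i trivial j trivial hij) hσst (by positivity)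
  have hσ0 : 0 ≤ σ i j ^ (1 / p) := Real.rpow_nonneg (cσ.nonneg i trivial j trivial hij) _
  obtain ⟨c1, c2, c3⟩ := hB (1 / p) hα hα1 f g θ x w a b y z σ ε hpair hσΩ i j hij
  have hy0 : y 0 = y₀ := by simp only [hy, π.time_zero, hY.path_zero hT.le]
  have hz0 : z 0 = z₀ := by simp only [hz, π.time_zero, hZ.path_zero hT.le]
  rw [hy0, hz0, ← hS] at c1 c2 c3
  simp only [hy, hz, hx, hw, hi, hj] at c1 c2 c3
  have hBB : B ≤ B + Ω + R := by linarith
  refine ⟨c1.trans (by gcongr), hYst.trans (by gcongr; linarith), hZst.trans (by gcongr; linarith),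
    c2.trans (by gcongr), ?_⟩
  rw [hY.remainder_eq hsm, hZ.remainder_eq hsm, rpow_one_div_half hω0]
  exact c3.trans (by gcongr)

end CadlagRDE

/-! ### Càdlàg paths and controls with jumps -/

namespace CadlagRDE

section Cadlag

variable {E F : Type*} [NormedAddCommGroup E] [NormedAddCommGroup F] {a b : ℝ}

theorem IsCadlagOn.mono {X : ℝ → E} (h : IsCadlagOn X a b) {a' b' : ℝ} (ha : a ≤ a')
    (hb : b' ≤ b) : IsCadlagOn X a' b' :=
  ⟨fun t ht => h.1 t ⟨ha.trans ht.1, ht.2.trans_le hb⟩,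
    fun t ht => h.2 t ⟨ha.trans_lt ht.1, ht.2.trans hb⟩⟩

theorem IsCadlagOn.comp {X : ℝ → E} (h : IsCadlagOn X a b) {φ : E → F} (hφ : Continuous φ) :
    IsCadlagOn (fun t => φ (X t)) a b :=
  ⟨fun t ht => hφ.continuousAt.comp_continuousWithinAt (h.1 t ht), fun t ht => by
    obtain ⟨l, hl⟩ := h.2 t ht
    exact ⟨φ l, (hφ.tendsto l).comp hl⟩⟩

theorem IsCadlagOn.comp₂ {G : Type*} [NormedAddCommGroup G] {X : ℝ → E} {Y : ℝ → F}
    (hX : IsCadlagOn X a b) (hY : IsCadlagOn Y a b) {φ : E × F → G} (hφ : Continuous φ) :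
    IsCadlagOn (fun t => φ (X t, Y t)) a b :=
  ⟨fun t ht => hφ.continuousAt.comp_continuousWithinAt ((hX.1 t ht).prodMk (hY.1 t ht)),
    fun t ht => by
      obtain ⟨l, hl⟩ := hX.2 t ht
      obtain ⟨m, hm⟩ := hY.2 t ht
      exact ⟨φ (l, m), (hφ.tendsto (l, m)).comp (hl.prodMk_nhds hm)⟩⟩

end Cadlag

/-- A control that is small on short intervals away from finitely many endpoints. -/
def LocallySmall (T : ℝ) (ω : ℝ → ℝ → ℝ) : Prop :=
  ∀ t ∈ Icc 0 T, ∀ η > 0, ∃ δ > 0,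
    (∀ u v, 0 ≤ u → t - δ < u → u ≤ v → v < t → ω u v ≤ η) ∧
      ∀ v, t ≤ v → v < t + δ → v ≤ T → ω t v ≤ η

/-- To the left of `t`, smallness holds for every control. To the right, it comes from the
right-continuity of the path and, in its first variable, of the area. -/
theorem RoughPath.locallySmall {d : ℕ} {p T : ℝ} (X : RoughPath d p T) (hp : 0 < p) :
    LocallySmall T X.ctrl := by
  intro t ht η hη
  obtain ⟨δ₁, h₁, H₁⟩ := (RoughPath.isControl (X := X) hp).exists_left_small ht hη
  obtain ⟨δ₂, h₂, H₂⟩ := exists_right_small hp X.path_mem.2 (fun v hv s hs =>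
    continuousWithinAt_const.sub (X.path_mem.1.1 s ⟨hs.1, hs.2.trans_le hv.2⟩)) ht (half_pos hη)
  obtain ⟨δ₃, h₃, H₃⟩ := exists_right_small (half_pos hp) X.area_mem.2.2 (fun v hv s hs =>
    (X.area_mem.1 v hv).1 s hs) ht (half_pos hη)
  refine ⟨min δ₁ (min δ₂ δ₃), by positivity, fun u v hu htu huv hvt => H₁ u v hu ?_ huv hvt,
    fun v htv hvt hvT => ?_⟩
  · linarith [min_le_left δ₁ (min δ₂ δ₃)]
  · have e1 := min_le_right δ₁ (min δ₂ δ₃)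
    have e2 := min_le_left δ₂ δ₃
    have e3 := min_le_right δ₂ δ₃
    have := H₂ v htv (by linarith) hvT
    have := H₃ v htv (by linarith) hvT
    rw [RoughPath.ctrl]
    linarith

/-- Where `ω ≤ η`, the bound `B ω^{3α}` is at most `B η^{3α-1} ω`, and superadditivity makes the sum
small. By compactness, every short cell either has `ω ≤ η` or straddles one of finitely many times.
At most one cell straddles each of these, and `hb` makes its contribution small. -/
theorem sum_norm_le_of_locallySmall {E : Type*} [NormedAddCommGroup E] {T α B ρ : ℝ}
    {ω : ℝ → ℝ → ℝ} (hω : IsControl (Icc 0 T) ω) (hs : LocallySmall T ω) {J : ℝ → ℝ → E}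
    (hα : 1 / 3 < α) (hB : 0 ≤ B) (hρ : 0 < ρ)
    (ha : ∀ u v, 0 ≤ u → u < v → v ≤ T → ω u v ≤ ρ → ‖J u v‖ ≤ B * (ω u v ^ α) ^ 3)
    (hb : ∀ t, 0 < t → t ≤ T → ∀ ε > 0, ∃ δ > 0, ∀ u v, 0 ≤ u → u < t → t ≤ v → v ≤ T →
      v - u < δ → ‖J u v‖ ≤ ε)
    {t₀ ε : ℝ} (ht₀ : t₀ ∈ Icc 0 T) (hε : 0 < ε) :
    ∃ δ > 0, ∀ π : Partition 0 t₀, π.MeshLT δ →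
      ∑ i ∈ Finset.range π.n, ‖J (π.pts i) (π.pts (i + 1))‖ ≤ ε := by
  have hT : 0 ≤ T := ht₀.1.trans ht₀.2
  set Ω := ω 0 T with hΩ
  have hΩ0 : 0 ≤ Ω := hω.nonneg 0 ⟨le_rfl, hT⟩ T ⟨hT, le_rfl⟩ hT
  set γ := 3 * α - 1 with hγ
  have hγ0 : 0 < γ := by linarith
  set c := ε / (2 * (B * Ω + 1)) with hc
  have hc0 : 0 < c := by positivity
  -- Chosen so that `B * η ^ γ * Ω ≤ ε / 2`; the other half of `ε` is divided among the times in the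
  -- finite set `Q`.
  set η := min ρ (c ^ (1 / γ)) with hη
  have hη0 : 0 < η := lt_min hρ (Real.rpow_pos_of_pos hc0 _)
  have hηγ : B * η ^ γ * Ω ≤ ε / 2 := by
    have h1 : η ^ γ ≤ c := by
      calc η ^ γ ≤ (c ^ (1 / γ)) ^ γ := Real.rpow_le_rpow hη0.le (min_le_right _ _) hγ0.le
        _ = c := by rw [← Real.rpow_mul hc0.le, one_div_mul_cancel hγ0.ne', Real.rpow_one]
    calc B * η ^ γ * Ω ≤ B * c * Ω := by gcongr
      _ = (B * Ω) * c := by ring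
      _ ≤ (B * Ω + 1) * c := by gcongr; linarith
      _ = ε / 2 := by rw [hc]; field_simp
  have hgood : ∀ u v, 0 ≤ u → u < v → v ≤ T → ω u v ≤ η →
      ‖J u v‖ ≤ B * η ^ γ * ω u v := by
    intro u v hu huv hv hle
    have h0 := hω.nonneg u ⟨hu, huv.le.trans hv⟩ v ⟨hu.trans huv.le, hv⟩ huv.le
    have h1 : (ω u v ^ α) ^ 3 = ω u v ^ γ * ω u v := by
      rw [← Real.rpow_natCast, ← Real.rpow_mul h0, ← Real.rpow_add_one' h0]
      · congr 1; rw [hγ]; push_cast; ring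
      · rw [hγ]; linarith
    refine (ha u v hu huv hv (hle.trans (min_le_left _ _))).trans ?_
    rw [h1, mul_assoc]
    have : ω u v ^ γ ≤ η ^ γ := Real.rpow_le_rpow h0 hle hγ0.le
    gcongr
  choose! h hh0 hhl hhr using fun t ht => hs t ht η hη0
  obtain ⟨Q, hQ, hcov⟩ := (isCompact_Icc (a := (0 : ℝ)) (b := T)).elim_nhds_subcover
    (fun t => Metric.ball t (h t)) fun t ht => Metric.ball_mem_nhds t (hh0 t ht)
  obtain ⟨δ₁, hδ₁, hleb⟩ := lebesgue_number_lemma_of_metric (ι := Q)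
    (c := fun t => Metric.ball (t : ℝ) (h t)) (isCompact_Icc (a := (0 : ℝ)) (b := T))
    (fun t => Metric.isOpen_ball) (fun x hx => by
      obtain ⟨t, ht, hxt⟩ := mem_iUnion₂.1 (hcov hx)
      exact mem_iUnion.2 ⟨⟨t, ht⟩, hxt⟩)
  set ε' := ε / (2 * (Q.card + 1)) with hε'
  have hε'0 : 0 < ε' := by positivity
  obtain ⟨δ₂, hδ₂, hbad⟩ : ∃ δ > 0, ∀ t ∈ Q, ∀ u v, 0 ≤ u → u < t → t ≤ v → v ≤ T →
      v - u < δ → ‖J u v‖ ≤ ε' := by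
    have hev : ∀ᶠ δ in 𝓝[>] (0 : ℝ), ∀ t ∈ Q, ∀ u v, 0 ≤ u → u < t → t ≤ v → v ≤ T →
        v - u < δ → ‖J u v‖ ≤ ε' := by
      rw [Filter.eventually_all_finset]
      intro t ht
      have htm := hQ t ht
      rcases htm.1.eq_or_lt with h0 | h0
      · exact Eventually.of_forall fun δ u v hu hut => by linarith
      · obtain ⟨δ, hδ, hδb⟩ := hb t h0 htm.2 ε' hε'0
        filter_upwards [Ioc_mem_nhdsGT hδ] with δ' hδ' u v h1 h2 h3 h4 h5
        exact hδb u v h1 h2 h3 h4 (h5.trans_le hδ'.2)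
    obtain ⟨δ, hδ1, hδ2⟩ := (hev.and self_mem_nhdsWithin).exists
    exact ⟨δ, hδ2, hδ1⟩
  refine ⟨min δ₁ δ₂, by positivity, fun π hπ => ?_⟩
  -- The increment of `χ t` over a cell is 1 exactly when the cell straddles `t`. Its telescoping
  -- sum is at most 1, so each time is counted at most once.
  set χ : ℝ → ℝ → ℝ := fun t s => if t ≤ s then 1 else 0 with hχ
  have hχm : ∀ t, Monotone (χ t) := fun t u v huv => by
    simp only [hχ]
    split_ifs with h1 h2
    · exact le_rfl
    · exact absurd (h1.trans huv) h2
    · exact zero_le_one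
    · exact le_rfl
  have hterm : ∀ i ∈ Finset.range π.n, ‖J (π.pts i) (π.pts (i + 1))‖ ≤
      B * η ^ γ * ω (π.pts i) (π.pts (i + 1)) +
        ∑ t ∈ Q, ε' * (χ t (π.pts (i + 1)) - χ t (π.pts i)) := by
    intro i hi
    have hi' := Finset.mem_range.1 hi
    have hum := π.pts_mem (i := i) hi'.le
    have hvm := π.pts_mem (i := i + 1) hi'
    have huv := π.lt_succ i hi'
    have hmesh := hπ i hi'
    set u := π.pts i
    set v := π.pts (i + 1)
    have hvT : v ≤ T := hvm.2.trans ht₀.2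
    have huT : u ∈ Icc 0 T := ⟨hum.1, huv.le.trans hvT⟩
    have hvT' : v ∈ Icc 0 T := ⟨hvm.1, hvT⟩
    have hnn : ∀ t ∈ Q, 0 ≤ ε' * (χ t v - χ t u) := fun t _ =>
      mul_nonneg hε'0.le (sub_nonneg.2 (hχm t huv.le))
    have hω0 := hω.nonneg u huT v hvT' huv.le
    obtain ⟨⟨t, ht⟩, hball⟩ := hleb u huT
    have htm := hQ t ht
    have hu1 : u ∈ Metric.ball t (h t) := hball (Metric.mem_ball_self hδ₁)
    have hv1 : v ∈ Metric.ball t (h t) := hball (by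
      rw [Metric.mem_ball, Real.dist_eq, abs_of_pos (by linarith)]
      exact hmesh.trans_le (min_le_left _ _))
    rw [Metric.mem_ball, Real.dist_eq, abs_lt] at hu1 hv1
    by_cases hcase : u < t ∧ t ≤ v
    · have h1 := hbad t ht u v hum.1 hcase.1 hcase.2 hvT (hmesh.trans_le (min_le_right _ _))
      have h2 : ε' * (χ t v - χ t u) ≤ ∑ t ∈ Q, ε' * (χ t v - χ t u) :=
        Finset.single_le_sum hnn ht
      have h3 : χ t v - χ t u = 1 := by
        simp only [hχ, hcase.2, not_le.2 hcase.1, if_true, if_false, sub_zero]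
      rw [h3, mul_one] at h2
      have h4 : 0 ≤ B * η ^ γ * ω u v := by positivity
      linarith
    · have hsm : ω u v ≤ η := by
        rw [not_and_or, not_lt, not_le] at hcase
        rcases hcase with h1 | h1
        · exact (hω.mono htm huT hvT' hvT' h1 huv.le le_rfl).trans
            (hhr t htm v (h1.trans huv.le) (by linarith) hvT)
        · exact hhl t htm u v hum.1 (by linarith) huv.le h1
      have h1 := hgood u v hum.1 huv hvT hsm
      have h2 := Finset.sum_nonneg hnn
      linarith
  refine (Finset.sum_le_sum hterm).trans ?_
  rw [Finset.sum_add_distrib, ← Finset.mul_sum, Finset.sum_comm]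
  have h1 : ∑ i ∈ Finset.range π.n, ω (π.pts i) (π.pts (i + 1)) ≤ Ω := by
    have hω' : IsControl (Icc 0 t₀) ω :=
      ⟨fun a ha b hb => hω.nonneg a ⟨ha.1, ha.2.trans ht₀.2⟩ b ⟨hb.1, hb.2.trans ht₀.2⟩,
        fun a ha b hb c hc => hω.superadd a ⟨ha.1, ha.2.trans ht₀.2⟩ b
          ⟨hb.1, hb.2.trans ht₀.2⟩ c ⟨hc.1, hc.2.trans ht₀.2⟩⟩
    exact (hω'.sum_le π).trans (hω.mono ⟨le_rfl, hT⟩ ⟨le_rfl, hT⟩ ht₀ ⟨hT, le_rfl⟩ le_rfl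
      ht₀.1 ht₀.2)
  have h2 : ∑ t ∈ Q, ∑ i ∈ Finset.range π.n, ε' * (χ t (π.pts (i + 1)) - χ t (π.pts i)) ≤
      ∑ _t ∈ Q, ε' := by
    refine Finset.sum_le_sum fun t _ => ?_
    rw [← Finset.mul_sum, Finset.sum_range_sub (fun i => χ t (π.pts i))]
    refine mul_le_of_le_one_right hε'0.le ?_
    simp only [hχ]
    split_ifs <;> norm_num
  have h3 : B * η ^ γ * ∑ i ∈ Finset.range π.n, ω (π.pts i) (π.pts (i + 1)) ≤ ε / 2 :=
    (mul_le_mul_of_nonneg_left h1 (by positivity)).trans hηγ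
  have h4 : ∑ _t ∈ Q, ε' ≤ ε / 2 := by
    rw [Finset.sum_const, nsmul_eq_mul, hε', ← mul_div_assoc, div_le_div_iff₀ (by positivity)
      (by norm_num)]
    nlinarith
  linarith

end CadlagRDE

/-! ### The scheme and its compactness limit -/

namespace CadlagRDE

variable {d k : ℕ} {p T : ℝ}

/-- The solution of the discrete rough differential equation. -/
noncomputable def scheme (f : Vec k → Vec d →L[ℝ] Vec k) (y₀ : Vec k) (x : ℕ → Vec d)
    (a : ℕ → ℕ → Tens d) : ℕ → Vec k
  | 0 => y₀
  | n + 1 => scheme f y₀ x a n + germ f (scheme f y₀ x a n) (x (n + 1) - x n) (a n (n + 1))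

theorem err_scheme (f : Vec k → Vec d →L[ℝ] Vec k) (y₀ : Vec k) (x : ℕ → Vec d)
    (a : ℕ → ℕ → Tens d) (i : ℕ) : err f x a (scheme f y₀ x a) i (i + 1) = 0 := by
  simp [err, scheme]

/-- The estimates for approximate solutions of a rough differential equation between two times. -/
structure DavieBound (X : RoughPath d p T) (f : Vec k → Vec d →L[ℝ] Vec k) (ρ B : ℝ) (s t : ℝ)
    (y z : Vec k) : Prop where
  incr_le : ‖z - y‖ ≤ B * X.ctrl s t ^ (1 / p)
  rem_le : ‖z - y - f y (incr X.path s t)‖ ≤ B * (X.ctrl s t ^ (1 / p)) ^ 2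
  germ_le : X.ctrl s t ≤ ρ → ‖z - y - germ f y (incr X.path s t) (X.area s t)‖ ≤
    B * (X.ctrl s t ^ (1 / p)) ^ 3
  jump_le : ∀ w ≤ ρ, s < t → (∀ r ∈ Ico s t, X.ctrl s r ≤ w) →
    ‖z - y - germ f y (incr X.path s t) (X.area s t)‖ ≤ B * w ^ (1 / p)

theorem continuous_germ {f : Vec k → Vec d →L[ℝ] Vec k} {M : ℝ} (hf : BoundC2 f M) (x : Vec d)
    (a : Tens d) : Continuous fun y => germ f y x a := by
  have h1 : Continuous f := hf.diff.continuous
  have h2 : Continuous (fderiv ℝ f) := by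
    have hl : LipschitzWith ⟨M, hf.nonneg⟩ (fderiv ℝ f) := LipschitzWith.of_dist_le_mul
      fun x y => by
        rw [dist_eq_norm, dist_eq_norm]
        exact hf.fderiv_lip x y
    exact hl.continuous
  have h3 : Continuous (coefD f) := h2.clm_comp h1
  unfold germ tensApply
  fun_prop

/-- The premises inside the clauses do not involve the endpoint values, and the conclusions are
non-strict inequalities between continuous functions of them. The bounds therefore survive pointwise
limits. -/
theorem isClosed_davieBound {f : Vec k → Vec d →L[ℝ] Vec k} {M : ℝ} (hf : BoundC2 f M)
    (X : RoughPath d p T) (ρ B s t : ℝ) :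
    IsClosed {yz : Vec k × Vec k | DavieBound X f ρ B s t yz.1 yz.2} := by
  have h1 : Continuous f := hf.diff.continuous
  have h2 := (continuous_germ hf (incr X.path s t) (X.area s t)).comp
    (continuous_fst (X := Vec k) (Y := Vec k))
  have h3 : Continuous fun yz : Vec k × Vec k => f yz.1 (incr X.path s t) := by fun_prop
  have e : {yz : Vec k × Vec k | DavieBound X f ρ B s t yz.1 yz.2} =
      {yz | ‖yz.2 - yz.1‖ ≤ B * X.ctrl s t ^ (1 / p)} ∩
      {yz | ‖yz.2 - yz.1 - f yz.1 (incr X.path s t)‖ ≤ B * (X.ctrl s t ^ (1 / p)) ^ 2} ∩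
      {yz | X.ctrl s t ≤ ρ → ‖yz.2 - yz.1 - germ f yz.1 (incr X.path s t) (X.area s t)‖ ≤
        B * (X.ctrl s t ^ (1 / p)) ^ 3} ∩
      {yz | ∀ w ≤ ρ, s < t → (∀ r ∈ Ico s t, X.ctrl s r ≤ w) →
        ‖yz.2 - yz.1 - germ f yz.1 (incr X.path s t) (X.area s t)‖ ≤ B * w ^ (1 / p)} := by
    ext yz
    exact ⟨fun h => ⟨⟨⟨h.1, h.2⟩, h.3⟩, h.4⟩, fun h => ⟨h.1.1.1, h.1.1.2, h.1.2, h.2⟩⟩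
  have h4 : Continuous fun yz : Vec k × Vec k =>
      ‖yz.2 - yz.1 - germ f yz.1 (incr X.path s t) (X.area s t)‖ :=
    ((continuous_snd.sub continuous_fst).sub h2).norm
  rw [e]
  refine (((isClosed_le (continuous_snd.sub continuous_fst).norm continuous_const).inter
    (isClosed_le ((continuous_snd.sub continuous_fst).sub h3).norm continuous_const)).inter
    ?_).inter ?_
  · simp only [Set.ofPred_forall]
    exact isClosed_iInter fun _ => isClosed_le h4 continuous_const
  · simp only [Set.ofPred_forall]
    exact isClosed_iInter fun w => isClosed_iInter fun _ => isClosed_iInter fun _ =>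
      isClosed_iInter fun _ => isClosed_le h4 continuous_const

/-- Run the scheme along a partition containing `F` and read off its values. For the bound across a
jump at `t`, the last clause of `exists_apriori` is applied to the partition point just before `t`,
where the control is still at most `w`. -/
theorem exists_discrete_solution (d k : ℕ) {p M Ω : ℝ} (hp : 1 ≤ p) (hp3 : p < 3) (hM : 1 ≤ M)
    (hΩ : 1 ≤ Ω) : ∃ ρ B : ℝ, 0 < ρ ∧ ρ ≤ 1 ∧ 0 ≤ B ∧ ∀ T : ℝ, 0 ≤ T →
      ∀ (f : Vec k → Vec d →L[ℝ] Vec k), BoundC2 f M → ∀ (y₀ : Vec k) (X : RoughPath d p T),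
      X.ctrl 0 T ≤ Ω → ∀ F : Finset ℝ, (∀ t ∈ F, t ∈ Icc 0 T) → ∃ y : ℝ → Vec k, y 0 = y₀ ∧
        ∀ s ∈ F, ∀ t ∈ F, s ≤ t → DavieBound X f ρ B s t (y s) (y t) := by
  have hp0 : 0 < p := by linarith
  have hα : 1 / 3 < 1 / p := one_div_lt_one_div_of_lt hp0 hp3
  obtain ⟨ρ, B, hρ, hρ1, hB, H⟩ := exists_apriori d k hα hM hΩ
  refine ⟨ρ ^ 3, B, by positivity, pow_le_one₀ hρ.le hρ1, hB, ?_⟩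
  intro T hT f hf y₀ X hX F hF
  obtain ⟨π, hπ⟩ := Partition.exists_subset F hT hF
  set x := fun i => X.path (π.time i) with hx
  set a := fun i j => X.area (π.time i) (π.time j) with ha
  set ω := fun i j => X.ctrl (π.time i) (π.time j) with hω
  have cX := RoughPath.isControl (X := X) hp0
  have cω : IsControl univ ω := cX.comp π.time_monotone π.time_mem
  have hωΩ : ∀ i j, i ≤ j → ω i j ≤ Ω := fun i j hij =>
    (cX.mono ⟨le_rfl, hT⟩ (π.time_mem i) (π.time_mem j) ⟨hT, le_rfl⟩ (π.time_mem i).1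
      (π.time_monotone hij) (π.time_mem j).2).trans hX
  have hmain := H (1 / p) le_rfl (by rw [div_le_one hp0]; exact hp) f hf x a ω
    (scheme f y₀ x a) cω (X.discreteRough hp0 π fun _ _ _ => le_rfl) hωΩ (err_scheme f y₀ x a)
  classical
  -- The first index is taken because `π.time` is constant after the last point. Minimality ensures
  -- that the preceding partition point lies strictly before `t`. Off the partition the index 0 is
  -- an irrelevant default.
  set idx : ℝ → ℕ := fun t => if h : ∃ i, π.time i = t then Nat.find h else 0 with hidx
  have idx_spec : ∀ t ∈ F, π.time (idx t) = t := fun t ht => by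
    simp only [hidx, dif_pos (hπ t ht)]
    exact Nat.find_spec (hπ t ht)
  have idx_min : ∀ t ∈ F, ∀ i < idx t, π.time i ≠ t := fun t ht i hi => by
    simp only [hidx, dif_pos (hπ t ht)] at hi
    exact Nat.find_min (hπ t ht) hi
  have hcube : ∀ i j, i ≤ j → ω i j ≤ ρ ^ 3 → ω i j ^ (1 / p) ≤ ρ := fun i j hij h =>
    rpow_le_of_le_cube (cω.nonneg i trivial j trivial hij) hρ hρ1 hα.le h
  refine ⟨fun t => scheme f y₀ x a (idx t), ?_, ?_⟩
  · have h0 : idx 0 = 0 := by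
      have h : ∃ i, π.time i = 0 := ⟨0, π.time_zero⟩
      simp only [hidx, dif_pos h]
      exact (Nat.find_eq_zero h).2 π.time_zero
    simp only [h0, scheme]
  · intro s hs t ht hst
    have es := idx_spec s hs
    have et := idx_spec t ht
    have hle : idx s ≤ idx t := by
      by_contra hcon
      have h1 := π.time_monotone (not_le.1 hcon).le
      rw [es, et] at h1
      exact idx_min s hs _ (not_le.1 hcon) (by rw [et]; exact le_antisymm h1 hst)
    obtain ⟨m1, m2, m3, -⟩ := hmain (idx s) (idx t) hle
    have eω : ω (idx s) (idx t) = X.ctrl s t := by simp only [hω, es, et]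
    have eJ : err f x a (scheme f y₀ x a) (idx s) (idx t) = scheme f y₀ x a (idx t) -
        scheme f y₀ x a (idx s) - germ f (scheme f y₀ x a (idx s)) (incr X.path s t)
          (X.area s t) := by
      simp only [err, hx, ha, es, et, incr]
    refine ⟨?_, ?_, fun h => ?_, fun w hw hlt h => ?_⟩
    · rw [← eω]; exact m2
    · rw [← eω]
      simpa only [hx, es, et, incr] using m3
    · rw [← eJ, ← eω]
      exact m1 (hcube _ _ hle (by rwa [eω]))
    · have hne : idx s ≠ idx t := fun h => by
        rw [h, et] at es
        exact hlt.ne' es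
      obtain ⟨j, hj⟩ : ∃ j, idx t = j + 1 := Nat.exists_eq_succ_of_ne_zero (by omega)
      have hsj : idx s ≤ j := by omega
      have hjt : π.time j < t := by
        refine lt_of_le_of_ne ?_ (idx_min t ht j (by omega))
        have := π.time_monotone (show j ≤ idx t by omega)
        rwa [et] at this
      have hjs : s ≤ π.time j := by
        have := π.time_monotone hsj
        rwa [es] at this
      have h1 : ω (idx s) j ≤ w := by
        have := h (π.time j) ⟨hjs, hjt⟩
        simpa only [hω, es] using this
      have h2 := (hmain (idx s) j hsj).2.2.2 (hcube _ _ hsj (h1.trans hw))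
      rw [← hj, eJ] at h2
      have h3 := cω.nonneg (idx s) trivial j trivial hsj
      exact h2.trans (by gcongr)

/-- At each time the discrete solutions stay in a fixed closed ball, which is compact. Along an
ultrafilter on the finite sets of times, finer than `atTop`, they converge at all times at once, and
the closed bounds pass to the limit. -/
theorem exists_davie_path (d k : ℕ) {p M Ω : ℝ} (hp : 1 ≤ p) (hp3 : p < 3) (hM : 1 ≤ M)
    (hΩ : 1 ≤ Ω) : ∃ ρ B : ℝ, 0 < ρ ∧ ρ ≤ 1 ∧ 0 ≤ B ∧ ∀ T : ℝ, 0 ≤ T →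
      ∀ (f : Vec k → Vec d →L[ℝ] Vec k), BoundC2 f M → ∀ (y₀ : Vec k) (X : RoughPath d p T),
      X.ctrl 0 T ≤ Ω → ∃ Y : ℝ → Vec k, Y 0 = y₀ ∧
        ∀ s t, 0 ≤ s → s ≤ t → t ≤ T → DavieBound X f ρ B s t (Y s) (Y t) := by
  obtain ⟨ρ, B, hρ, hρ1, hB, H⟩ := exists_discrete_solution d k hp hp3 hM hΩ
  refine ⟨ρ, B, hρ, hρ1, hB, ?_⟩
  intro T hT f hf y₀ X hX
  have hp0 : 0 < p := by linarith
  classical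
  -- The time 0 is always included, so that the distance from `y₀` is controlled.
  set F' : Finset ℝ → Finset ℝ := fun F => insert 0 (F.filter fun t => t ∈ Icc 0 T) with hF'
  have hF'T : ∀ F, ∀ t ∈ F' F, t ∈ Icc 0 T := fun F t ht => by
    rcases Finset.mem_insert.1 ht with rfl | h
    · exact ⟨le_rfl, hT⟩
    · exact (Finset.mem_filter.1 h).2
  choose y hy0 hy using fun F => H T hT f hf y₀ X hX (F' F) (hF'T F)
  set U : Ultrafilter (Finset ℝ) := Ultrafilter.of atTop with hU
  have hmem : ∀ t ∈ Icc 0 T, ∀ᶠ F in (U : Filter (Finset ℝ)), t ∈ F' F := fun t ht => by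
    refine Ultrafilter.of_le atTop ?_
    filter_upwards [eventually_ge_atTop ({t} : Finset ℝ)] with F hF
    exact Finset.mem_insert_of_mem (Finset.mem_filter.2 ⟨hF (Finset.mem_singleton_self t), ht⟩)
  have hlim : ∀ t ∈ Icc 0 T, ∃ v, Tendsto (fun F => y F t) U (𝓝 v) := by
    intro t ht
    have hb : ∀ᶠ F in (U : Filter (Finset ℝ)),
        y F t ∈ Metric.closedBall y₀ (B * X.ctrl 0 t ^ (1 / p)) := by
      filter_upwards [hmem t ht] with F hF
      have := (hy F 0 (Finset.mem_insert_self _ _) t hF ht.1).incr_le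
      rwa [hy0, ← dist_eq_norm] at this
    obtain ⟨v, -, hv⟩ := (isCompact_closedBall y₀ _).ultrafilter_le_nhds
      (U.map fun F => y F t) (by
        rw [Ultrafilter.coe_map]
        exact tendsto_principal.2 hb)
    exact ⟨v, by rwa [Ultrafilter.coe_map] at hv⟩
  choose! Y hY using hlim
  refine ⟨Y, ?_, ?_⟩
  · have h := hY 0 ⟨le_rfl, hT⟩
    simp only [hy0] at h
    exact (tendsto_nhds_unique h tendsto_const_nhds)
  · intro s t hs hst ht
    have hsm : s ∈ Icc 0 T := ⟨hs, hst.trans ht⟩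
    have htm : t ∈ Icc 0 T := ⟨hs.trans hst, ht⟩
    refine (isClosed_davieBound hf X ρ B s t).mem_of_tendsto
      ((hY s hsm).prodMk_nhds (hY t htm)) ?_
    filter_upwards [hmem s hsm, hmem t htm] with F h1 h2
    exact hy F s h1 t h2 hst

/-! ### The limit path solves the equation -/

section Limit

variable {X : RoughPath d p T} {f : Vec k → Vec d →L[ℝ] Vec k} {M Ω ρ B : ℝ} {Y : ℝ → Vec k}

/-- The increments are dominated by a power of the control, which is small on short intervals
starting at `t` and on intervals ending shortly before `t`. The second fact gives the Cauchy
criterion for the left limit. -/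
theorem isCadlagOn_of_davie (hp : 0 < p) (hB : 0 ≤ B)
    (h : ∀ s t, 0 ≤ s → s ≤ t → t ≤ T → DavieBound X f ρ B s t (Y s) (Y t)) :
    IsCadlagOn Y 0 T := by
  have cX := RoughPath.isControl (X := X) hp
  have hsmall : ∀ ε > 0, ∃ η > 0, ∀ w, 0 ≤ w → w ≤ η → B * w ^ (1 / p) < ε := by
    intro ε hε
    refine ⟨(ε / (B + 1)) ^ p, by positivity, fun w hw0 hw => ?_⟩
    have h1 : w ^ (1 / p) ≤ ε / (B + 1) := by
      calc w ^ (1 / p) ≤ ((ε / (B + 1)) ^ p) ^ (1 / p) :=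
            Real.rpow_le_rpow hw0 hw (by positivity)
        _ = _ := by rw [← Real.rpow_mul (by positivity), mul_one_div_cancel hp.ne', Real.rpow_one]
    calc B * w ^ (1 / p) ≤ B * (ε / (B + 1)) := by gcongr
      _ < ε := by
        rw [← mul_div_assoc, div_lt_iff₀ (by positivity)]
        nlinarith
  constructor
  · intro t ht
    rw [Metric.continuousWithinAt_iff]
    intro ε hε
    obtain ⟨η, hη, hw⟩ := hsmall ε hε
    obtain ⟨δ, hδ, -, h2⟩ := X.locallySmall hp t ⟨ht.1, ht.2.le⟩ η hη
    refine ⟨min δ (T - t), lt_min hδ (by linarith [ht.2]), fun v hv hvt => ?_⟩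
    rw [Real.dist_eq, abs_of_nonneg (by linarith [show t ≤ v from hv])] at hvt
    have hvT : v ≤ T := by linarith [min_le_right δ (T - t)]
    rw [dist_eq_norm]
    refine (h t v ht.1 hv hvT).incr_le.trans_lt (hw _ (cX.nonneg _ ⟨ht.1, ht.2.le⟩ _
      ⟨ht.1.trans hv, hvT⟩ hv) (h2 v hv (by linarith [min_le_left δ (T - t)]) hvT))
  · intro t ht
    have hc : Cauchy (map Y (𝓝[<] t)) := by
      rw [Metric.cauchy_iff]
      refine ⟨inferInstance, fun ε hε => ?_⟩
      obtain ⟨η, hη, hw⟩ := hsmall ε hε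
      obtain ⟨δ, hδ, h1, -⟩ := X.locallySmall hp t ⟨ht.1.le, ht.2⟩ η hη
      have hI : Ioo (max 0 (t - δ)) t ∈ 𝓝[<] t :=
        Ioo_mem_nhdsLT (max_lt ht.1 (by linarith))
      refine ⟨Y '' Ioo (max 0 (t - δ)) t, image_mem_map hI, ?_⟩
      have key : ∀ u ∈ Ioo (max 0 (t - δ)) t, ∀ v ∈ Ioo (max 0 (t - δ)) t, u ≤ v →
          ‖Y v - Y u‖ < ε := by
        intro u hu v hv huv
        have hu0 : 0 ≤ u := (le_max_left _ _).trans hu.1.le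
        have hvT : v ≤ T := hv.2.le.trans ht.2
        exact (h u v hu0 huv hvT).incr_le.trans_lt (hw _ (cX.nonneg _ ⟨hu0, huv.trans hvT⟩ _
          ⟨hu0.trans huv, hvT⟩ huv) (h1 u v hu0 ((le_max_right _ _).trans_lt hu.1) huv hv.2))
      rintro _ ⟨u, hu, rfl⟩ _ ⟨v, hv, rfl⟩
      rcases le_total u v with huv | huv
      · rw [dist_comm, dist_eq_norm]; exact key u hu v hv huv
      · rw [dist_eq_norm]; exact key v hv u hu huv
    exact cauchy_map_iff_exists_tendsto.1 hc

theorem isControlled_of_davie (hp : 0 < p) (hT : 0 ≤ T) (hB : 0 ≤ B)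
    (hf : BoundC2 f M)
    (h : ∀ s t, 0 ≤ s → s ≤ t → t ≤ T → DavieBound X f ρ B s t (Y s) (Y t)) :
    IsControlled p T X.path Y (fun t => f (Y t)) ∧
      controlledNorm p T X.path Y (fun t => f (Y t)) ≤
        M + M * B * X.ctrl 0 T ^ (1 / p) + B * (X.ctrl 0 T ^ (1 / p)) ^ 2 := by
  have cX := RoughPath.isControl (X := X) hp
  have hM := hf.nonneg
  have hY := isCadlagOn_of_davie hp hB h
  have hfc : Continuous f := hf.diff.continuous
  have v1 := eVar_lt_top_and_pVar_le (Ξ := incr Y) hp cX hT hB fun s t hs hst ht =>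
    (h s t hs hst.le ht).incr_le
  have v2 := eVar_lt_top_and_pVar_le (Ξ := incr fun t => f (Y t)) hp cX hT (mul_nonneg hM hB)
    fun s t hs hst ht => by
      refine (hf.lip (Y t) (Y s)).trans ?_
      rw [mul_assoc]
      gcongr
      exact (h s t hs hst.le ht).incr_le
  have v3 := eVar_lt_top_and_pVar_le (Ξ := remainder X.path Y fun t => f (Y t))
    (half_pos hp) cX hT hB fun s t hs hst ht => by
      rw [rpow_one_div_half (cX.nonneg s ⟨hs, hst.le.trans ht⟩ t ⟨hs.trans hst.le, ht⟩ hst.le)]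
      exact (h s t hs hst.le ht).rem_le
  refine ⟨⟨⟨hY, v1.1⟩, ⟨hY.comp hfc, v2.1⟩, ?_, ?_, v3.1⟩, ?_⟩
  · intro t ht
    exact (hY.mono le_rfl ht.2).comp₂ (X.path_mem.1.mono le_rfl ht.2)
      (φ := fun yx => Y t - yx.1 - f yx.1 (X.path t - yx.2)) (by fun_prop)
  · intro s hs
    exact (hY.mono hs.1 le_rfl).comp₂ (X.path_mem.1.mono hs.1 le_rfl)
      (φ := fun yx => yx.1 - Y s - f (Y s) (yx.2 - X.path s)) (by fun_prop)
  · have h1 := hf.bound (Y 0)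
    have h2 := v3.2
    rw [rpow_one_div_half (cX.nonneg 0 ⟨le_rfl, hT⟩ T ⟨hT, le_rfl⟩ hT)] at h2
    exact add_le_add (add_le_add h1 v2.2) h2

/-- Split the cell at `t`. The error over `[u, t]` is bounded through the control before `t`,
whatever the jump at `t`. The error over `[t, v]` is small because the control of `[t, v]` is. The
defect is a bounded coefficient applied to the path and the area over `[t, v]`, which are small as
well. -/
theorem exists_norm_germ_error_le (hp : 1 ≤ p) (hρ : 0 < ρ) (hρ1 : ρ ≤ 1) (hB : 0 ≤ B)
    (hf : BoundC2 f M)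
    (h : ∀ s t, 0 ≤ s → s ≤ t → t ≤ T → DavieBound X f ρ B s t (Y s) (Y t)) {t ε : ℝ}
    (ht0 : 0 < t) (htT : t ≤ T) (hε : 0 < ε) :
    ∃ δ > 0, ∀ u v, 0 ≤ u → u < t → t ≤ v → v ≤ T → v - u < δ →
      ‖Y v - Y u - germ f (Y u) (incr X.path u v) (X.area u v)‖ ≤ ε := by
  have hp0 : 0 < p := by linarith
  have cX := RoughPath.isControl (X := X) hp0
  have hM := hf.nonneg
  have hT : 0 ≤ T := ht0.le.trans htT
  have hD := one_le_tensConst d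
  set D := tensConst d with hDdef
  set Φ := X.ctrl 0 T ^ (1 / p) with hΦ
  have hΦ0 : 0 ≤ Φ := Real.rpow_nonneg (cX.nonneg 0 ⟨le_rfl, hT⟩ T ⟨hT, le_rfl⟩ hT) _
  set C := 2 * B + (2 * M + M ^ 2 * Φ) + D * (2 * M ^ 2) with hC
  have hC0 : 0 ≤ C := by positivity
  set η := min ρ ((ε / (C + 1)) ^ p) with hη
  have hη0 : 0 < η := by positivity
  have hηρ : η ≤ ρ := min_le_left _ _
  set r := η ^ (1 / p) with hr
  have hr0 : 0 ≤ r := by positivity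
  have hr1 : r ≤ 1 := Real.rpow_le_one hη0.le (hηρ.trans hρ1) (by positivity)
  have hCr : C * r ≤ ε := by
    have h1 : r ≤ ε / (C + 1) := by
      calc r ≤ ((ε / (C + 1)) ^ p) ^ (1 / p) :=
            Real.rpow_le_rpow hη0.le (min_le_right _ _) (by positivity)
        _ = _ := by rw [← Real.rpow_mul (by positivity), mul_one_div_cancel hp0.ne', Real.rpow_one]
    calc C * r ≤ C * (ε / (C + 1)) := by gcongr
      _ ≤ ε := by
        rw [← mul_div_assoc, div_le_iff₀ (by positivity)]
        nlinarith
  obtain ⟨δ, hδ, hl, hrt⟩ := X.locallySmall hp0 t ⟨ht0.le, htT⟩ η hη0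
  refine ⟨δ, hδ, fun u v hu hut htv hvT huv => ?_⟩
  have hum : u ∈ Icc 0 T := ⟨hu, hut.le.trans htT⟩
  have htm : t ∈ Icc 0 T := ⟨ht0.le, htT⟩
  have hvm : v ∈ Icc 0 T := ⟨ht0.le.trans htv, hvT⟩
  have hω := hrt v htv (by linarith) hvT
  have hω0 := cX.nonneg t htm v hvm htv
  have hφ : X.ctrl t v ^ (1 / p) ≤ r := Real.rpow_le_rpow hω0 hω (by positivity)
  have hφ0 : 0 ≤ X.ctrl t v ^ (1 / p) := Real.rpow_nonneg hω0 _
  have b1 := (h u t hu hut.le htT).jump_le η hηρ hut fun q hq =>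
    hl u q hu (by linarith) hq.1 hq.2
  have b2 : ‖Y v - Y t - germ f (Y t) (incr X.path t v) (X.area t v)‖ ≤ B * r := by
    refine ((h t v ht0.le htv hvT).germ_le (hω.trans hηρ)).trans ?_
    gcongr
    exact (pow_le_of_le_one hφ0 (hφ.trans hr1) (by norm_num)).trans hφ
  have hx1 : ‖incr X.path u t‖ ≤ Φ := by
    refine (RoughPath.norm_path_le hp0 hu hut.le htT).trans
      (Real.rpow_le_rpow (vr_nonneg _ _ _ _) ?_ (by positivity))
    exact (le_add_of_nonneg_right (vr_nonneg _ _ _ _)).trans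
      (cX.mono ⟨le_rfl, hT⟩ hum htm ⟨hT, le_rfl⟩ hu hut.le htT)
  have hx2 : ‖incr X.path t v‖ ≤ r := by
    refine (RoughPath.norm_path_le hp0 ht0.le htv hvT).trans (le_trans
      (Real.rpow_le_rpow (vr_nonneg _ _ _ _) ?_ (by positivity)) hφ)
    exact le_add_of_nonneg_right (vr_nonneg _ _ _ _)
  have ha2 : ‖X.area t v‖ ≤ r := by
    have h1 : vr (p / 2) X.area t v ^ (1 / p) ≤ r := (Real.rpow_le_rpow (vr_nonneg _ _ _ _)
      (le_add_of_nonneg_left (vr_nonneg _ _ _ _)) (by positivity)).trans hφ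
    have h2 : 0 ≤ vr (p / 2) X.area t v ^ (1 / p) := Real.rpow_nonneg (vr_nonneg _ _ _ _) _
    exact (RoughPath.norm_area_le hp0 ht0.le htv hvT).trans
      ((pow_le_of_le_one h2 (h1.trans hr1) (by norm_num)).trans h1)
  have hd := germ_defect f (Y u) (Y t) (incr X.path u t) (incr X.path t v) (X.area u t)
    (X.area t v)
  rw [← X.area_add hu hut.le htv hvT] at hd
  have ei : incr X.path u t + incr X.path t v = incr X.path u v := by simp only [incr]; abel
  rw [ei] at hd
  set A := f (Y t) - f (Y u) - fderiv ℝ f (Y u) (f (Y u) (incr X.path u t)) with hA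
  have hAn : ‖A‖ ≤ 2 * M + M ^ 2 * Φ := by
    have h1 : ‖fderiv ℝ f (Y u) (f (Y u) (incr X.path u t))‖ ≤ M * (M * Φ) :=
      (ContinuousLinearMap.le_opNorm _ _).trans (mul_le_mul (hf.fderiv_bound _)
        (norm_apply_le_of_le hf (Y u) hx1) (norm_nonneg _) hM)
    have h2 := hf.bound (Y t)
    have h3 := hf.bound (Y u)
    have h4 := norm_sub_le (f (Y t) - f (Y u)) (fderiv ℝ f (Y u) (f (Y u) (incr X.path u t)))
    have h5 := norm_sub_le (f (Y t)) (f (Y u))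
    rw [hA]
    linarith
  have hcn : ‖coefD f (Y t) - coefD f (Y u)‖ ≤ 2 * M ^ 2 := by
    have h1 := norm_sub_le (coefD f (Y t)) (coefD f (Y u))
    have h2 := norm_coefD_le hf (Y t)
    have h3 := norm_coefD_le hf (Y u)
    linarith
  have b3 : ‖A (incr X.path t v)‖ ≤ (2 * M + M ^ 2 * Φ) * r :=
    (ContinuousLinearMap.le_opNorm _ _).trans
      (mul_le_mul hAn hx2 (norm_nonneg _) (by positivity))
  have b4 : ‖tensApply (coefD f (Y t) - coefD f (Y u)) (X.area t v)‖ ≤ D * (2 * M ^ 2) * r := by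
    refine (norm_tensApply_le _ _).trans ?_
    gcongr
  have e : Y v - Y u - germ f (Y u) (incr X.path u v) (X.area u v) =
      (Y t - Y u - germ f (Y u) (incr X.path u t) (X.area u t)) +
      (Y v - Y t - germ f (Y t) (incr X.path t v) (X.area t v)) +
      (A (incr X.path t v) + tensApply (coefD f (Y t) - coefD f (Y u)) (X.area t v)) := by
    have e1 : germ f (Y u) (incr X.path u v) (X.area u v) =
        germ f (Y u) (incr X.path u t) (X.area u t) +
        germ f (Y t) (incr X.path t v) (X.area t v) - A (incr X.path t v) -
        tensApply (coefD f (Y t) - coefD f (Y u)) (X.area t v) := by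
      rw [sub_sub, sub_eq_iff_eq_add] at hd
      rw [hd]; abel
    rw [e1]; abel
  rw [e]
  refine (norm_add_le _ _).trans ((add_le_add (norm_add_le _ _) (norm_add_le _ _)).trans ?_)
  rw [hC] at hCr
  linarith

/-- The increments of `Y` telescope, so the sum of the germ errors over a partition is the
difference between `Y t - y₀` and the Riemann sum. -/
theorem isSolution_of_davie (hp : 1 ≤ p) (hp3 : p < 3) (hT : 0 ≤ T) (hρ : 0 < ρ) (hρ1 : ρ ≤ 1)
    (hB : 0 ≤ B) (hf : BoundC2 f M) {y₀ : Vec k} (hY0 : Y 0 = y₀)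
    (h : ∀ s t, 0 ≤ s → s ≤ t → t ≤ T → DavieBound X f ρ B s t (Y s) (Y t)) :
    IsSolution X f y₀ Y (fun t => f (Y t)) := by
  have hp0 : 0 < p := by linarith
  refine ⟨(isControlled_of_davie hp0 hT hB hf h).1, fun _ _ => rfl, fun t ht ε hε => ?_⟩
  obtain ⟨δ, hδ, H⟩ := sum_norm_le_of_locallySmall (α := 1 / p)
    (J := fun u v => Y v - Y u - germ f (Y u) (incr X.path u v) (X.area u v))
    (RoughPath.isControl (X := X) hp0) (X.locallySmall hp0)
    (one_div_lt_one_div_of_lt hp0 hp3) hB hρ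
    (fun u v hu huv hv hle => (h u v hu huv.le hv).germ_le hle)
    (fun s hs0 hsT ε hε => exists_norm_germ_error_le hp hρ hρ1 hB hf h hs0 hsT hε) ht (half_pos hε)
  refine ⟨δ, hδ, fun π hπ => ?_⟩
  have h1 := (norm_sum_le _ _).trans (H π hπ)
  have h2 : ∑ i ∈ Finset.range π.n, (Y (π.pts (i + 1)) - Y (π.pts i)) = Y t - y₀ := by
    rw [Finset.sum_range_sub (fun i => Y (π.pts i)), π.first, π.last, hY0]
  rw [Finset.sum_sub_distrib, h2, norm_sub_rev] at h1
  exact lt_of_le_of_lt h1 (by linarith)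

end Limit

end CadlagRDE

/-! ### Uniqueness, Lipschitz estimate and bounds with explicit parameters -/

namespace CadlagRDE

variable {d k : ℕ} {p T : ℝ}

theorem RoughPath.norm_nonneg (X : RoughPath d p T) : 0 ≤ X.norm :=
  add_nonneg (pVar_nonneg _ _ _ _) (pVar_nonneg _ _ _ _)

theorem RoughPath.dist_nonneg (X W : RoughPath d p T) : 0 ≤ X.dist W :=
  add_nonneg (pVar_nonneg _ _ _ _) (pVar_nonneg _ _ _ _)

theorem RoughPath.dist_self_le (X : RoughPath d p T) (hp : 0 < p) (hT : 0 ≤ T) :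
    X.dist X ≤ 0 := by
  have cX := X.isControl hp
  have h1 := (eVar_lt_top_and_pVar_le (Ξ := incr fun t => X.path t - X.path t) hp cX hT le_rfl
    fun s t _ _ _ => by simp [incr]).2
  have h2 := (eVar_lt_top_and_pVar_le (Ξ := fun s t => X.area s t - X.area s t) (half_pos hp) cX
    hT le_rfl fun s t _ _ _ => by simp).2
  rw [zero_mul] at h1 h2
  exact add_nonpos h1 h2

theorem CoefPair.of_memCb {f g : Vec k → Vec d →L[ℝ] Vec k} {R θ : ℝ} (hR : 1 ≤ R)
    (hf : MemCb 3 f) (hg : MemCb 3 g) (hfR : cbNorm 3 f ≤ R) (hgR : cbNorm 3 g ≤ R)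
    (hθ : cbNorm 2 (fun x => f x - g x) ≤ θ) : CoefPair f g R θ where
  one_le := hR
  left := hf.boundC2_of_three.mono hfR
  left_fderiv := hf.boundC2_fderiv.mono hfR
  right := hg.boundC2_of_three.mono hgR
  sub := ((hf.sub hg).mono (by norm_num)).boundC2.mono hθ

theorem CoefPair.self_of_memCb {f : Vec k → Vec d →L[ℝ] Vec k} {R θ : ℝ} (hR : 1 ≤ R)
    (hf : MemCb 3 f) (hfR : cbNorm 3 f ≤ R) (hθ : 0 ≤ θ) : CoefPair f f R θ where
  one_le := hR
  left := hf.boundC2_of_three.mono hfR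
  left_fderiv := hf.boundC2_fderiv.mono hfR
  right := hf.boundC2_of_three.mono hfR
  sub := by
    simp only [sub_self]
    exact ⟨differentiable_const _, fun x => by simpa, fun x => by simpa, fun x y => by
      simpa using mul_nonneg hθ (_root_.norm_nonneg (x - y))⟩

/-- With equal data the stability estimate holds for every `θ > 0`; let `θ` tend to 0. The bound `R`
may depend on the two solutions. -/
theorem IsSolution.eqOn {X : RoughPath d p T} {f : Vec k → Vec d →L[ℝ] Vec k} {y₀ : Vec k}
    {Y Z : ℝ → Vec k} {Y' Z' : ℝ → Vec d →L[ℝ] Vec k} (hp : p ∈ Ioo (2 : ℝ) 3) (hT : 0 < T)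
    (hf : MemCb 3 f) (hY : IsSolution X f y₀ Y Y') (hZ : IsSolution X f y₀ Z Z') :
    ∀ t ∈ Icc 0 T, Z t = Y t ∧ Z' t = Y' t := by
  have main : ∀ t ∈ Icc 0 T, Z t = Y t := by
    intro t ht
    rcases ht.1.eq_or_lt with rfl | ht0
    · rw [hY.path_zero hT.le, hZ.path_zero hT.le]
    set R := 1 + |cbNorm 3 f| + |X.norm| + |controlledNorm p T X.path Y Y'| +
      |controlledNorm p T X.path Z Z'| with hR
    have a1 := abs_nonneg (cbNorm 3 f)
    have a2 := abs_nonneg X.norm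
    have a3 := abs_nonneg (controlledNorm p T X.path Y Y')
    have a4 := abs_nonneg (controlledNorm p T X.path Z Z')
    have b1 := le_abs_self (cbNorm 3 f)
    have b2 := le_abs_self X.norm
    have b3 := le_abs_self (controlledNorm p T X.path Y Y')
    have b4 := le_abs_self (controlledNorm p T X.path Z Z')
    have hR1 : 1 ≤ R := by linarith
    obtain ⟨B, hB1, hB⟩ := exists_pathwise_stability d k hp.2 hR1
    have key : ∀ θ > 0, ‖Y t - Z t‖ ≤ 0 + B * θ := by
      intro θ hθ
      obtain ⟨ω, -, -, h⟩ := hB p hp.1 le_rfl T hT f f y₀ y₀ X X Y Y' Z Z' θ hθ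
        (.self_of_memCb hR1 hf (by linarith) hθ.le) (by linarith) (by linarith)
        ((X.dist_self_le (by linarith [hp.1]) hT.le).trans hθ.le) hY hZ (by linarith)
        (by linarith)
      simpa using (h 0 t le_rfl ht0 ht.2).1
    have h0 : ‖Y t - Z t‖ ≤ 0 := by
      refine le_of_forall_pos_le_add fun ε hε => ?_
      have := key (ε / B) (by positivity)
      rwa [mul_div_cancel₀ _ (by positivity)] at this
    exact (sub_eq_zero.1 (norm_le_zero_iff.1 h0)).symm
  exact fun t ht => ⟨main t ht, by rw [hY.deriv_eq t ht, hZ.deriv_eq t ht, main t ht]⟩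

/-- The pointwise bounds of `exists_pathwise_stability` are converted into variations over `[0, T]`.
The Gubinelli derivatives are the coefficients along the solutions, so their difference is a second
difference covered by `CoefPair.four_point`. -/
theorem exists_controlledDist_le (d k : ℕ) {p₁ R : ℝ} (hp₁ : p₁ < 3) (hR : 1 ≤ R) :
    ∃ C : ℝ, 0 < C ∧ ∀ p, 2 < p → p ≤ p₁ → ∀ T : ℝ, 0 < T →
      ∀ (f g : Vec k → Vec d →L[ℝ] Vec k), MemCb 3 f → MemCb 3 g →
      cbNorm 3 f ≤ R → cbNorm 3 g ≤ R →
      ∀ (y₀ z₀ : Vec k) (X W : RoughPath d p T)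
        (Y : ℝ → Vec k) (Y' : ℝ → Vec d →L[ℝ] Vec k)
        (Z : ℝ → Vec k) (Z' : ℝ → Vec d →L[ℝ] Vec k), X.norm ≤ R → W.norm ≤ R →
        IsSolution X f y₀ Y Y' → IsSolution W g z₀ Z Z' →
        controlledNorm p T X.path Y Y' ≤ R → controlledNorm p T W.path Z Z' ≤ R →
          ‖Y 0 - Z 0‖ + controlledDist p T X.path W.path Y Y' Z Z' ≤
            C * (‖y₀ - z₀‖ + cbNorm 2 (fun x => f x - g x) + X.dist W) := by
  obtain ⟨B, hB1, hB⟩ := exists_pathwise_stability d k hp₁ hR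
  set Ω := 6 * R ^ 3 + 3 with hΩ
  have hΩ1 : 1 ≤ Ω := by
    have : 0 ≤ R ^ 3 := by positivity
    rw [hΩ]; linarith
  refine ⟨1 + 2 * R + R * (1 + 2 * B) * B * Ω + B * Ω ^ 2, by positivity, ?_⟩
  intro p hp2 hpp T hT f g hf hg hfR hgR y₀ z₀ X W Y Y' Z Z' hX hW hY hZ hYR hZR
  set D := ‖y₀ - z₀‖ + cbNorm 2 (fun x => f x - g x) + X.dist W with hD
  set C := 1 + 2 * R + R * (1 + 2 * B) * B * Ω + B * Ω ^ 2 with hC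
  have hC0 : 0 < C := by positivity
  have hp0 : 0 < p := by linarith
  have hcb := cbNorm_nonneg 2 (fun x => f x - g x)
  have hdist := X.dist_nonneg W
  have key : ∀ η > 0, ‖Y 0 - Z 0‖ + controlledDist p T X.path W.path Y Y' Z Z' ≤
      C * (D + η) := by
    intro η hη
    -- The control of the distance is normalised by `θ`, which must be positive even when the data
    -- coincide. The parameter `η` is removed at the end.
    set θ := cbNorm 2 (fun x => f x - g x) + X.dist W + η with hθ
    set S := ‖y₀ - z₀‖ + θ with hS
    have hθ0 : 0 < θ := by positivity
    have hn := norm_nonneg (y₀ - z₀)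
    have hS0 : 0 < S := by positivity
    have hSD : D + η = S := by rw [hS, hθ, hD]; ring
    have hfg : CoefPair f g R θ := .of_memCb hR hf hg hfR hgR (by linarith)
    obtain ⟨ω, hω, hωT, h⟩ := hB p hp2 hpp T hT f g y₀ z₀ X W Y Y' Z Z' θ hθ0 hfg hX hW
      (by linarith) hY hZ hYR hZR
    have hSB : S ≤ B * S := le_mul_of_one_le_left hS0.le hB1
    have h0 : ‖Y 0 - Z 0‖ ≤ S := by
      rw [hY.path_zero hT.le, hZ.path_zero hT.le]; linarith
    have hpt : ∀ t ∈ Icc 0 T, ‖Y t - Z t‖ ≤ B * S := by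
      intro t ht
      rcases ht.1.eq_or_lt with rfl | ht0
      · exact h0.trans hSB
      · exact (h 0 t le_rfl ht0 ht.2).1
    have hφ0 : 0 ≤ ω 0 T := hω.nonneg 0 ⟨le_rfl, hT.le⟩ T ⟨hT.le, le_rfl⟩ hT.le
    have hφ : ω 0 T ^ (1 / p) ≤ Ω := rpow_le_of_le hφ0 hΩ1 (by positivity)
      (by rw [div_le_one hp0]; linarith) hωT
    have hφ' : 0 ≤ ω 0 T ^ (1 / p) := Real.rpow_nonneg hφ0 _
    have d0 : ‖Y' 0 - Z' 0‖ ≤ 2 * R * S := by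
      rw [hY.deriv_eq 0 ⟨le_rfl, hT.le⟩, hZ.deriv_eq 0 ⟨le_rfl, hT.le⟩]
      exact hfg.norm_sub_le (by linarith) h0
    have d1 := (eVar_lt_top_and_pVar_le (Ξ := incr fun t => Y' t - Z' t) (q := p) hp0 hω hT.le
      (c := R * (1 + 2 * B) * (B * S)) (by positivity) fun s t hs hst ht => by
        have hs' : s ∈ Icc 0 T := ⟨hs, hst.le.trans ht⟩
        have ht' : t ∈ Icc 0 T := ⟨hs.trans hst.le, ht⟩
        obtain ⟨-, e1, e2, e3, -⟩ := h s t hs hst ht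
        have h4 := hfg.four_point (z := Y t) (z' := Z t) (by linarith) (hpt s hs')
        have e : incr (fun t => Y' t - Z' t) s t = f (Y t) - f (Y s) - (g (Z t) - g (Z s)) := by
          simp only [incr, hY.deriv_eq s hs', hY.deriv_eq t ht', hZ.deriv_eq s hs',
            hZ.deriv_eq t ht']
          abel
        rw [e]
        calc _ ≤ _ := h4
          _ ≤ R * (B * S * ω s t ^ (1 / p)) +
              R * (B * S) * (B * ω s t ^ (1 / p) + B * ω s t ^ (1 / p)) := by gcongr
          _ = _ := by ring).2
    have d2 := (eVar_lt_top_and_pVar_le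
      (Ξ := fun s t => remainder X.path Y Y' s t - remainder W.path Z Z' s t) (half_pos hp0) hω
      hT.le (c := B * S) (by positivity) fun s t hs hst ht => (h s t hs hst ht).2.2.2.2).2
    rw [rpow_one_div_half hφ0] at d2
    have d1' : R * (1 + 2 * B) * (B * S) * ω 0 T ^ (1 / p) ≤
        R * (1 + 2 * B) * (B * S) * Ω := by gcongr
    have d2' : B * S * (ω 0 T ^ (1 / p)) ^ 2 ≤ B * S * Ω ^ 2 := by gcongr
    calc _ ≤ S + (2 * R * S + R * (1 + 2 * B) * (B * S) * Ω + B * S * Ω ^ 2) := by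
          unfold controlledDist; linarith
      _ = C * (D + η) := by rw [hSD, hC]; ring
  refine le_of_forall_pos_le_add fun ε hε => ?_
  have := key (ε / C) (by positivity)
  rwa [mul_add, mul_div_cancel₀ _ hC0.ne'] at this

theorem exists_solution_and_bound (d k : ℕ) (hp : p ∈ Ioo (2 : ℝ) 3) {R : ℝ} (hR : 1 ≤ R) :
    ∃ C : ℝ, ∀ T : ℝ, 0 < T → ∀ f : Vec k → Vec d →L[ℝ] Vec k, MemCb 3 f → cbNorm 2 f ≤ R →
      ∀ (y₀ : Vec k) (X : RoughPath d p T), X.norm ≤ R →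
        ∃ (Y : ℝ → Vec k) (Y' : ℝ → Vec d →L[ℝ] Vec k),
          IsSolution X f y₀ Y Y' ∧ controlledNorm p T X.path Y Y' ≤ C := by
  have hp0 : 0 < p := by linarith [hp.1]
  have hp1 : 1 ≤ p := by linarith [hp.1]
  have hΩ : 1 ≤ 2 * R ^ 3 := by
    have : 1 ≤ R ^ 3 := one_le_pow₀ hR
    linarith
  obtain ⟨ρ, B, hρ, hρ1, hB, h⟩ := exists_davie_path d k hp1 hp.2 hR hΩ
  set Ω := 2 * R ^ 3 with hΩdef
  refine ⟨R + R * B * Ω + B * Ω ^ 2, fun T hT f hf hfR y₀ X hX => ?_⟩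
  have hfb : BoundC2 f R := (hf.mono (by norm_num)).boundC2.mono hfR
  have hXΩ : X.ctrl 0 T ≤ Ω := X.ctrl_le hp0 hp.2.le hR hX
  obtain ⟨Y, hY0, hY⟩ := h T hT.le f hfb y₀ X hXΩ
  refine ⟨Y, fun t => f (Y t), isSolution_of_davie hp1 hp.2 hT.le hρ hρ1 hB hfb hY0 hY,
    (isControlled_of_davie hp0 hT.le hB hfb hY).2.trans ?_⟩
  have hφ0 : 0 ≤ X.ctrl 0 T := (X.isControl hp0).nonneg 0 ⟨le_rfl, hT.le⟩ T ⟨hT.le, le_rfl⟩ hT.le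
  have hφ : X.ctrl 0 T ^ (1 / p) ≤ Ω := rpow_le_of_le hφ0 hΩ (by positivity)
    (by rw [div_le_one hp0]; linarith) hXΩ
  have hφ' : 0 ≤ X.ctrl 0 T ^ (1 / p) := Real.rpow_nonneg hφ0 _
  gcongr

end CadlagRDE

open CadlagRDE in
theorem corollary3p1 (d k : ℕ) :
    -- existence, uniqueness and the a priori bound
    (∀ p ∈ Set.Ioo (2 : ℝ) 3, ∃ Kp : ℝ≥0 × ℝ≥0 → ℝ≥0, Monotone Kp ∧
      ∀ (T : ℝ), 0 < T → ∀ (f : Vec k → Vec d →L[ℝ] Vec k), MemCb 3 f →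
      ∀ (y₀ : Vec k) (X : RoughPath d p T),
        ∃ (Y : ℝ → Vec k) (Y' : ℝ → Vec d →L[ℝ] Vec k),
          IsSolution X f y₀ Y Y' ∧
          (∀ (Z : ℝ → Vec k) (Z' : ℝ → Vec d →L[ℝ] Vec k), IsSolution X f y₀ Z Z' →
            ∀ t ∈ Set.Icc 0 T, Z t = Y t ∧ Z' t = Y' t) ∧
          controlledNorm p T X.path Y Y' ≤ Kp ((cbNorm 2 f).toNNReal, X.norm.toNNReal)) ∧
    -- local Lipschitz continuity of the solution map
    (∃ C : ℝ × ℝ × ℝ × ℝ × ℝ → ℝ, (∀ z ∈ paramRange, 0 < C z) ∧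
      (∀ A ⊆ paramRange, IsCompact A → BddAbove (C '' A)) ∧
      ∀ p ∈ Set.Ioo (2 : ℝ) 3, ∀ (T : ℝ), 0 < T →
      ∀ (f g : Vec k → Vec d →L[ℝ] Vec k), MemCb 3 f → MemCb 3 g →
      ∀ (y₀ z₀ : Vec k) (X W : RoughPath d p T)
        (Y : ℝ → Vec k) (Y' : ℝ → Vec d →L[ℝ] Vec k)
        (Z : ℝ → Vec k) (Z' : ℝ → Vec d →L[ℝ] Vec k),
        IsSolution X f y₀ Y Y' → IsSolution W g z₀ Z Z' →
        ∀ K > 0, controlledNorm p T X.path Y Y' ≤ K → controlledNorm p T W.path Z Z' ≤ K →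
          ‖Y 0 - Z 0‖ + controlledDist p T X.path W.path Y Y' Z Z' ≤
            C (p, max (cbNorm 3 f) (cbNorm 3 g), K, X.norm, W.norm) *
              (‖y₀ - z₀‖ + cbNorm 2 (fun x => f x - g x) + X.dist W)) := by
  constructor
  · intro p hp
    have hn (n : ℕ) : (1 : ℝ) ≤ n + 1 := by simp
    choose B hB using fun n : ℕ => exists_solution_and_bound d k hp (hn n)
    -- The constants `B n` need not be monotone in `n`. Summing them up to the integer bound on the
    -- two arguments makes the function monotone in both arguments.
    refine ⟨fun z => ∑ m ∈ Finset.range (⌈z.1 + z.2⌉₊ + 1), (B m).toNNReal, ?_, ?_⟩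
    · intro z w hzw
      refine Finset.sum_le_sum_of_subset (Finset.range_mono ?_)
      gcongr
      exacts [hzw.1, hzw.2]
    · intro T hT f hf y₀ X
      set n := ⌈(cbNorm 2 f).toNNReal + X.norm.toNNReal⌉₊ with hndef
      have hle : cbNorm 2 f + X.norm ≤ n := by
        have := NNReal.coe_le_coe.2 (Nat.le_ceil ((cbNorm 2 f).toNNReal + X.norm.toNNReal))
        rwa [NNReal.coe_add, Real.coe_toNNReal _ (cbNorm_nonneg 2 f),
          Real.coe_toNNReal _ X.norm_nonneg] at this
      have h1 := cbNorm_nonneg 2 f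
      have h2 := X.norm_nonneg
      obtain ⟨Y, Y', hY, hYB⟩ := hB n T hT f hf (by linarith) y₀ X (by linarith)
      refine ⟨Y, Y', hY, fun Z Z' hZ => hY.eqOn hp hT hf hZ, hYB.trans ?_⟩
      calc B n ≤ ((B n).toNNReal : ℝ) := Real.le_coe_toNNReal _
        _ ≤ _ := NNReal.coe_le_coe.2 (Finset.single_le_sum (f := fun m => (B m).toNNReal)
          (fun _ _ => zero_le) (Finset.self_mem_range_succ n))
  · have hn (n : ℕ) : (1 : ℝ) ≤ n + 1 := by simp
    have hp₁ (n : ℕ) : (3 : ℝ) - 1 / (n + 1) < 3 := by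
      have : (0 : ℝ) < 1 / (n + 1) := by positivity
      linarith
    choose B hB0 hB using fun n : ℕ => exists_controlledDist_le d k (hp₁ n) (hn n)
    -- One number bounding all parameters and growing as `p` approaches 3. With `n = ⌈s z⌉₊`, the
    -- constant for `p₁ = 3 - 1 / (n + 1)` and `R = n + 1` applies. On a compact set `s` is bounded,
    -- so only finitely many constants occur. There is no degeneration at `p = 2`, hence no term for
    -- it.
    set s : ℝ × ℝ × ℝ × ℝ × ℝ → ℝ :=
      fun z => 1 / (3 - z.1) + z.2.1 + z.2.2.1 + z.2.2.2.1 + z.2.2.2.2 with hs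
    refine ⟨fun z => B ⌈s z⌉₊, fun z _ => hB0 _, fun A hA hAc => ?_, ?_⟩
    · have hcont : ContinuousOn s A := by
        have : ∀ z ∈ A, 3 - z.1 ≠ 0 := fun z hz => (sub_pos.2 (hA hz).1.2).ne'
        fun_prop (disch := assumption)
      obtain ⟨N, hN⟩ := hAc.bddAbove_image hcont
      refine ⟨∑ m ∈ Finset.range (⌈N⌉₊ + 1), B m, ?_⟩
      rintro _ ⟨z, hz, rfl⟩
      exact Finset.single_le_sum (f := B) (fun m _ => (hB0 m).le)
        (Finset.mem_range_succ_iff.2 (Nat.ceil_mono (hN ⟨z, hz, rfl⟩)))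
    · intro p hp T hT f g hf hg y₀ z₀ X W Y Y' Z Z' hY hZ K hK hYK hZK
      have hle := Nat.le_ceil (s (p, max (cbNorm 3 f) (cbNorm 3 g), K, X.norm, W.norm))
      set n := ⌈s (p, max (cbNorm 3 f) (cbNorm 3 g), K, X.norm, W.norm)⌉₊ with hndef
      simp only [hs] at hle
      have h3 : 0 < 3 - p := by linarith [hp.2]
      have h4 : 0 < 1 / (3 - p) := by positivity
      have h5 := cbNorm_nonneg 3 f
      have h6 := le_max_left (cbNorm 3 f) (cbNorm 3 g)
      have h7 := le_max_right (cbNorm 3 f) (cbNorm 3 g)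
      have h8 := X.norm_nonneg
      have h9 := W.norm_nonneg
      have hpn : p ≤ 3 - 1 / ((n : ℝ) + 1) := by
        have : 1 / ((n : ℝ) + 1) ≤ 3 - p := by
          rw [one_div_le (by positivity) h3]
          linarith
        linarith
      exact hB n p hp.1 hpn T hT f g hf hg (by linarith) (by linarith) y₀ z₀ X W Y Y' Z Z'
        (by linarith) (by linarith) hY hZ (by linarith) (by linarith)
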